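/- Let $U\subseteq\mathbb R^4$ be open with coordinates $x^\mu$, let $g_{\mu\nu}$ be a smooth real metric on $U$ of signature $(-,+,+,+)$, with Levi-Civita connection $\tilde\Gamma^\lambda{}_{\mu\nu}$ and Ricci tensor $\tilde R_{\mu\nu}$, and let $\Gamma^\lambda{}_{\mu\nu}$ be smooth complex coefficients of an affine connection on $U$, independent of $g$. Set $R^\mu{}_{\nu\alpha\beta}=\partial_\alpha\Gamma^\mu{}_{\nu\beta}-\partial_\beta\Gamma^\mu{}_{\nu\alpha}+\Gamma^\mu{}_{\rho\alpha}\Gamma^\rho{}_{\nu\beta}-\Gamma^\mu{}_{\rho\beta}\Gamma^\rho{}_{\nu\alpha}$, $R_{\mu\nu}=R^\rho{}_{\mu\rho\nu}$, $R=g^{\mu\nu}R_{\mu\nu}$, and let $\varepsilon^{\mu\nu\alpha\beta}=\epsilon^{\mu\nu\alpha\beta}/\sqrt{-g}$ be the Levi-Civita tensor, $\epsilon^{0123}=1$; indices are moved with $g$. Let $\kappa>0$ and $\alpha\in\mathbb C$, $\alpha\neq0$. Call $(g,\Gamma)$ a solution if the action $$\frac1{2\kappa}\int d^4x\,\sqrt{-g}\,\bigl(R+\alpha\,\varepsilon^{\mu\nu\rho\sigma}R_{\mu\nu\rho\sigma}\bigr)$$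 is stationary under all smooth compactly supported variations of $g$ and of $\Gamma$. Call $N^\lambda{}_{\mu\nu}$ an admissible shift if, for smooth complex fields $\xi,\psi,V$ on $U$: * (any $\alpha$) $N^\lambda{}_{\mu\nu}=\delta^\lambda_\mu\xi_\nu$; or * ($\alpha=\pm\frac i2$) $N^\lambda{}_{\mu\nu}=\delta^\lambda_\mu\xi_\nu+\delta^\lambda_\nu\psi_\mu-\psi^\lambda g_{\mu\nu}\mp i\varepsilon^\lambda{}_{\mu\nu\rho}\psi^\rho+V^\lambda{}_{\mu\nu}$ with $V_{\lambda\mu\nu}=\pm i\varepsilon_{\lambda\mu\rho\sigma}V_\nu{}^{\rho\sigma}$, $V_{[\lambda\mu\nu]}=0$; or * ($\alpha=\pm\frac i6$) $N^\lambda{}_{\mu\nu}=\delta^\lambda_\mu\xi_\nu+V^\lambda{}_{\nu\mu}+V_{\mu\nu}{}^\lambda$ with $V_{\lambda\mu\nu}=\mp i\varepsilon_{\lambda\mu\rho\sigma}V_\nu{}^{\rho\sigma}$, $V_{[\lambda\mu\nu]}=0$. Then: 1. For every $\Gamma$ and every admissible shift $N$, the scalar $R+\alpha\varepsilon^{\mu\nu\rho\sigma}R_{\mu\nu\rho\sigma}$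 takes the same value on $\Gamma+N$ as on $\Gamma$. 2. $(g,\Gamma)$ is a solution if and only if $\tilde R_{\mu\nu}=0$ and there is an admissible shift $N$ with $\Gamma+N=\tilde\Gamma$. 3. Let $S_{\mu\nu}{}^\rho=\Gamma^\rho{}_{[\mu\nu]}$, $S_\mu=S_{\mu\rho}{}^\rho$, $\tilde S^\lambda=\varepsilon^{\lambda\alpha\beta\kappa}S_{\alpha\beta\kappa}$ and $Z_{\lambda\mu\nu}=S_{\lambda\mu\nu}-\frac13(g_{\mu\nu}S_\lambda-g_{\lambda\nu}S_\mu)-\frac16\varepsilon_{\lambda\mu\nu\rho}\tilde S^\rho$. If $(g,\Gamma)$ is a solution, then * for $\alpha\notin\{\pm\frac i2,\pm\frac i6\}$ (which includes $\alpha=\pm\frac i{2\sqrt3}$): $\Gamma^\lambda{}_{\mu\nu}=\tilde\Gamma^\lambda{}_{\mu\nu}-\frac23\delta^\lambda_\mu S_\nu$; * for $\alpha=\pm\frac i2$: $\Gamma^\lambda{}_{\mu\nu}=\tilde\Gamma^\lambda{}_{\mu\nu}+\frac16\varepsilon^\lambda{}_{\mu\nu\rho}\tilde S^\rho\pm\frac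 i6(\delta^\lambda_\mu\tilde S_\nu+\delta^\lambda_\nu\tilde S_\mu-g_{\mu\nu}\tilde S^\lambda)-\frac23\delta^\lambda_\mu S_\nu-2Z^\lambda{}_{\mu\nu}$, where $Z_{\lambda\mu\nu}=\pm i\varepsilon_{\lambda\mu\rho\sigma}Z_\nu{}^{\rho\sigma}$ and $Z_{[\lambda\mu\nu]}=0$; * for $\alpha=\pm\frac i6$: $\Gamma^\lambda{}_{\mu\nu}=\tilde\Gamma^\lambda{}_{\mu\nu}-\frac23\delta^\lambda_\mu S_\nu+\frac23(Z^\lambda{}_{\nu\mu}+Z_{\mu\nu}{}^\lambda)$, where $Z_{\lambda\mu\nu}=\mp i\varepsilon_{\lambda\mu\rho\sigma}Z_\nu{}^{\rho\sigma}$ and $Z_{[\lambda\mu\nu]}=0$. 4. The theory is equivalent to vacuum general relativity: $g$ is the metric of some solution if and only if $\tilde R_{\mu\nu}=0$, and $(g,\tilde\Gamma)$ is a solution if and only if $\tilde R_{\mu\nu}=0$. -/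

import Mathlib

open scoped ContDiff

noncomputable section

namespace MetricAffine

/-- Coordinates `(x⁰, x¹, x², x³)` on a domain of spacetime. -/
abbrev Coord : Type := Fin 4 → ℝ

/-- Components `g_{μν}(x)` of a (real) metric. -/
abbrev MetricField : Type := Coord → Matrix (Fin 4) (Fin 4) ℝ

/-- Complex covector fields `ξ_μ(x)`. -/
abbrev CovectorField : Type := Coord → Fin 4 → ℂ

/-- Complex fields with three indices. A connection `Γ` is stored as `Γ x l m n = Γ^l_{mn}(x)`. -/
abbrev Field3 : Type := Coord → Fin 4 → Fin 4 → Fin 4 → ℂ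

/-- The partial derivative `∂_m f` at `x`. -/
def pd {E : Type*} [NormedAddCommGroup E] [NormedSpace ℝ E] (m : Fin 4) (f : Coord → E)
    (x : Coord) : E :=
  fderiv ℝ f x (Pi.single m 1)

/-- The Minkowski matrix `diag(-1, 1, 1, 1)`. -/
def minkowski : Matrix (Fin 4) (Fin 4) ℝ := Matrix.diagonal ![-1, 1, 1, 1]

/-- `g` is a smooth metric of signature `(-,+,+,+)` on `U`. -/
structure IsLorentzMetric (U : Set Coord) (g : MetricField) : Prop where
  smooth : ∀ m n, ContDiffOn ℝ ∞ (fun x => g x m n) U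
  signature : ∀ x ∈ U, ∃ e : Matrix (Fin 4) (Fin 4) ℝ,
    IsUnit e.det ∧ g x = e.transpose * minkowski * e

/-- `√(-g)`. -/
def sqrtNegDet (g : MetricField) (x : Coord) : ℝ := Real.sqrt (-(g x).det)

/-- The Levi-Civita symbol, with value `1` on `(0,1,2,3)`: the product of the signs of the
differences of the later and the earlier indices. -/
def symb (a b c d : Fin 4) : ℤ :=
  let s : Fin 4 → Fin 4 → ℤ := fun i j => Int.sign ((j.val : ℤ) - (i.val : ℤ))
  s a b * s a c * s a d * s b c * s b d * s c d

/-- The Levi-Civita tensor `ε^{abcd}`, the symbol divided by `√(-g)`. -/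
def epsUp (g : MetricField) (x : Coord) (a b c d : Fin 4) : ℝ :=
  (symb a b c d : ℝ) / sqrtNegDet g x

/-- `ε_{abcd}`, obtained from `ε^{abcd}` by lowering all the indices. -/
def epsLow (g : MetricField) (x : Coord) (a b c d : Fin 4) : ℝ :=
  ∑ i, ∑ j, ∑ k, ∑ l, g x a i * g x b j * g x c k * g x d l * epsUp g x i j k l

/-- `ε^a_{bcd}`. -/
def epsMixed (g : MetricField) (x : Coord) (a b c d : Fin 4) : ℝ :=
  ∑ i, (g x)⁻¹ a i * epsLow g x i b c d

/-- `ε_{ab}^{cd}`. -/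
def epsHalf (g : MetricField) (x : Coord) (a b c d : Fin 4) : ℝ :=
  ∑ i, ∑ j, epsLow g x a b i j * (g x)⁻¹ i c * (g x)⁻¹ j d

/-- Kronecker delta. -/
def kd (a b : Fin 4) : ℂ := if a = b then 1 else 0

/-- Raises the index of a covector: `v^a = g^{ab} v_b`. -/
def raise (g : MetricField) (x : Coord) (v : Fin 4 → ℂ) (a : Fin 4) : ℂ :=
  ∑ b, ((g x)⁻¹ a b : ℂ) * v b

/-- Lowers the index of a vector: `v_a = g_{ab} v^b`. -/
def lower (g : MetricField) (x : Coord) (v : Fin 4 → ℂ) (a : Fin 4) : ℂ :=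
  ∑ b, (g x a b : ℂ) * v b

/-- The Riemann tensor
`R^m_{nab} = ∂_a Γ^m_{nb} - ∂_b Γ^m_{na} + Γ^m_{ra} Γ^r_{nb} - Γ^m_{rb} Γ^r_{na}`. -/
def riemann (Γ : Field3) (x : Coord) (m n a b : Fin 4) : ℂ :=
  pd a (fun y => Γ y m n b) x - pd b (fun y => Γ y m n a) x
    + ∑ r, (Γ x m r a * Γ x r n b - Γ x m r b * Γ x r n a)

/-- The Ricci tensor `R_{mn} = R^r_{mrn}`. -/
def ricci (Γ : Field3) (x : Coord) (m n : Fin 4) : ℂ := ∑ r, riemann Γ x r m r n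

/-- The scalar curvature `R = g^{mn} R_{mn}`. -/
def scalarCurv (g : MetricField) (Γ : Field3) (x : Coord) : ℂ :=
  ∑ m, ∑ n, ((g x)⁻¹ m n : ℂ) * ricci Γ x m n

/-- The Holst scalar `ε^{mnab} R_{mnab}`, with `R_{mnab} = g_{mr} R^r_{nab}`. -/
def holst (g : MetricField) (Γ : Field3) (x : Coord) : ℂ :=
  ∑ m, ∑ n, ∑ a, ∑ b, (epsUp g x m n a b : ℂ) * ∑ r, (g x m r : ℂ) * riemann Γ x r n a b

/-- The scalar `R + α ε^{mnab} R_{mnab}`. -/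
def lagrangian (α : ℂ) (g : MetricField) (Γ : Field3) (x : Coord) : ℂ :=
  scalarCurv g Γ x + α * holst g Γ x

/-- The action `(1/2κ) ∫_K d⁴x √(-g) (R + α ε^{mnab} R_{mnab})` over the region `K`. -/
def action (κ : ℝ) (α : ℂ) (K : Set Coord) (g : MetricField) (Γ : Field3) : ℂ :=
  (1 / (2 * (κ : ℂ))) * ∫ x in K, (sqrtNegDet g x : ℂ) * lagrangian α g Γ x

/-- `(g, Γ)` solves the vacuum field equations on `U`: the action is stationary under all smooth
compactly supported variations of the metric (with `Γ` fixed) and of the connection (with `g`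
fixed). -/
structure IsSolution (κ : ℝ) (α : ℂ) (U : Set Coord) (g : MetricField) (Γ : Field3) : Prop where
  metric_eq : ∀ K ⊆ U, IsCompact K → ∀ h : MetricField,
    (∀ m n, ContDiff ℝ ∞ (fun x => h x m n)) → (∀ x, (h x).IsSymm) → (∀ x ∉ K, h x = 0) →
    HasDerivAt (fun t : ℝ => action κ α K (fun x => g x + t • h x) Γ) 0 0
  connection_eq : ∀ K ⊆ U, IsCompact K → ∀ γ : Field3,
    ContDiff ℝ ∞ γ → (∀ x ∉ K, γ x = 0) →
    HasDerivAt (fun t : ℝ => action κ α K g (fun x => Γ x + t • γ x)) 0 0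

/-- The Levi-Civita connection
`(1/2) g^{rl} (∂_m g_{nr} + ∂_n g_{rm} - ∂_r g_{mn})`. -/
def leviCivita (g : MetricField) : Field3 := fun x l m n =>
  ((1 / 2 * ∑ r, (g x)⁻¹ r l * (pd m (fun y => g y n r) x + pd n (fun y => g y r m) x
    - pd r (fun y => g y m n) x) : ℝ) : ℂ)

/-- The vacuum Einstein equations: the Ricci tensor of the Levi-Civita connection vanishes. -/
def IsRicciFlat (U : Set Coord) (g : MetricField) : Prop :=
  ∀ x ∈ U, ∀ m n, ricci (leviCivita g) x m n = 0

/-- The projective shift `δ^l_m ξ_n`. -/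
def projShift (ξ : CovectorField) : Field3 := fun x l m n => kd l m * ξ x n

/-- The shift `δ^l_n ψ_m - ψ^l g_{mn} - s i ε^l_{mna} ψ^a`. -/
def vectorShift (s : ℂ) (g : MetricField) (ψ : CovectorField) : Field3 := fun x l m n =>
  kd l n * ψ x m - raise g x (ψ x) l * (g x m n : ℂ)
    - s * Complex.I * ∑ a, (epsMixed g x l m n a : ℂ) * raise g x (ψ x) a

/-- The shift `V^l_{mn}` of a tensor given by its components `V_{lmn}`. -/
def tensorShift (g : MetricField) (V : Field3) : Field3 := fun x l m n =>
  ∑ k, ((g x)⁻¹ l k : ℂ) * V x k m n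

/-- The shift `V^l_{nm} + V_{mn}^l` of a tensor given by its components `V_{lmn}`. -/
def tensorShiftSix (g : MetricField) (V : Field3) : Field3 := fun x l m n =>
  ∑ k, ((g x)⁻¹ l k : ℂ) * (V x k n m + V x m n k)

/-- The duality conditions `V_{lmn} = c ε_{lm}^{rs} V_{nrs}` and `V_{[lmn]} = 0` on `U`. -/
def IsDualTensor (c : ℂ) (U : Set Coord) (g : MetricField) (V : Field3) : Prop :=
  ∀ x ∈ U, ∀ l m n,
    V x l m n = c * ∑ r, ∑ s, (epsHalf g x l m r s : ℂ) * V x n r s ∧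
    V x l m n + V x m n l + V x n l m - V x m l n - V x l n m - V x n m l = 0

/-- `N` is, on `U`, one of the shifts of the connection that are available for the parameter `α`:
projective shifts for every `α`; for `α = s i/2`, `s = ±1`, sums of a projective shift, a vector
shift and a tensor shift; for `α = s i/6`, sums of a projective shift and a shift
`V^l_{nm} + V_{mn}^l`. -/
def IsGaugeShift (α : ℂ) (U : Set Coord) (g : MetricField) (N : Field3) : Prop :=
  ∃ ξ : CovectorField, ContDiffOn ℝ ∞ ξ U ∧
    ((∀ x ∈ U, N x = projShift ξ x) ∨
      (∃ s : ℂ, (s = 1 ∨ s = -1) ∧ α = s * Complex.I / 2 ∧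
        ∃ (ψ : CovectorField) (V : Field3), ContDiffOn ℝ ∞ ψ U ∧ ContDiffOn ℝ ∞ V U ∧
          IsDualTensor (s * Complex.I) U g V ∧
          ∀ x ∈ U, N x = projShift ξ x + vectorShift s g ψ x + tensorShift g V x) ∨
      (∃ s : ℂ, (s = 1 ∨ s = -1) ∧ α = s * Complex.I / 6 ∧
        ∃ V : Field3, ContDiffOn ℝ ∞ V U ∧ IsDualTensor (-(s * Complex.I)) U g V ∧
          ∀ x ∈ U, N x = projShift ξ x + tensorShiftSix g V x))

/-- Cartan torsion: `torsion Γ x m n r = S_{mn}^r = Γ^r_{[mn]}`. -/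
def torsion (Γ : Field3) : Field3 := fun x m n r => (Γ x r m n - Γ x r n m) / 2

/-- The torsion with lowered index, `S_{mnk} = S_{mn}^r g_{rk}`. -/
def torsionLow (g : MetricField) (Γ : Field3) : Field3 := fun x m n k =>
  ∑ r, torsion Γ x m n r * (g x r k : ℂ)

/-- The torsion vector `S_m = S_{mr}^r`. -/
def torsionVec (Γ : Field3) : CovectorField := fun x m => ∑ r, torsion Γ x m r r

/-- The torsion pseudo-vector `S̃^l = ε^{labk} S_{abk}` (upper index). -/
def torsionPseudo (g : MetricField) (Γ : Field3) : Coord → Fin 4 → ℂ := fun x l =>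
  ∑ a, ∑ b, ∑ k, (epsUp g x l a b k : ℂ) * torsionLow g Γ x a b k

/-- The remaining part `Z_{lmn}` of the torsion, defined by
`S_{lmn} = (1/3)(g_{mn} S_l - g_{ln} S_m) + (1/6) ε_{lmnr} S̃^r + Z_{lmn}`. -/
def torsionTensor (g : MetricField) (Γ : Field3) : Field3 := fun x l m n =>
  torsionLow g Γ x l m n
    - 1 / 3 * ((g x m n : ℂ) * torsionVec Γ x l - (g x l n : ℂ) * torsionVec Γ x m)
    - 1 / 6 * ∑ r, (epsLow g x l m n r : ℂ) * torsionPseudo g Γ x r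

/-- The form of the connection for generic `α`: `Γ̃^l_{mn} - (2/3) δ^l_m S_n`. -/
def SolvedGeneric (U : Set Coord) (g : MetricField) (Γ : Field3) : Prop :=
  ∀ x ∈ U, ∀ l m n, Γ x l m n = leviCivita g x l m n - 2 / 3 * kd l m * torsionVec Γ x n

/-- The form of the connection for `α = s i/2`: it equals
`Γ̃^l_{mn} + (1/6) ε^l_{mnr} S̃^r + (s i/6)(δ^l_m S̃_n + δ^l_n S̃_m - g_{mn} S̃^l)
- (2/3) δ^l_m S_n - 2 Z^l_{mn}`, where `Z` satisfies the duality conditions. -/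
def SolvedHalf (s : ℂ) (U : Set Coord) (g : MetricField) (Γ : Field3) : Prop :=
  IsDualTensor (s * Complex.I) U g (torsionTensor g Γ) ∧
  ∀ x ∈ U, ∀ l m n, Γ x l m n = leviCivita g x l m n
    + 1 / 6 * ∑ r, (epsMixed g x l m n r : ℂ) * torsionPseudo g Γ x r
    + s * Complex.I / 6 * (kd l m * lower g x (torsionPseudo g Γ x) n
      + kd l n * lower g x (torsionPseudo g Γ x) m - (g x m n : ℂ) * torsionPseudo g Γ x l)
    - 2 / 3 * kd l m * torsionVec Γ x n
    - 2 * tensorShift g (torsionTensor g Γ) x l m n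

/-- The form of the connection for `α = s i/6`: it equals
`Γ̃^l_{mn} - (2/3) δ^l_m S_n + (2/3) (Z^l_{nm} + Z_{mn}^l)`, where `Z` satisfies the duality
conditions. -/
def SolvedSixth (s : ℂ) (U : Set Coord) (g : MetricField) (Γ : Field3) : Prop :=
  IsDualTensor (-(s * Complex.I)) U g (torsionTensor g Γ) ∧
  ∀ x ∈ U, ∀ l m n, Γ x l m n = leviCivita g x l m n
    - 2 / 3 * kd l m * torsionVec Γ x n
    + 2 / 3 * tensorShiftSix g (torsionTensor g Γ) x l m n

end MetricAffine

end

open scoped ContDiff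
open MetricAffine

noncomputable section
namespace MetricAffine

/-! The density √(-g)(R + α εR) equals ∑ tr(P^{ab} R_{ab}), where P^{ab} = -P^{ba} is a matrix built
from g alone (`dens`) and R_{ab} is the curvature as a matrix-valued two-form. P is covariantly
constant for the Levi-Civita connection Γ̃. Hence passing from Γ to Γ + C changes the density by a
divergence, plus 2 ∑ tr(E^b(Γ - Γ̃) C_b), plus ∑ tr(E^b(C) C_b), with E^b(C) = ∑_a [P^{ab}, C_a]
(`lagDens_add`). Stationarity in Γ is thus the pointwise linear equation E(Γ - Γ̃) = 0.

To solve it, take a complex coframe with g = eᵀe and det e = i√(-g). The equation becomes one for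
the Euclidean metric in which ε is i times the symbol and α enters only through β = iα
(`algEq_act`). The matrices P^{ab} are now antisymmetric, so the equation splits. Let τ be the
antisymmetrisation of C in its first two indices. Duality commutes with the adjoint action of the
rotation algebra, so τ + β*τ solves the equation with β = 0, whose only antisymmetric solution is
zero (`eq_zero_of_palatini`). Therefore τ = -β*τ, and since the unnormalised dual squares to 4, τ =
0 unless 4β² = 1, which is α = ±i/2. In the symmetric part a trace stays free, the projective mode.
The rest is equivalent to a hook tensor h with h = 3β*h (`hookPart_dual`), so it vanishes unless
36β² = 1, which is α = ±i/6. Rewriting the solutions in terms of torsion gives the explicit forms,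
and from these the shift to Γ̃ is read off.

An admissible shift N satisfies E(N) = 0 and tr(P^{ab} N_c) = 0. The first relation removes the
cross and quadratic terms, because ∑ tr(E(C) D) is symmetric in C and D; the second removes the
divergence. This is the invariance of the Lagrangian (`lagrangian_add_eq`).

The metric equation needs more: the conditions on N depend on g, whereas Γ is held fixed when g
varies. Under δg = gA + Aᵀg the matrix P varies by the gl(4) action of A (`densVar`). Paired with
the change of curvature caused by N, every term of this action vanishes, by E(N) = 0, tr(P N) = 0,
their derivatives and the Jacobi identity (`sum_densVar_curvMat_add`). So the metric equation for Γ
is the one for Γ̃. There the Holst term drops out by the first Bianchi identity, and what remains is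
the vanishing of the Einstein tensor, equivalent to Ricci-flatness in dimension four
(`metricEq_leviCivita_iff`). -/

theorem forall_fin_four {p : Fin 4 → Prop} (h0 : p 0) (h1 : p 1) (h2 : p 2) (h3 : p 3) :
    ∀ i, p i := by
  intro i
  fin_cases i <;> assumption

/-! ### Duality with the Levi-Civita symbol -/

/-- The contraction `ε_{lmrs} X_{rs}` with the Levi-Civita symbol. -/
def dualSymb (X : Fin 4 → Fin 4 → ℂ) (l m : Fin 4) : ℂ :=
  ∑ r, ∑ s, (symb l m r s : ℂ) * X r s

theorem dualSymb_eq (X : Fin 4 → Fin 4 → ℂ) : dualSymb X =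
    ![![0, X 2 3 - X 3 2, X 3 1 - X 1 3, X 1 2 - X 2 1],
      ![X 3 2 - X 2 3, 0, X 0 3 - X 3 0, X 2 0 - X 0 2],
      ![X 1 3 - X 3 1, X 3 0 - X 0 3, 0, X 0 1 - X 1 0],
      ![X 2 1 - X 1 2, X 0 2 - X 2 0, X 1 0 - X 0 1, 0]] := by
  have h2 : Int.sign 2 = 1 := rfl
  have h3 : Int.sign 3 = 1 := rfl
  funext l m
  revert l m
  refine forall_fin_four ?_ ?_ ?_ ?_ <;> refine forall_fin_four ?_ ?_ ?_ ?_ <;>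
  simp [dualSymb, symb, Fin.sum_univ_four, h2, h3] <;> ring

theorem dualSymb_add (X Y : Fin 4 → Fin 4 → ℂ) (l m : Fin 4) :
    dualSymb (fun r s => X r s + Y r s) l m = dualSymb X l m + dualSymb Y l m := by
  simp only [dualSymb, mul_add, Finset.sum_add_distrib]

theorem dualSymb_sub (X Y : Fin 4 → Fin 4 → ℂ) (l m : Fin 4) :
    dualSymb (fun r s => X r s - Y r s) l m = dualSymb X l m - dualSymb Y l m := by
  simp only [dualSymb, mul_sub, Finset.sum_sub_distrib]

theorem dualSymb_mul (c : ℂ) (X : Fin 4 → Fin 4 → ℂ) (l m : Fin 4) :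
    dualSymb (fun r s => c * X r s) l m = c * dualSymb X l m := by
  simp only [dualSymb, Finset.mul_sum]
  exact Finset.sum_congr rfl fun r _ => Finset.sum_congr rfl fun s _ => by ring

theorem symb_swap_left (a b c d : Fin 4) : symb b a c d = -symb a b c d := by
  revert a b c d; decide

theorem symb_swap_right (a b c d : Fin 4) : symb a b d c = -symb a b c d := by
  revert a b c d; decide

theorem symb_cycle (a b c d : Fin 4) : symb b c d a = -symb a b c d := by
  revert a b c d; decide

theorem dualSymb_swap (X : Fin 4 → Fin 4 → ℂ) (l m : Fin 4) :
    dualSymb X m l = -dualSymb X l m := by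
  simp only [dualSymb, symb_swap_left l m, Int.cast_neg, neg_mul, Finset.sum_neg_distrib]

theorem dualSymb_transpose (X : Fin 4 → Fin 4 → ℂ) (l m : Fin 4) :
    dualSymb (fun r s => X s r) l m = -dualSymb X l m := by
  rw [dualSymb, Finset.sum_comm]
  simp only [dualSymb, ← Finset.sum_neg_distrib]
  refine Finset.sum_congr rfl fun r _ => Finset.sum_congr rfl fun s _ => ?_
  rw [symb_swap_right l m r s]; push_cast; ring

/-- Double duality in Euclidean signature for the dual without the factor 1/2: antisymmetric
arguments are multiplied by 4. This 4 produces the exceptional values β² = 1/4 and β² = 1/36. -/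
theorem dualSymb_dualSymb (X : Fin 4 → Fin 4 → ℂ) (l m : Fin 4) :
    dualSymb (dualSymb X) l m = 2 * (X l m - X m l) := by
  revert l m
  refine forall_fin_four ?_ ?_ ?_ ?_ <;> refine forall_fin_four ?_ ?_ ?_ ?_ <;>
  simp [dualSymb_eq] <;> ring

theorem sum_kd_left (f : Fin 4 → ℂ) (a : Fin 4) : ∑ r, kd a r * f r = f a := by
  simp [kd]

theorem sum_kd_right (f : Fin 4 → ℂ) (a : Fin 4) : ∑ r, kd r a * f r = f a := by
  simp [kd]

theorem kd_comm (a b : Fin 4) : kd a b = kd b a := by simp [kd, eq_comm]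

theorem sum_kd_self : ∑ r, kd r r = 4 := by simp [kd]

/-- The trivector `ε_{lmnr} v_r`. -/
def symbVec (v : Fin 4 → ℂ) (l m n : Fin 4) : ℂ := ∑ r, (symb l m n r : ℂ) * v r

theorem dualSymb_kd (v : Fin 4 → ℂ) (l m n : Fin 4) :
    dualSymb (fun r s => kd r n * v s) l m = symbVec v l m n := by
  simp only [dualSymb, symbVec]
  rw [Finset.sum_eq_single n]
  · simp [kd]
  · intro b _ hb; simp [kd, hb]
  · simp

theorem symbVec_swap_left (v : Fin 4 → ℂ) (l m n : Fin 4) : symbVec v m l n = -symbVec v l m n := by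
  simp only [symbVec, symb_swap_left l m, Int.cast_neg, neg_mul, Finset.sum_neg_distrib]

theorem symbVec_swap_right (v : Fin 4 → ℂ) (l m n : Fin 4) :
    symbVec v l n m = -symbVec v l m n := by
  have h : ∀ a b c d : Fin 4, symb a c b d = -symb a b c d := by decide
  simp only [symbVec, h l m n, Int.cast_neg, neg_mul, Finset.sum_neg_distrib]

theorem symbVec_cycle (v : Fin 4 → ℂ) (l m n : Fin 4) : symbVec v m n l = symbVec v l m n := by
  rw [symbVec_swap_right, symbVec_swap_left, neg_neg]

theorem symbVec_mul (c : ℂ) (v : Fin 4 → ℂ) (l m n : Fin 4) :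
    symbVec (fun r => c * v r) l m n = c * symbVec v l m n := by
  simp only [symbVec, Finset.mul_sum]
  exact Finset.sum_congr rfl fun r _ => by ring

/-- A trivector is itself a dual, so this is double duality. -/
theorem dualSymb_symbVec (v : Fin 4 → ℂ) (l m n : Fin 4) :
    dualSymb (fun r s => symbVec v r s n) l m = 2 * (kd l n * v m - kd m n * v l) := by
  have h : (fun r s => symbVec v r s n) = dualSymb (fun r s => kd r n * v s) := by
    funext r s; rw [dualSymb_kd]
  rw [h, dualSymb_dualSymb]

/-- The cyclic part of a dual is the trivector of the trace. -/
theorem dualSymb_cyclic (X : Fin 4 → Fin 4 → Fin 4 → ℂ) (l m n : Fin 4) :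
    dualSymb (fun p q => X p q n) l m + dualSymb (fun p q => X p q l) m n
      + dualSymb (fun p q => X p q m) n l
      = -symbVec (fun r => ∑ k, (X r k k - X k r k)) l m n := by
  have h2 : Int.sign 2 = 1 := rfl
  have h3 : Int.sign 3 = 1 := rfl
  revert l m n
  refine forall_fin_four ?_ ?_ ?_ ?_ <;> refine forall_fin_four ?_ ?_ ?_ ?_ <;>
  refine forall_fin_four ?_ ?_ ?_ ?_ <;>
  simp [dualSymb_eq, symbVec, Fin.sum_univ_four, symb, h2, h3] <;> ring

/-! ### Solving the connection equation in a Euclidean frame -/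

/-- The algebraic connection equation `∑ₐ [P^{ab}, C_a] = 0` for the Euclidean metric,
`P^{ab}_{nm} = (δ_{am} δ_{nb} - δ_{bm} δ_{na}) / 2 + β ε_{mnab}`. -/
def flatEq (β : ℂ) (C : Fin 4 → Fin 4 → Fin 4 → ℂ) (n m b : Fin 4) : ℂ :=
  1 / 2 * (kd n b * ∑ a, C a m a - C b m n) - 1 / 2 * (C n b m - kd b m * ∑ a, C n a a)
    + β * (dualSymb (fun k a => C k m a) b n + dualSymb (fun k a => C n k a) b m)

set_option maxHeartbeats 2000000 in
-- Duality commutes with the adjoint action of the rotation algebra: a commutator with a dualised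
-- generator is the commutator of the dualised tensor with the generator itself. This lets the
-- β-term be absorbed into the tensor.
theorem dualSymb_commutator (C : Fin 4 → Fin 4 → Fin 4 → ℂ) (n m b : Fin 4) :
    dualSymb (fun k a => C k m a - C m k a) b n + dualSymb (fun k a => C n k a - C k n a) b m =
      1 / 2 * (kd n b * ∑ a, dualSymb (fun p q => C p q a - C q p a) a m
        - dualSymb (fun p q => C p q n - C q p n) b m
        - dualSymb (fun p q => C p q m - C q p m) n b
        + kd b m * ∑ a, dualSymb (fun p q => C p q a - C q p a) n a) := by
  revert n m b
  refine forall_fin_four ?_ ?_ ?_ ?_ <;> refine forall_fin_four ?_ ?_ ?_ ?_ <;>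
  refine forall_fin_four ?_ ?_ ?_ ?_ <;>
  simp [dualSymb_eq, Fin.sum_univ_four, kd] <;> ring

/-- Once the trace is known to vanish, the equation makes θ symmetric in its last two indices. A
tensor antisymmetric in the first pair and symmetric in the last pair is zero. -/
theorem eq_zero_of_palatini {θ : Fin 4 → Fin 4 → Fin 4 → ℂ} (hθ : ∀ l m n, θ m l n = -θ l m n)
    (h : ∀ n m b, kd n b * ∑ a, θ a m a - θ b m n - θ n b m + kd b m * ∑ a, θ n a a = 0)
    (l m n : Fin 4) : θ l m n = 0 := by
  have hd : ∀ l n, θ l l n = 0 := fun l n => by linear_combination (1 / 2) * hθ l l n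
  have htr : ∀ m, ∑ a, θ a m a = -∑ a, θ m a a := fun m => by
    rw [← Finset.sum_neg_distrib]
    exact Finset.sum_congr rfl fun a _ => hθ m a a
  have hw : ∀ n, ∑ a, θ n a a = 0 := by
    intro n
    -- Contracting m with b leaves 4 - 1 - 1 = 2 times the trace.
    have h1 : ∑ b, (kd n b * ∑ a, θ a b a - θ b b n - θ n b b + kd b b * ∑ a, θ n a a) = 0 :=
      Finset.sum_eq_zero fun b _ => h n b b
    simp only [hd, sub_zero, Finset.sum_add_distrib, Finset.sum_sub_distrib, sum_kd_left,
      ← Finset.sum_mul, sum_kd_self, htr] at h1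
    linear_combination (1 / 2) * h1
  have hs : ∀ b m n, θ b m n = θ b n m := by
    intro b m n
    have := h n m b
    rw [htr, hw, hw] at this
    linear_combination -this - hθ b n m
  have h1 := hs l m n
  have h2 := hθ n l m
  have h3 := hs n l m
  have h4 := hθ m n l
  have h5 := hs m n l
  have h6 := hθ l m n
  linear_combination (1 / 2) * (h1 + h2 - h3 - h4 + h5 + h6)

/-- The matrices P^{ab} are antisymmetric in a Euclidean frame, so their commutator with the
symmetric part of C is symmetric and drops out of the difference. -/
theorem flatEq_sub_swap (β : ℂ) (C : Fin 4 → Fin 4 → Fin 4 → ℂ) (n m b : Fin 4) :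
    flatEq β C n m b - flatEq β C m n b = flatEq β (fun l m n => C l m n - C m l n) n m b := by
  simp only [flatEq, dualSymb_sub, Finset.sum_sub_distrib]
  rw [kd_comm m b, kd_comm b n]
  ring

/-- For a tensor that is antisymmetric in its first two indices, the connection equation is the
one with `β = 0` for the tensor `C + β * C`. -/
theorem flatEq_antisymm (β : ℂ) (C : Fin 4 → Fin 4 → Fin 4 → ℂ) (n m b : Fin 4) :
    flatEq β (fun l m n => C l m n - C m l n) n m b =
      flatEq 0 (fun l m n => C l m n - C m l n
        + β * dualSymb (fun p q => C p q n - C q p n) l m) n m b := by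
  simp only [flatEq, dualSymb_commutator, Finset.sum_add_distrib, ← Finset.mul_sum]
  ring

/-- By `flatEq_antisymm` the tensor τ + β*τ solves the equation with β = 0, and
`eq_zero_of_palatini` then forces it to vanish. -/
theorem antisymm_part_dual {β : ℂ} {C : Fin 4 → Fin 4 → Fin 4 → ℂ}
    (H : ∀ n m b, flatEq β C n m b = 0) (l m n : Fin 4) :
    C l m n - C m l n = -β * dualSymb (fun p q => C p q n - C q p n) l m := by
  have key := eq_zero_of_palatini (θ := fun l m n => C l m n - C m l n
        + β * dualSymb (fun p q => C p q n - C q p n) l m)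
    (fun l m n => by rw [dualSymb_swap]; ring)
    (fun n m b => by
      have h1 := flatEq_sub_swap β C n m b
      rw [flatEq_antisymm, H, H] at h1
      simp only [flatEq] at h1
      linear_combination -2 * h1) l m n
  linear_combination key

/-- Using τ = -β*τ twice gives τ = 4β²τ. -/
theorem antisymm_part_eq_zero {β : ℂ} (hβ : 4 * β ^ 2 ≠ 1) {C : Fin 4 → Fin 4 → Fin 4 → ℂ}
    (H : ∀ n m b, flatEq β C n m b = 0) (l m n : Fin 4) : C l m n - C m l n = 0 := by
  have h := antisymm_part_dual H
  have h2 : dualSymb (fun p q => C p q n - C q p n) l m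
      = -β * (4 * (C l m n - C m l n)) := by
    have : (fun p q => C p q n - C q p n)
        = fun p q => -β * dualSymb (fun p q => C p q n - C q p n) p q := by
      funext p q; exact h p q n
    rw [this, dualSymb_mul]
    change -β * dualSymb (dualSymb _) l m = _
    rw [dualSymb_dualSymb]; ring
  have h3 := h l m n
  rw [h2] at h3
  have h4 : (1 - 4 * β ^ 2) * (C l m n - C m l n) = 0 := by linear_combination h3
  exact (mul_eq_zero.mp h4).resolve_left fun h0 => hβ (by linear_combination -h0)

theorem sum_dualSymb_of_symm {Y : Fin 4 → Fin 4 → Fin 4 → ℂ} (hY : ∀ l m n, Y m l n = Y l m n)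
    (n : Fin 4) : ∑ b, dualSymb (fun k a => Y k b a) b n = 0 := by
  have h : ∀ b n k a : Fin 4, symb k n b a = -symb b n k a := by decide
  have h1 : ∑ b, dualSymb (fun k a => Y k b a) b n = -∑ b, dualSymb (fun k a => Y k b a) b n := by
    conv_lhs => simp only [dualSymb]
    rw [Finset.sum_comm]
    simp only [dualSymb, ← Finset.sum_neg_distrib]
    refine Finset.sum_congr rfl fun b _ => Finset.sum_congr rfl fun k _ =>
      Finset.sum_congr rfl fun a _ => ?_
    rw [h b n k a, hY]; push_cast; ring
  linear_combination (1 / 2) * h1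

/-- The trace `∑ₐ (C_{ama} + C_{maa})` of the symmetric part of `C`. -/
def symmTrace (C : Fin 4 → Fin 4 → Fin 4 → ℂ) (m : Fin 4) : ℂ := ∑ a, (C a m a + C m a a)

/-- The trace-free part of `C_{lmn} + C_{mln}`. -/
def symmPart (C : Fin 4 → Fin 4 → Fin 4 → ℂ) (l m n : Fin 4) : ℂ :=
  C l m n + C m l n - kd l m * symmTrace C n

/-- The hook form of the trace-free symmetric part. -/
def hookPart (C : Fin 4 → Fin 4 → Fin 4 → ℂ) (l m n : Fin 4) : ℂ :=
  symmPart C l n m - symmPart C m n l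

theorem symmPart_swap (C : Fin 4 → Fin 4 → Fin 4 → ℂ) (l m n : Fin 4) :
    symmPart C m l n = symmPart C l m n := by
  simp only [symmPart, kd_comm m l]; ring

/-- This is the part of the equation symmetric in n and m. The duals of C that occur in it are
expressed by duals of the hook form, which is what closes the system. -/
theorem symmPart_eq {β : ℂ} {C : Fin 4 → Fin 4 → Fin 4 → ℂ}
    (H : ∀ n m b, flatEq β C n m b = 0) (b m n : Fin 4) :
    symmPart C b m n + symmPart C b n m =
      β * (dualSymb (fun p q => hookPart C p q m) b n
        + dualSymb (fun p q => hookPart C p q n) b m) := by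
  have hook : ∀ b m n, dualSymb (fun p q => hookPart C p q m) b n
      = 2 * (dualSymb (fun k a => C k m a) b n + dualSymb (fun k a => C m k a) b n
        - symbVec (symmTrace C) b n m) := by
    intro b m n
    simp only [hookPart]
    rw [dualSymb_sub (fun p q => symmPart C p m q) (fun p q => symmPart C q m p),
      dualSymb_transpose (fun p q => symmPart C p m q)]
    simp only [symmPart]
    rw [dualSymb_sub (fun p q => C p m q + C m p q), dualSymb_add, dualSymb_kd]
    ring
  have h1 := H n m b
  have h2 := H m n b
  simp only [flatEq] at h1 h2
  -- The trivectors of the trace come with opposite signs and cancel, which is why the trace remains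
  -- undetermined.
  rw [hook, hook, symbVec_swap_right _ b m n]
  simp only [symmPart, symmTrace, Finset.sum_add_distrib]
  rw [kd_comm n b] at h1
  rw [kd_comm m b] at h2
  linear_combination -2 * h1 - 2 * h2

/-- The first trace vanishes by the choice of `symmTrace`. The second needs the equation: after
contraction the dual side pairs the antisymmetric symbol with a symmetric tensor. -/
theorem sum_symmPart {β : ℂ} {C : Fin 4 → Fin 4 → Fin 4 → ℂ}
    (H : ∀ n m b, flatEq β C n m b = 0) (r : Fin 4) :
    ∑ k, symmPart C r k k = 0 ∧ ∑ k, symmPart C k k r = 0 := by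
  have h1 : ∑ k, symmPart C r k k = 0 := by
    simp only [symmPart, Finset.sum_sub_distrib, sum_kd_left]
    simp only [symmTrace, Finset.sum_add_distrib]; ring
  refine ⟨h1, ?_⟩
  have h2 : ∑ b, (symmPart C b b r + symmPart C b r b) = ∑ b, β *
      (dualSymb (fun p q => hookPart C p q b) b r + dualSymb (fun p q => hookPart C p q r) b b) :=
    Finset.sum_congr rfl fun b _ => symmPart_eq H b b r
  have h3 : ∀ X b, dualSymb X b b = 0 := fun X b => by
    linear_combination (1 / 2) * dualSymb_swap X b b
  have h4 : ∑ b, dualSymb (fun p q => hookPart C p q b) b r = 0 := by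
    have h5 : ∀ b, dualSymb (fun p q => hookPart C p q b) b r
        = 2 * dualSymb (fun k a => symmPart C k b a) b r := by
      intro b
      simp only [hookPart]
      rw [dualSymb_sub (fun p q => symmPart C p b q) (fun p q => symmPart C q b p),
        dualSymb_transpose (fun p q => symmPart C p b q)]
      ring
    simp only [h5, ← Finset.mul_sum]
    rw [sum_dualSymb_of_symm (symmPart_swap C), mul_zero]
  have h6 : ∑ b, symmPart C b r b = ∑ b, symmPart C r b b :=
    Finset.sum_congr rfl fun b _ => symmPart_swap C r b b
  simp only [h3, add_zero, ← Finset.mul_sum, h4, mul_zero, Finset.sum_add_distrib, h6, h1] at h2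
  exact h2

/-- Antisymmetrising `symmPart_eq` in l and m gives twice the wanted dual plus two duals with
permuted indices. Since the hook form is trace-free, the cyclic sum of duals vanishes by
`dualSymb_cyclic`, so those two add up to one more copy. Hence the factor 3. -/
theorem hookPart_dual {β : ℂ} {C : Fin 4 → Fin 4 → Fin 4 → ℂ}
    (H : ∀ n m b, flatEq β C n m b = 0) (l m n : Fin 4) :
    hookPart C l m n = 3 * β * dualSymb (fun p q => hookPart C p q n) l m := by
  have h1 := symmPart_eq H l m n
  have h2 := symmPart_eq H m l n
  have htr : (fun r => ∑ k, (hookPart C r k k - hookPart C k r k)) = fun _ => 0 := by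
    funext r
    simp only [hookPart, Finset.sum_sub_distrib, (sum_symmPart H r).1, (sum_symmPart H r).2]
    ring
  have h3 := dualSymb_cyclic (hookPart C) l m n
  rw [htr] at h3
  have h4 : symbVec (fun _ => 0) l m n = 0 := by simp [symbVec]
  rw [h4] at h3
  rw [symmPart_swap C l m n, dualSymb_swap _ l m] at h2
  rw [dualSymb_swap _ l n] at h3
  simp only [hookPart] at *
  linear_combination h1 - h2 - β * h3

/-- A tensor symmetric in its first pair is determined by its hook form up to its totally symmetric
part. That part vanishes: in the cyclic sum of `symmPart_eq` the duals cancel in pairs. -/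
theorem symmPart_eq_hookPart {β : ℂ} {C : Fin 4 → Fin 4 → Fin 4 → ℂ}
    (H : ∀ n m b, flatEq β C n m b = 0) (l m n : Fin 4) :
    symmPart C l m n = 1 / 3 * (hookPart C l n m + hookPart C m n l) := by
  have h1 := symmPart_eq H l m n
  have h2 := symmPart_eq H m n l
  have h3 := symmPart_eq H n l m
  rw [dualSymb_swap _ l n, dualSymb_swap _ m l] at *
  rw [dualSymb_swap _ m n] at h3
  simp only [symmPart_swap C l m, symmPart_swap C l n, symmPart_swap C m n, hookPart] at *
  linear_combination (1 / 6) * (h1 + h2 + h3)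

/-- Using h = 3β*h twice gives h = 36β²h. -/
theorem hookPart_eq_zero {β : ℂ} (hβ : 36 * β ^ 2 ≠ 1) {C : Fin 4 → Fin 4 → Fin 4 → ℂ}
    (H : ∀ n m b, flatEq β C n m b = 0) (l m n : Fin 4) : hookPart C l m n = 0 := by
  have h := hookPart_dual H
  have h2 : dualSymb (fun p q => hookPart C p q n) l m = 3 * β * (4 * hookPart C l m n) := by
    have : (fun p q => hookPart C p q n)
        = fun p q => 3 * β * dualSymb (fun p q => hookPart C p q n) p q := by
      funext p q; exact h p q n
    rw [this, dualSymb_mul]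
    change 3 * β * dualSymb (dualSymb _) l m = _
    rw [dualSymb_dualSymb]; simp only [hookPart]; ring
  have h3 := h l m n
  rw [h2] at h3
  have h4 : (1 - 36 * β ^ 2) * hookPart C l m n = 0 := by linear_combination h3
  exact (mul_eq_zero.mp h4).resolve_left fun h0 => hβ (by linear_combination -h0)

/-! ### Euclidean solutions in terms of torsion -/

/-- Torsion `S_{lmn} = (C_{nlm} - C_{nml}) / 2` for the Euclidean metric. -/
def flatTorsion (C : Fin 4 → Fin 4 → Fin 4 → ℂ) (l m n : Fin 4) : ℂ := (C n l m - C n m l) / 2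

/-- The torsion vector for the Euclidean metric. -/
def flatVec (C : Fin 4 → Fin 4 → Fin 4 → ℂ) (m : Fin 4) : ℂ := ∑ r, flatTorsion C m r r

/-- The torsion pseudo-vector for the Euclidean metric. -/
def flatPseudo (C : Fin 4 → Fin 4 → Fin 4 → ℂ) (l : Fin 4) : ℂ :=
  ∑ a, ∑ b, ∑ k, (symb l a b k : ℂ) * flatTorsion C a b k

/-- The remaining part of the torsion for the Euclidean metric. -/
def flatTensor (C : Fin 4 → Fin 4 → Fin 4 → ℂ) (l m n : Fin 4) : ℂ :=
  flatTorsion C l m n - 1 / 3 * (kd m n * flatVec C l - kd l n * flatVec C m)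
    + 1 / 6 * symbVec (flatPseudo C) l m n

/-- The duality conditions for the Euclidean metric. -/
def FlatDual (c : ℂ) (V : Fin 4 → Fin 4 → Fin 4 → ℂ) : Prop :=
  ∀ l m n, V l m n = c * dualSymb (V n) l m ∧
    V l m n + V m n l + V n l m - V m l n - V l n m - V n m l = 0

/-- The trace of `P^{lm}` with `C_k` for the Euclidean metric. -/
def flatTr (β : ℂ) (C : Fin 4 → Fin 4 → Fin 4 → ℂ) (l m k : Fin 4) : ℂ :=
  1 / 2 * (C l m k - C m l k) + β * dualSymb (fun p q => C p q k) l m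

theorem dualSymb_antisymm (X : Fin 4 → Fin 4 → ℂ) (l m : Fin 4) :
    dualSymb (fun p q => X p q - X q p) l m = 2 * dualSymb X l m := by
  rw [dualSymb_sub X fun p q => X q p, dualSymb_transpose]; ring

/-- The totally antisymmetric contraction sees only the antisymmetrisation of C in its first two
indices, so duality relations for that part determine the pseudo-vector. -/
theorem flatPseudo_eq (C : Fin 4 → Fin 4 → Fin 4 → ℂ) (l : Fin 4) :
    flatPseudo C l = 1 / 2 * ∑ b, dualSymb (fun p q => C p q b - C q p b) l b := by
  have hc : ∀ a b c d : Fin 4, symb a b c d = symb a c d b := by decide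
  have h1 : ∑ a, ∑ b, ∑ k, (symb l a b k : ℂ) * C k a b = ∑ b, dualSymb (fun p q => C p q b) l b := by
    simp only [dualSymb]
    rw [Finset.sum_comm]
    refine Finset.sum_congr rfl fun b _ => ?_
    rw [Finset.sum_comm]
    refine Finset.sum_congr rfl fun k _ => Finset.sum_congr rfl fun a _ => ?_
    rw [hc]
  have h2 : ∑ a, ∑ b, ∑ k, (symb l a b k : ℂ) * C k b a =
      -∑ a, ∑ b, ∑ k, (symb l a b k : ℂ) * C k a b := by
    have hs : ∀ a b c d : Fin 4, symb a b c d = -symb a c b d := by decide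
    rw [Finset.sum_comm]
    simp only [← Finset.sum_neg_distrib]
    refine Finset.sum_congr rfl fun a _ => Finset.sum_congr rfl fun b _ =>
      Finset.sum_congr rfl fun k _ => ?_
    rw [hs]; push_cast; ring
  have h3 : flatPseudo C l = 1 / 2 * (∑ a, ∑ b, ∑ k, (symb l a b k : ℂ) * C k a b
      - ∑ a, ∑ b, ∑ k, (symb l a b k : ℂ) * C k b a) := by
    simp only [flatPseudo, flatTorsion, ← Finset.sum_sub_distrib, Finset.mul_sum]
    refine Finset.sum_congr rfl fun a _ => Finset.sum_congr rfl fun b _ =>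
      Finset.sum_congr rfl fun k _ => ?_
    ring
  rw [h3, h2, h1]
  simp only [dualSymb_antisymm, ← Finset.mul_sum]
  ring

/-- By the cyclic identity, antisymmetrising V_{npq} in p and q gives -V_{pqn}. Thus a dual over the
last pair is -1/2 times the dual over the first pair, the pair in which the connection equation
supplies its duality. -/
theorem dualSymb_first {V : Fin 4 → Fin 4 → Fin 4 → ℂ} (ha : ∀ l m n, V m l n = -V l m n)
    (hc : ∀ l m n, V l m n + V m n l + V n l m = 0) (l m n : Fin 4) :
    dualSymb (V n) l m = -(1 / 2) * dualSymb (fun p q => V p q n) l m := by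
  have h1 := dualSymb_antisymm (V n) l m
  have h2 : (fun p q => V n p q - V n q p) = fun p q => -1 * V p q n := by
    funext p q; linear_combination hc p q n - ha n q p
  rw [h2, dualSymb_mul] at h1
  linear_combination -(1 / 2) * h1

theorem FlatDual.swap {c : ℂ} {V : Fin 4 → Fin 4 → Fin 4 → ℂ} (h : FlatDual c V) (l m n : Fin 4) :
    V m l n = -V l m n := by
  rw [(h l m n).1, (h m l n).1, dualSymb_swap]; ring

theorem FlatDual.cyclic {c : ℂ} {V : Fin 4 → Fin 4 → Fin 4 → ℂ} (h : FlatDual c V)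
    (l m n : Fin 4) : V l m n + V m n l + V n l m = 0 := by
  linear_combination (1 / 2) * (h l m n).2 + (1 / 2) * (h.swap l m n + h.swap n l m + h.swap m n l)

theorem FlatDual.eq_dual {c : ℂ} {V : Fin 4 → Fin 4 → Fin 4 → ℂ} (h : FlatDual c V)
    (l m n : Fin 4) : V l m n = -(c / 2) * dualSymb (fun p q => V p q n) l m := by
  rw [(h l m n).1, dualSymb_first h.swap h.cyclic]; ring

theorem flatDual_of {c : ℂ} {V : Fin 4 → Fin 4 → Fin 4 → ℂ} (ha : ∀ l m n, V m l n = -V l m n)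
    (hc : ∀ l m n, V l m n + V m n l + V n l m = 0)
    (hd : ∀ l m n, V l m n = -(c / 2) * dualSymb (fun p q => V p q n) l m) : FlatDual c V := by
  intro l m n
  refine ⟨?_, ?_⟩
  · rw [dualSymb_first ha hc]
    linear_combination hd l m n
  · linear_combination 2 * hc l m n - ha l m n - ha n l m - ha m n l

/-- A projective term contributes -(3/2)ξ to the torsion vector. This is the origin of the
coefficient 2/3 in all explicit forms. -/
theorem sum_antisymm_trace {C : Fin 4 → Fin 4 → Fin 4 → ℂ} {ξ : Fin 4 → ℂ}
    {W : Fin 4 → Fin 4 → Fin 4 → ℂ} (hC : ∀ l m n, C l m n = W l m n + kd l m * ξ n)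
    (m : Fin 4) : flatVec C m = flatVec W m - 3 / 2 * ξ m := by
  simp only [flatVec, flatTorsion, hC]
  have h : ∀ r, (W r m r + kd r m * ξ r - (W r r m + kd r r * ξ m)) / 2
      = (W r m r - W r r m) / 2 + 1 / 2 * (kd r m * ξ r) - 1 / 2 * (kd r r * ξ m) := fun r => by ring
  simp only [h, Finset.sum_add_distrib, Finset.sum_sub_distrib, ← Finset.mul_sum, sum_kd_right,
    ← Finset.sum_mul, sum_kd_self]
  ring

theorem flat_generic {β : ℂ} (h4 : 4 * β ^ 2 ≠ 1) (h36 : 36 * β ^ 2 ≠ 1)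
    {C : Fin 4 → Fin 4 → Fin 4 → ℂ} (H : ∀ n m b, flatEq β C n m b = 0) (l m n : Fin 4) :
    C l m n = -(2 / 3) * kd l m * flatVec C n := by
  have hC : ∀ l m n, C l m n = (fun _ _ _ => 0 : Fin 4 → Fin 4 → Fin 4 → ℂ) l m n
      + kd l m * (1 / 2 * symmTrace C n) := by
    intro l m n
    have h1 := antisymm_part_eq_zero h4 H l m n
    have h2 := symmPart_eq_hookPart H l m n
    rw [hookPart_eq_zero h36 H, hookPart_eq_zero h36 H, symmPart] at h2
    linear_combination (1 / 2) * h1 + (1 / 2) * h2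
  have hv := sum_antisymm_trace (ξ := fun n => 1 / 2 * symmTrace C n) hC n
  rw [hv, hC l m n]
  simp only [flatVec, flatTorsion, sub_self, zero_div, Finset.sum_const_zero]
  ring

/-- Here the hook part is zero and τ satisfies τ = (s/2)*τ. Such a τ decomposes into its trace, a
trivector tied to that trace, and a remainder obeying the same duality; the remainder is
proportional to the tensor part of the torsion. -/
theorem flat_half {s : ℂ} (hs : s = 1 ∨ s = -1) {C : Fin 4 → Fin 4 → Fin 4 → ℂ}
    (H : ∀ n m b, flatEq (-(s / 2)) C n m b = 0) :
    FlatDual (-s) (flatTensor C) ∧ ∀ l m n, C l m n =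
      -(1 / 6) * symbVec (flatPseudo C) l m n
      - s / 6 * (kd l m * flatPseudo C n + kd l n * flatPseudo C m - kd m n * flatPseudo C l)
      - 2 / 3 * kd l m * flatVec C n - 2 * flatTensor C l m n := by
  have hss : s * s = 1 := by rcases hs with rfl | rfl <;> norm_num
  have h36 : 36 * (-(s / 2)) ^ 2 ≠ 1 := by
    rw [show 36 * (-(s / 2)) ^ 2 = 9 * (s * s) by ring, hss]; norm_num
  obtain ⟨τ, hτ⟩ : ∃ τ : Fin 4 → Fin 4 → Fin 4 → ℂ, τ = fun l m n => C l m n - C m l n := ⟨_, rfl⟩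
  obtain ⟨w, hw⟩ : ∃ w : Fin 4 → ℂ, w = fun m => ∑ k, τ m k k := ⟨_, rfl⟩
  have ha : ∀ l m n, τ m l n = -τ l m n := fun l m n => by rw [hτ]; ring
  have hd : ∀ l m n, τ l m n = s / 2 * dualSymb (fun p q => τ p q n) l m := by
    intro l m n
    have := antisymm_part_dual H l m n
    rw [hτ]; linear_combination this
  have hd' : ∀ l m n, dualSymb (fun p q => τ p q n) l m = 2 * s * τ l m n := by
    intro l m n
    linear_combination -2 * s * hd l m n - dualSymb (fun p q => τ p q n) l m * hss
  have hC : ∀ l m n, C l m n = 1 / 2 * τ l m n + kd l m * (1 / 2 * symmTrace C n) := by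
    intro l m n
    have h2 := symmPart_eq_hookPart H l m n
    rw [hookPart_eq_zero h36 H, hookPart_eq_zero h36 H, symmPart] at h2
    rw [hτ]
    linear_combination (1 / 2) * h2
  have hv : ∀ m, flatVec C m = -(1 / 4) * w m - 3 / 4 * symmTrace C m := by
    intro m
    rw [sum_antisymm_trace (W := fun l m n => 1 / 2 * τ l m n)
      (ξ := fun n => 1 / 2 * symmTrace C n) hC m, hw]
    have h1 : ∀ r, (1 / 2 * τ r m r - 1 / 2 * τ r r m) / 2 = -(1 / 4) * τ m r r := fun r => by
      linear_combination (1 / 4) * ha m r r - (1 / 8) * ha r r m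
    simp only [flatVec, flatTorsion, h1, ← Finset.mul_sum]
    ring
  -- Self-duality turns the pseudo-trace of τ into its trace, so the trace of τ can be expressed by
  -- the torsion pseudo-vector.
  have hp : ∀ l, flatPseudo C l = s * w l := by
    intro l
    have h1 : ∀ b, dualSymb (fun p q => C p q b - C q p b) l b = 2 * s * τ l b b := fun b => by
      rw [← hd', hτ]
    rw [flatPseudo_eq]
    simp only [h1, ← Finset.mul_sum, hw]
    ring
  have hu : ∀ l m n, symbVec (flatPseudo C) l m n = s * symbVec w l m n := by
    intro l m n
    rw [← symbVec_mul]; congr 1; funext r; exact hp r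
  -- The totally antisymmetric part of τ is also fixed by its trace, through `dualSymb_cyclic`.
  have hcyc : ∀ l m n, τ l m n + τ m n l + τ n l m = -s * symbVec w l m n := by
    intro l m n
    have h1 := dualSymb_cyclic τ l m n
    have h2 : (fun r => ∑ k, (τ r k k - τ k r k)) = fun r => 2 * w r := by
      funext r
      rw [hw, Finset.mul_sum]
      exact Finset.sum_congr rfl fun k _ => by rw [ha r k k]; ring
    rw [h2, symbVec_mul, hd', hd', hd'] at h1
    linear_combination (s / 2) * h1 - (τ l m n + τ m n l + τ n l m) * hss
  have hZ : ∀ l m n, flatTensor C l m n = -(1 / 4) * (τ l m n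
      + 1 / 3 * (s * symbVec w l m n + (kd l n * w m - kd m n * w l))) := by
    intro l m n
    rw [flatTensor, flatTorsion, hu, hv, hv, hC n l m, hC n m l, kd_comm n l, kd_comm n m]
    linear_combination (1 / 4) * hcyc l m n - (1 / 4) * ha m n l
  refine ⟨flatDual_of ?_ ?_ ?_, ?_⟩
  · intro l m n
    rw [hZ, hZ, symbVec_swap_left, ha l m n]; ring
  · intro l m n
    have h1 := symbVec_cycle w l m n
    have h2 := symbVec_cycle w m n l
    rw [hZ, hZ, hZ, h2, h1, kd_comm m l, kd_comm n l, kd_comm n m]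
    linear_combination -(1 / 4) * hcyc l m n
  · intro l m n
    have h1 : (fun p q => flatTensor C p q n) = fun p q => -(1 / 4) * (τ p q n
        + 1 / 3 * (s * symbVec w p q n + (kd p n * w q - kd q n * w p))) := by
      funext p q; exact hZ p q n
    rw [h1, dualSymb_mul, dualSymb_add, dualSymb_mul, dualSymb_add, dualSymb_mul,
      dualSymb_symbVec, dualSymb_antisymm (fun p q => kd p n * w q), dualSymb_kd, hZ, hd']
    linear_combination -((1 / 4) * (τ l m n + 1 / 3 * (kd l n * w m - kd m n * w l))) * (-hss)
  · intro l m n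
    rw [hu, hp, hp, hp, hv, hZ, hC l m n]
    linear_combination -((1 / 6) * (kd l m * w n + kd l n * w m - kd m n * w l)) * (-hss)

/-- Now τ = 0, so the pseudo-vector vanishes and the torsion comes from the symmetric part alone:
its tensor part is a quarter of the hook form, whose duality it inherits. -/
theorem flat_sixth {s : ℂ} (hs : s = 1 ∨ s = -1) {C : Fin 4 → Fin 4 → Fin 4 → ℂ}
    (H : ∀ n m b, flatEq (-(s / 6)) C n m b = 0) :
    FlatDual s (flatTensor C) ∧ ∀ l m n, C l m n =
      -(2 / 3) * kd l m * flatVec C n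
        + 2 / 3 * (flatTensor C l n m + flatTensor C m n l) := by
  have hss : s * s = 1 := by rcases hs with rfl | rfl <;> norm_num
  have h4 : 4 * (-(s / 6)) ^ 2 ≠ 1 := by
    rw [show 4 * (-(s / 6)) ^ 2 = 1 / 9 * (s * s) by ring, hss]; norm_num
  have hτ := antisymm_part_eq_zero h4 H
  have hX := symmPart_eq_hookPart H
  have hC : ∀ l m n, C l m n = 1 / 2 * symmPart C l m n + kd l m * (1 / 2 * symmTrace C n) := by
    intro l m n
    rw [symmPart]
    linear_combination (1 / 2) * hτ l m n
  have hv : ∀ m, flatVec C m = -(3 / 4) * symmTrace C m := by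
    intro m
    rw [sum_antisymm_trace (W := fun l m n => 1 / 2 * symmPart C l m n)
      (ξ := fun n => 1 / 2 * symmTrace C n) hC m]
    have h1 : ∀ r, (1 / 2 * symmPart C r m r - 1 / 2 * symmPart C r r m) / 2
        = 1 / 4 * symmPart C m r r - 1 / 4 * symmPart C r r m := fun r => by
      rw [symmPart_swap C m r r]; ring
    simp only [flatVec, flatTorsion, h1, ← Finset.mul_sum, Finset.sum_sub_distrib,
      (sum_symmPart H m).1, (sum_symmPart H m).2]
    ring
  have hp : flatPseudo C = fun _ => 0 := by
    funext l
    rw [flatPseudo_eq]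
    simp [hτ, dualSymb]
  have hZ : ∀ l m n, flatTensor C l m n = 1 / 4 * hookPart C l m n := by
    intro l m n
    have h0 : symbVec (fun _ => 0) l m n = 0 := by simp [symbVec]
    rw [flatTensor, flatTorsion, hp, h0, hv, hv, hC n l m, hC n m l, kd_comm n l, kd_comm n m,
      hookPart, symmPart_swap C l n, symmPart_swap C m n]
    ring
  refine ⟨flatDual_of ?_ ?_ ?_, ?_⟩
  · intro l m n
    rw [hZ, hZ, hookPart, hookPart]; ring
  · intro l m n
    rw [hZ, hZ, hZ]
    simp only [hookPart, symmPart_swap C l m, symmPart_swap C l n, symmPart_swap C m n]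
    ring
  · intro l m n
    have h1 : (fun p q => flatTensor C p q n) = fun p q => 1 / 4 * hookPart C p q n := by
      funext p q; exact hZ p q n
    rw [h1, dualSymb_mul, hZ]
    linear_combination (1 / 4) * hookPart_dual H l m n
  · intro l m n
    rw [hZ, hZ, hv]
    linear_combination hC l m n + (1 / 2) * hX l m n

/-! ### Shifts that solve the Euclidean equation -/

theorem flatEq_add (β : ℂ) (C D : Fin 4 → Fin 4 → Fin 4 → ℂ) (n m b : Fin 4) :
    flatEq β (fun l m n => C l m n + D l m n) n m b = flatEq β C n m b + flatEq β D n m b := by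
  simp only [flatEq, dualSymb_add, Finset.sum_add_distrib]; ring

theorem flatEq_proj (β : ℂ) (ξ : Fin 4 → ℂ) (n m b : Fin 4) :
    flatEq β (fun l m n => kd l m * ξ n) n m b = 0 := by
  have h1 : (fun k a => kd n k * ξ a) = fun k a => kd k n * ξ a := by
    funext k a; rw [kd_comm]
  simp only [flatEq, sum_kd_right, sum_kd_left]
  rw [h1, dualSymb_kd, dualSymb_kd, symbVec_swap_right ξ b m n]
  ring

theorem flatTr_add (β : ℂ) (C D : Fin 4 → Fin 4 → Fin 4 → ℂ) (n m b : Fin 4) :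
    flatTr β (fun l m n => C l m n + D l m n) n m b = flatTr β C n m b + flatTr β D n m b := by
  simp only [flatTr, dualSymb_add]; ring

/-- An antisymmetric matrix has zero trace pairing with a symmetric one. -/
theorem flatTr_of_symm (β : ℂ) {C : Fin 4 → Fin 4 → Fin 4 → ℂ} (hC : ∀ l m n, C m l n = C l m n)
    (l m n : Fin 4) : flatTr β C l m n = 0 := by
  have h1 := dualSymb_transpose (fun p q => C p q n) l m
  simp only [hC] at h1
  rw [flatTr, hC l m n]
  linear_combination (β / 2) * h1

theorem flatTr_proj (β : ℂ) (ξ : Fin 4 → ℂ) (l m k : Fin 4) :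
    flatTr β (fun l m n => kd l m * ξ n) l m k = 0 :=
  flatTr_of_symm β (fun l m n => by rw [kd_comm]) l m k

/-- The hypotheses say A + β*A = 0. This sum is the pairing of P with A, and by `flatEq_antisymm`
the equation depends on A only through it. -/
theorem flat_shift_of_dual {β : ℂ} {A : Fin 4 → Fin 4 → Fin 4 → ℂ}
    (ha : ∀ l m n, A m l n = -A l m n)
    (hd : ∀ l m n, A l m n = -β * dualSymb (fun p q => A p q n) l m) (n m b : Fin 4) :
    flatEq β A n m b = 0 ∧ flatTr β A n m b = 0 := by
  have h1 : A = fun l m n => 1 / 2 * A l m n - 1 / 2 * A m l n := by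
    funext l m n; rw [ha l m n]; ring
  refine ⟨?_, ?_⟩
  · rw [h1, flatEq_antisymm]
    have h2 : ∀ n, (fun p q => 1 / 2 * A p q n - 1 / 2 * A q p n) = fun p q => A p q n := by
      intro n; funext p q; rw [ha p q n]; ring
    have h3 : (fun l m n => 1 / 2 * A l m n - 1 / 2 * A m l n
        + β * dualSymb (fun p q => 1 / 2 * A p q n - 1 / 2 * A q p n) l m)
        = fun _ _ _ => (0 : ℂ) := by
      funext l m n
      rw [h2]
      linear_combination hd l m n - (1 / 2) * ha l m n
    rw [h3]
    simp [flatEq]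
  · rw [flatTr]
    linear_combination hd n m b - (1 / 2) * ha n m b

theorem flat_shift_half {s : ℂ} (hs : s = 1 ∨ s = -1) (ξ ψ : Fin 4 → ℂ)
    {V : Fin 4 → Fin 4 → Fin 4 → ℂ} (hV : FlatDual (-s) V) (n m b : Fin 4) :
    flatEq (-(s / 2)) (fun l m n => kd l m * ξ n
      + (kd l n * ψ m - ψ l * kd m n + s * symbVec ψ l m n + V l m n)) n m b = 0 ∧
    flatTr (-(s / 2)) (fun l m n => kd l m * ξ n
      + (kd l n * ψ m - ψ l * kd m n + s * symbVec ψ l m n + V l m n)) n m b = 0 := by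
  have hss : s * s = 1 := by rcases hs with rfl | rfl <;> norm_num
  have key := flat_shift_of_dual (β := -(s / 2))
    (A := fun l m n => kd l n * ψ m - ψ l * kd m n + s * symbVec ψ l m n + V l m n)
    (fun l m n => by rw [symbVec_swap_left, hV.swap l m n]; ring)
    (fun l m n => by
      have h1 : ∀ p q, kd p n * ψ q - ψ p * kd q n = kd p n * ψ q - kd q n * ψ p :=
        fun p q => by ring
      simp only [h1]
      rw [dualSymb_add, dualSymb_add, dualSymb_mul, dualSymb_symbVec,
        dualSymb_antisymm (fun p q => kd p n * ψ q), dualSymb_kd]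
      linear_combination hV.eq_dual l m n - (kd l n * ψ m - kd m n * ψ l) * hss) n m b
  rw [flatEq_add, flatTr_add, flatEq_proj, flatTr_proj, key.1, key.2]
  simp

/-- The shift is symmetric in its first two indices, hence has zero pairing with P. The traces of V
vanish, and duality cancels what remains of the equation. -/
theorem flat_shift_sixth {s : ℂ} (hs : s = 1 ∨ s = -1) (ξ : Fin 4 → ℂ)
    {V : Fin 4 → Fin 4 → Fin 4 → ℂ} (hV : FlatDual s V) (n m b : Fin 4) :
    flatEq (-(s / 6)) (fun l m n => kd l m * ξ n + (V l n m + V m n l)) n m b = 0 ∧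
    flatTr (-(s / 6)) (fun l m n => kd l m * ξ n + (V l n m + V m n l)) n m b = 0 := by
  have hss : s * s = 1 := by rcases hs with rfl | rfl <;> norm_num
  have hsym : ∀ l m n, V m n l + V l n m = V l n m + V m n l := fun l m n => by ring
  have ha := hV.swap
  have hc := hV.cyclic
  -- A cyclic relabelling in the symbol equates the sum X of first-pair duals with the sum of
  -- last-pair duals, which is -X/2.
  have htr : ∀ l, ∑ b, dualSymb (fun p q => V p q b) l b = 0 := by
    intro l
    have hcy : ∀ a b c d : Fin 4, symb a b c d = symb a c d b := by decide
    have h1 : ∑ b, dualSymb (fun p q => V p q b) l b = ∑ b, dualSymb (V b) l b := by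
      simp only [dualSymb]
      rw [Finset.sum_comm]
      refine Finset.sum_congr rfl fun r _ => ?_
      rw [Finset.sum_comm]
      refine Finset.sum_congr rfl fun s _ => Finset.sum_congr rfl fun b _ => ?_
      rw [hcy]
    simp only [dualSymb_first ha hc, ← Finset.mul_sum] at h1
    linear_combination (2 / 3) * h1
  have hv : ∀ l, ∑ b, V l b b = 0 := by
    intro l
    rw [Finset.sum_congr rfl fun b _ => hV.eq_dual l b b, ← Finset.mul_sum, htr, mul_zero]
  have hv2 : ∀ l, ∑ b, V b b l = 0 := fun l =>
    Finset.sum_eq_zero fun b _ => by linear_combination (1 / 2) * ha b b l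
  -- Antisymmetrisation in k and a triples V by the cyclic identity, and the dual of V is -2sV. With
  -- the 1/2 from antisymmetrising this gives -3s, which meets β = -s/6 to produce 1/2.
  have hdual : ∀ m b n, dualSymb (fun k a => V k a m + V m a k) b n = -3 * s * V b n m := by
    intro m b n
    have h1 := dualSymb_antisymm (fun k a => V k a m + V m a k) b n
    have h2 : (fun k a => V k a m + V m a k - (V a k m + V m k a)) = fun k a => 3 * V k a m := by
      funext k a; linear_combination -hc k a m - ha k a m + ha m a k
    rw [h2, dualSymb_mul] at h1
    linear_combination -(1 / 2) * h1 + 3 * s * hV.eq_dual b n m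
      - (3 / 2) * dualSymb (fun p q => V p q m) b n * hss
  refine ⟨?_, ?_⟩
  · have h1 : (fun k a => V n a k + V k a n) = fun k a => V k a n + V n a k := by
      funext k a; ring
    rw [flatEq_add, flatEq_proj, flatEq]
    simp only [Finset.sum_add_distrib, hv, hv2]
    rw [h1, hdual, hdual]
    linear_combination (-(1 / 2)) * (hc b n m + hc b m n)
      + (1 / 2) * (ha b m n + ha b n m) + (1 / 2) * (V b n m + V b m n) * hss
  · rw [flatTr_add, flatTr_proj, flatTr_of_symm _ (fun l m n => hsym l m n), add_zero]

/-! ### Determinants, tensor actions and complex coframes -/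

open Matrix

/-- Complex square matrices indexed by the spacetime coordinates. -/
abbrev CMat : Type := Matrix (Fin 4) (Fin 4) ℂ

theorem det_eq_sum_dualSymb (M : CMat) :
    M.det = ∑ i, ∑ j, M i 0 * M j 1 * dualSymb (fun k l => M k 2 * M l 3) i j := by
  rw [Matrix.det_succ_column_zero]
  simp [Fin.sum_univ_four, dualSymb_eq, Matrix.det_fin_three, Fin.succAbove]
  ring

/-- The left side is the determinant of the matrix formed by columns a, b, c, d of M. That matrix is
M times a column selection, whose determinant is the symbol. -/
theorem det_mul_symb (M : CMat) (a b c d : Fin 4) :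
    ∑ i, ∑ j, ∑ k, ∑ l, M i a * (M j b * (M k c * (M l d * (symb i j k l : ℂ))))
      = M.det * symb a b c d := by
  have key : ∀ (N : CMat) (a b c d : Fin 4), (N.submatrix id ![a, b, c, d]).det =
      ∑ i, ∑ j, ∑ k, ∑ l, N i a * (N j b * (N k c * (N l d * (symb i j k l : ℂ)))) := by
    intro N a b c d
    rw [det_eq_sum_dualSymb]
    refine Finset.sum_congr rfl fun i _ => Finset.sum_congr rfl fun j _ => ?_
    simp only [dualSymb, Finset.mul_sum]
    refine Finset.sum_congr rfl fun k _ => Finset.sum_congr rfl fun l _ => ?_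
    simp
    ring
  have h1 : M.submatrix id ![a, b, c, d] = M * (1 : CMat).submatrix id ![a, b, c, d] := by
    ext i j
    simp [Matrix.mul_apply, Matrix.one_apply]
  rw [← key, h1, Matrix.det_mul, key]
  simp [Matrix.one_apply]

/-- Three contractions of the symbol with a matrix, in terms of one with its inverse. -/
theorem symb_contract {M N : CMat} (h : M * N = 1) (a b c q : Fin 4) :
    ∑ i, ∑ j, ∑ k, M i a * (M j b * (M k c * (symb i j k q : ℂ)))
      = M.det * ∑ d, (symb a b c d : ℂ) * N d q := by
  obtain ⟨f, hf⟩ : ∃ f : Fin 4 → ℂ, f = fun q =>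
    ∑ i, ∑ j, ∑ k, M i a * (M j b * (M k c * (symb i j k q : ℂ))) := ⟨_, rfl⟩
  have h1 : ∀ d, ∑ l, f l * M l d = M.det * symb a b c d := by
    intro d
    rw [← det_mul_symb, hf]
    simp only [Finset.sum_mul]
    rw [Finset.sum_comm]
    refine Finset.sum_congr rfl fun i _ => ?_
    rw [Finset.sum_comm]
    refine Finset.sum_congr rfl fun j _ => ?_
    rw [Finset.sum_comm]
    exact Finset.sum_congr rfl fun k _ => Finset.sum_congr rfl fun l _ => by ring
  have h2 : f ᵥ* M = fun d => M.det * symb a b c d := by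
    funext d; rw [← h1]; rfl
  have h3 : f = (fun d => M.det * (symb a b c d : ℂ)) ᵥ* N := by
    rw [← h2, Matrix.vecMul_vecMul, h, Matrix.vecMul_one]
  have h4 := congrFun h3 q
  rw [hf] at h4
  refine h4.trans ?_
  rw [Matrix.vecMul, dotProduct, Finset.mul_sum]
  exact Finset.sum_congr rfl fun d _ => by ring

/-- `(A ⊗ B ⊗ D) T`. -/
def act (A B D : CMat) (T : Fin 4 → Fin 4 → Fin 4 → ℂ) (l m n : Fin 4) : ℂ :=
  ∑ i, A l i * ∑ j, B m j * ∑ k, D n k * T i j k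

theorem act_first (E A B D : CMat) (T : Fin 4 → Fin 4 → Fin 4 → ℂ) (l m n : Fin 4) :
    ∑ r, E l r * act A B D T r m n = act (E * A) B D T l m n := by
  simp only [act, Matrix.mul_apply, Finset.sum_mul, Finset.mul_sum]
  rw [Finset.sum_comm]
  refine Finset.sum_congr rfl fun i _ => ?_
  rw [Finset.sum_comm]
  refine Finset.sum_congr rfl fun j _ => ?_
  rw [Finset.sum_comm]
  exact Finset.sum_congr rfl fun k _ => Finset.sum_congr rfl fun r _ => by ring

theorem act_swap_left (A B D : CMat) (T : Fin 4 → Fin 4 → Fin 4 → ℂ) (l m n : Fin 4) :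
    act A B D T l m n = act B A D (fun i j k => T j i k) m l n := by
  simp only [act, Finset.mul_sum]
  rw [Finset.sum_comm]
  exact Finset.sum_congr rfl fun i _ => Finset.sum_congr rfl fun j _ =>
    Finset.sum_congr rfl fun k _ => by ring

theorem act_swap_right (A B D : CMat) (T : Fin 4 → Fin 4 → Fin 4 → ℂ) (l m n : Fin 4) :
    act A B D T l m n = act A D B (fun i j k => T i k j) l n m := by
  simp only [act, Finset.mul_sum]
  refine Finset.sum_congr rfl fun i _ => ?_
  rw [Finset.sum_comm]
  exact Finset.sum_congr rfl fun j _ => Finset.sum_congr rfl fun k _ => by ring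

theorem act_second (E A B D : CMat) (T : Fin 4 → Fin 4 → Fin 4 → ℂ) (l m n : Fin 4) :
    ∑ r, E m r * act A B D T l r n = act A (E * B) D T l m n := by
  rw [act_swap_left, ← act_first]
  exact Finset.sum_congr rfl fun r _ => by rw [act_swap_left]

theorem act_third (E A B D : CMat) (T : Fin 4 → Fin 4 → Fin 4 → ℂ) (l m n : Fin 4) :
    ∑ r, E n r * act A B D T l m r = act A B (E * D) T l m n := by
  rw [act_swap_right, ← act_second]
  exact Finset.sum_congr rfl fun r _ => by rw [act_swap_right]

theorem act_one (T : Fin 4 → Fin 4 → Fin 4 → ℂ) : act 1 1 1 T = T := by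
  funext l m n
  simp [act, Matrix.one_apply]

theorem act_act (A B D A' B' D' : CMat) (T : Fin 4 → Fin 4 → Fin 4 → ℂ) :
    act A B D (act A' B' D' T) = act (A * A') (B * B') (D * D') T := by
  funext l m n
  rw [act]
  simp only [act_third, act_second, act_first]

theorem act_add (A B D : CMat) (T S : Fin 4 → Fin 4 → Fin 4 → ℂ) (l m n : Fin 4) :
    act A B D (fun i j k => T i j k + S i j k) l m n = act A B D T l m n + act A B D S l m n := by
  simp only [act, mul_add, Finset.sum_add_distrib]

theorem act_mul (A B D : CMat) (c : ℂ) (T : Fin 4 → Fin 4 → Fin 4 → ℂ) (l m n : Fin 4) :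
    act A B D (fun i j k => c * T i j k) l m n = c * act A B D T l m n := by
  simp only [act, Finset.mul_sum]
  exact Finset.sum_congr rfl fun i _ => Finset.sum_congr rfl fun j _ =>
    Finset.sum_congr rfl fun k _ => by ring

theorem act_kd (A B D : CMat) (v : Fin 4 → ℂ) (l m n : Fin 4) :
    act A B D (fun i j k => kd i j * v k) l m n = (A * Bᵀ) l m * ∑ k, D n k * v k := by
  simp only [act, Matrix.mul_apply, Matrix.transpose_apply]
  rw [Finset.sum_mul]
  refine Finset.sum_congr rfl fun i _ => ?_
  have h : ∀ j, B m j * ∑ k, D n k * (kd i j * v k) = kd i j * (B m j * ∑ k, D n k * v k) := by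
    intro j
    simp only [Finset.mul_sum]
    exact Finset.sum_congr rfl fun k _ => by ring
  simp only [h, sum_kd_left]
  ring

/-- `e` is a complex coframe with inverse `F` in which `G` is the Euclidean metric and the
Levi-Civita tensor is `i` times the symbol. -/
structure IsFrame (G : Matrix (Fin 4) (Fin 4) ℝ) (e F : CMat) : Prop where
  metric : ∀ m n, (G m n : ℂ) = (eᵀ * e) m n
  left : F * e = 1
  right : e * F = 1
  det : e.det = Complex.I * (Real.sqrt (-G.det) : ℂ)
  pos : 0 < Real.sqrt (-G.det)

theorem det_minkowski : minkowski.det = -1 := by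
  simp [minkowski, Matrix.det_diagonal, Fin.prod_univ_four]

/-- A Wick rotation: multiplying the time leg of a real Lorentz coframe by i makes the metric
Euclidean. -/
theorem exists_isFrame {G e : Matrix (Fin 4) (Fin 4) ℝ} (he : IsUnit e.det)
    (hG : G = eᵀ * minkowski * e) : ∃ f F : CMat, IsFrame G f F := by
  have hdet : -G.det = e.det ^ 2 := by
    rw [hG, Matrix.det_mul, Matrix.det_mul, Matrix.det_transpose, det_minkowski]; ring
  have hsqrt : Real.sqrt (-G.det) = |e.det| := by rw [hdet, Real.sqrt_sq_eq_abs]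
  have he0 : e.det ≠ 0 := he.ne_zero
  -- The sign σ repairs the orientation of the given coframe, so that the determinant is +i√(-g) in
  -- every case.
  obtain ⟨σ, hσ, hσe⟩ : ∃ σ : ℝ, σ ^ 2 = 1 ∧ σ * e.det = |e.det| := by
    rcases le_or_gt 0 e.det with h | h
    · exact ⟨1, by norm_num, by rw [abs_of_nonneg h, one_mul]⟩
    · exact ⟨-1, by norm_num, by rw [abs_of_neg h]; ring⟩
  obtain ⟨f, hf⟩ : ∃ f : CMat, f = Matrix.diagonal ![Complex.I * σ, 1, 1, 1] * e.map (fun t : ℝ => (t : ℂ)) :=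
    ⟨_, rfl⟩
  have hmapdet : (e.map (fun t : ℝ => (t : ℂ))).det = (e.det : ℂ) :=
    (RingHom.map_det Complex.ofRealHom e).symm
  have hfdet : f.det = Complex.I * (Real.sqrt (-G.det) : ℂ) := by
    rw [hf, Matrix.det_mul, hmapdet, hsqrt, ← hσe, Matrix.det_diagonal]
    simp [Fin.prod_univ_four]; ring
  have hpos : 0 < Real.sqrt (-G.det) := by rw [hsqrt]; exact abs_pos.mpr he0
  have hunit : IsUnit f.det := by
    rw [hfdet]
    exact isUnit_iff_ne_zero.mpr (mul_ne_zero Complex.I_ne_zero (by exact_mod_cast hpos.ne'))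
  refine ⟨f, f⁻¹, ⟨?_, Matrix.nonsing_inv_mul f hunit, Matrix.mul_nonsing_inv f hunit, hfdet, hpos⟩⟩
  intro m n
  have hσ' : (σ : ℂ) ^ 2 = 1 := by exact_mod_cast hσ
  rw [hG, hf]
  simp only [Matrix.mul_apply, Matrix.transpose_apply, minkowski, Matrix.diagonal_apply,
    Matrix.map_apply, Fin.sum_univ_four]
  simp
  linear_combination (-(e 0 m : ℂ) * e 0 n) * (hσ' * Complex.I ^ 2 + Complex.I_sq)

namespace IsFrame

variable {G : Matrix (Fin 4) (Fin 4) ℝ} {e F : CMat}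

theorem sqrt_ne (h : IsFrame G e F) : (Real.sqrt (-G.det) : ℂ) ≠ 0 := by
  exact_mod_cast h.pos.ne'

theorem map_metric (h : IsFrame G e F) : G.map (fun t : ℝ => (t : ℂ)) = eᵀ * e := by
  ext m n; exact h.metric m n

theorem det_sq (h : IsFrame G e F) : (G.det : ℂ) = -(Real.sqrt (-G.det) : ℂ) ^ 2 := by
  have h1 : (G.map (fun t : ℝ => (t : ℂ))).det = (G.det : ℂ) :=
    (RingHom.map_det Complex.ofRealHom G).symm
  rw [← h1, h.map_metric, Matrix.det_mul, Matrix.det_transpose, h.det]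
  linear_combination (Real.sqrt (-G.det) : ℂ) ^ 2 * Complex.I_sq

theorem isUnit_det (h : IsFrame G e F) : IsUnit G.det := by
  refine isUnit_iff_ne_zero.mpr fun h0 => h.sqrt_ne ?_
  simp [h0]

theorem right_transpose (h : IsFrame G e F) : Fᵀ * eᵀ = 1 := by
  rw [← Matrix.transpose_mul, h.right, Matrix.transpose_one]

theorem left_transpose (h : IsFrame G e F) : eᵀ * Fᵀ = 1 := by
  rw [← Matrix.transpose_mul, h.left, Matrix.transpose_one]

theorem inv (h : IsFrame G e F) : G⁻¹.map (fun t : ℝ => (t : ℂ)) = F * Fᵀ := by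
  have h1 : G⁻¹.map (fun t : ℝ => (t : ℂ)) * G.map (fun t : ℝ => (t : ℂ)) = 1 := by
    have := congrArg (fun M : Matrix (Fin 4) (Fin 4) ℝ => M.map Complex.ofRealHom)
      (Matrix.nonsing_inv_mul G h.isUnit_det)
    simp only [Matrix.map_mul] at this
    simp only [Matrix.map_one, map_zero, map_one] at this
    exact this
  rw [h.map_metric] at h1
  calc G⁻¹.map (fun t : ℝ => (t : ℂ))
      = G⁻¹.map (fun t : ℝ => (t : ℂ)) * (eᵀ * (e * F) * Fᵀ) := by
        rw [h.right, Matrix.mul_one, h.left_transpose, Matrix.mul_one]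
    _ = (G⁻¹.map (fun t : ℝ => (t : ℂ)) * (eᵀ * e)) * (F * Fᵀ) := by
        simp only [Matrix.mul_assoc]
    _ = F * Fᵀ := by rw [h1, Matrix.one_mul]

theorem inv_apply (h : IsFrame G e F) (m n : Fin 4) : ((G⁻¹ m n : ℝ) : ℂ) = (F * Fᵀ) m n := by
  rw [← h.inv]; rfl

theorem det_inv (h : IsFrame G e F) : e.det * F.det = 1 := by
  rw [← Matrix.det_mul, h.right, Matrix.det_one]

end IsFrame

/-! ### Frame components of the Levi-Civita tensor -/

section Frame

variable {g : MetricField} {x : Coord} {e F : CMat}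

/-- Lowering all four indices multiplies the symbol by det g = -(√(-g))², hence the minus sign. -/
theorem epsLow_eq (h : IsFrame (g x) e F) (a b c d : Fin 4) :
    (epsLow g x a b c d : ℂ) = -(Real.sqrt (-(g x).det) : ℂ) * symb a b c d := by
  have h1 := det_mul_symb ((g x).map (fun t : ℝ => (t : ℂ)))ᵀ a b c d
  rw [Matrix.det_transpose, show ((g x).map (fun t : ℝ => (t : ℂ))).det = ((g x).det : ℂ) from
    (RingHom.map_det Complex.ofRealHom (g x)).symm, h.det_sq] at h1
  have h2 : (epsLow g x a b c d : ℂ) * (Real.sqrt (-(g x).det) : ℂ)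
      = -(Real.sqrt (-(g x).det) : ℂ) ^ 2 * symb a b c d := by
    rw [← h1]
    simp only [epsLow, epsUp, sqrtNegDet]
    push_cast
    simp only [Finset.sum_mul]
    refine Finset.sum_congr rfl fun i _ => Finset.sum_congr rfl fun j _ =>
      Finset.sum_congr rfl fun k _ => Finset.sum_congr rfl fun l _ => ?_
    simp only [Matrix.transpose_apply, Matrix.map_apply]
    field_simp [h.sqrt_ne]
  apply mul_right_cancel₀ h.sqrt_ne
  rw [h2]; ring

/-- Since e⊗e⊗e⊗e maps the symbol to i√(-g) times itself, -√(-g) times the symbol is i times that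
image. One index is moved to the other side, so three coframe factors remain. -/
theorem sum_epsLow (h : IsFrame (g x) e F) (l m n q : Fin 4) :
    ∑ r, (epsLow g x l m n r : ℂ) * F r q = Complex.I *
      ∑ i, ∑ j, ∑ k, e i l * (e j m * (e k n * (symb i j k q : ℂ))) := by
  rw [symb_contract h.right, h.det]
  simp only [epsLow_eq h, Finset.mul_sum]
  refine Finset.sum_congr rfl fun r _ => ?_
  linear_combination -(Real.sqrt (-(g x).det) : ℂ) * symb l m n r * F r q * Complex.I_sq

theorem sum_epsLow_vec (h : IsFrame (g x) e F) (v : Fin 4 → ℂ) (l m n : Fin 4) :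
    ∑ r, (epsLow g x l m n r : ℂ) * ∑ q, F r q * v q
      = Complex.I * act eᵀ eᵀ eᵀ (symbVec v) l m n := by
  have h1 : ∑ r, (epsLow g x l m n r : ℂ) * ∑ q, F r q * v q
      = ∑ q, (∑ r, (epsLow g x l m n r : ℂ) * F r q) * v q := by
    simp only [Finset.mul_sum, Finset.sum_mul]
    rw [Finset.sum_comm]
    exact Finset.sum_congr rfl fun q _ => Finset.sum_congr rfl fun r _ => by ring
  rw [h1]
  simp only [sum_epsLow h, act, symbVec, Matrix.transpose_apply, Finset.mul_sum, Finset.sum_mul]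
  rw [Finset.sum_comm]
  refine Finset.sum_congr rfl fun i _ => ?_
  rw [Finset.sum_comm]
  refine Finset.sum_congr rfl fun j _ => ?_
  rw [Finset.sum_comm]
  exact Finset.sum_congr rfl fun k _ => Finset.sum_congr rfl fun r _ => by ring

theorem sum_epsMixed_vec (h : IsFrame (g x) e F) (v : Fin 4 → ℂ) (l m n : Fin 4) :
    ∑ r, (epsMixed g x l m n r : ℂ) * ∑ q, F r q * v q
      = Complex.I * act F eᵀ eᵀ (symbVec v) l m n := by
  have h1 : ∑ r, (epsMixed g x l m n r : ℂ) * ∑ q, F r q * v q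
      = ∑ i, (F * Fᵀ) l i * ∑ r, (epsLow g x i m n r : ℂ) * ∑ q, F r q * v q := by
    simp only [epsMixed]
    push_cast
    simp only [h.inv_apply, Finset.sum_mul]
    rw [Finset.sum_comm]
    refine Finset.sum_congr rfl fun i _ => ?_
    rw [Finset.mul_sum]
    exact Finset.sum_congr rfl fun r _ => by ring
  rw [h1]
  simp only [sum_epsLow_vec h]
  have h2 : ∀ i, (F * Fᵀ) l i * (Complex.I * act eᵀ eᵀ eᵀ (symbVec v) i m n)
      = Complex.I * ((F * Fᵀ) l i * act eᵀ eᵀ eᵀ (symbVec v) i m n) := fun i => by ring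
  simp only [h2, ← Finset.mul_sum, act_first]
  rw [Matrix.mul_assoc, h.right_transpose, Matrix.mul_one]

theorem sum_move (f : Fin 4 → Fin 4 → Fin 4 → Fin 4 → ℂ) :
    ∑ a, ∑ b, ∑ k, ∑ i, f a b k i = ∑ i, ∑ a, ∑ b, ∑ k, f a b k i := by
  symm
  rw [Finset.sum_comm]
  refine Finset.sum_congr rfl fun a _ => ?_
  rw [Finset.sum_comm]
  exact Finset.sum_congr rfl fun b _ => Finset.sum_comm

theorem sum_mul_act (A B D : CMat) (U T : Fin 4 → Fin 4 → Fin 4 → ℂ) :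
    ∑ a, ∑ b, ∑ k, U a b k * act A B D T a b k
      = ∑ i, ∑ j, ∑ p, (∑ a, ∑ b, ∑ k, A a i * (B b j * (D k p * U a b k))) * T i j p := by
  simp only [act, Finset.mul_sum, Finset.sum_mul]
  rw [sum_move]
  refine Finset.sum_congr rfl fun i _ => ?_
  rw [sum_move]
  refine Finset.sum_congr rfl fun j _ => ?_
  rw [sum_move]
  exact Finset.sum_congr rfl fun p _ => Finset.sum_congr rfl fun a _ =>
    Finset.sum_congr rfl fun b _ => Finset.sum_congr rfl fun k _ => by ring

/-- The inverse coframe has determinant 1/(i√(-g)), so the upper tensor also has i times the symbol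
as frame components. -/
theorem sum_epsUp (h : IsFrame (g x) e F) (T : Fin 4 → Fin 4 → Fin 4 → ℂ) (l : Fin 4) :
    ∑ a, ∑ b, ∑ k, (epsUp g x l a b k : ℂ) * act eᵀ eᵀ eᵀ T a b k
      = Complex.I * ∑ q, F l q * ∑ a, ∑ b, ∑ k, (symb q a b k : ℂ) * T a b k := by
  have key : ∀ i j p, ∑ a, ∑ b, ∑ k, e i a * (e j b * (e p k * (epsUp g x l a b k : ℂ)))
      = Complex.I * ∑ q, F l q * (symb q i j p : ℂ) := by
    intro i j p
    have h2 := symb_contract (M := eᵀ) (N := Fᵀ) h.left_transpose i j p l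
    rw [Matrix.det_transpose, h.det] at h2
    simp only [Matrix.transpose_apply] at h2
    have h3 : ∀ a b k, (epsUp g x l a b k : ℂ)
        = -(1 / (Real.sqrt (-(g x).det) : ℂ)) * symb a b k l := by
      intro a b k
      rw [symb_cycle l a b k, epsUp, sqrtNegDet]
      push_cast
      ring
    have h4 : ∑ a, ∑ b, ∑ k, e i a * (e j b * (e p k * (epsUp g x l a b k : ℂ)))
        = -(1 / (Real.sqrt (-(g x).det) : ℂ)) *
          ∑ a, ∑ b, ∑ k, e i a * (e j b * (e p k * (symb a b k l : ℂ))) := by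
      simp only [h3, Finset.mul_sum]
      exact Finset.sum_congr rfl fun a _ => Finset.sum_congr rfl fun b _ =>
        Finset.sum_congr rfl fun k _ => by ring
    rw [h4, h2]
    have h5 : ∑ d, (symb i j p d : ℂ) * F l d = -∑ q, F l q * (symb q i j p : ℂ) := by
      rw [← Finset.sum_neg_distrib]
      refine Finset.sum_congr rfl fun q _ => ?_
      rw [symb_cycle q i j p]; push_cast; ring
    rw [h5]
    field_simp [h.sqrt_ne]
  rw [sum_mul_act]
  simp only [Matrix.transpose_apply, key, Finset.mul_sum, Finset.sum_mul]
  rw [sum_move]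
  exact Finset.sum_congr rfl fun q _ => Finset.sum_congr rfl fun i _ =>
    Finset.sum_congr rfl fun j _ => Finset.sum_congr rfl fun p _ => by ring

/-- For fixed l and m the Levi-Civita tensor is a matrix; raising its two indices multiplies it on
both sides by the inverse metric FFᵀ, which cancels against the coframe factors of the tensor. -/
theorem sum_epsHalf (h : IsFrame (g x) e F) (T : Fin 4 → Fin 4 → Fin 4 → ℂ) (l m n : Fin 4) :
    ∑ r, ∑ s, (epsHalf g x l m r s : ℂ) * act eᵀ eᵀ eᵀ T n r s
      = Complex.I * act eᵀ eᵀ eᵀ (fun i j k => dualSymb (T k) i j) l m n := by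
  obtain ⟨L, hL⟩ : ∃ L : CMat, L = Matrix.of fun i j => (epsLow g x l m i j : ℂ) := ⟨_, rfl⟩
  obtain ⟨H, hH⟩ : ∃ H : CMat, H = Matrix.of fun r s => (epsHalf g x l m r s : ℂ) := ⟨_, rfl⟩
  obtain ⟨S, hS⟩ : ∃ S : CMat, S = Matrix.of fun p q =>
    ∑ a, ∑ b, e a l * (e b m * (symb a b p q : ℂ)) := ⟨_, rfl⟩
  have h1 : H = (F * Fᵀ)ᵀ * L * (F * Fᵀ) := by
    have h0 := h.inv_apply
    generalize F * Fᵀ = K at h0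
    ext r s
    rw [hH, hL, Matrix.mul_apply, Matrix.of_apply, epsHalf]
    push_cast
    simp only [h0, Matrix.mul_apply, Matrix.transpose_apply, Matrix.of_apply, Finset.sum_mul]
    rw [Finset.sum_comm]
    exact Finset.sum_congr rfl fun j _ => Finset.sum_congr rfl fun i _ => by ring
  have h2 : L * F = Complex.I • (eᵀ * S) := by
    ext i q
    rw [Matrix.smul_apply, smul_eq_mul, Matrix.mul_apply, Matrix.mul_apply, hL, hS]
    simp only [Matrix.of_apply]
    rw [sum_epsLow h]
    congr 1
    simp only [Matrix.transpose_apply, Finset.mul_sum]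
    conv_rhs => rw [Finset.sum_comm]
    refine Finset.sum_congr rfl fun a _ => ?_
    rw [Finset.sum_comm]
    exact Finset.sum_congr rfl fun b _ => Finset.sum_congr rfl fun c _ => by ring
  have h3 : e * H * eᵀ = Complex.I • S := by
    have : e * H * eᵀ = (e * F) * Fᵀ * (L * F) * (Fᵀ * eᵀ) := by
      rw [h1, Matrix.transpose_mul, Matrix.transpose_transpose]
      simp only [Matrix.mul_assoc]
    rw [this, h.right, h.right_transpose, h2, Matrix.one_mul, Matrix.mul_one, Matrix.mul_smul,
      ← Matrix.mul_assoc, h.right_transpose, Matrix.one_mul]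
  have h4 : ∀ p q, ∑ r, ∑ s, e p r * (e q s * H r s) = Complex.I * S p q := by
    intro p q
    rw [← smul_eq_mul, ← Matrix.smul_apply, ← h3, Matrix.mul_apply]
    simp only [Matrix.mul_apply, Matrix.transpose_apply, Finset.sum_mul]
    rw [Finset.sum_comm]
    exact Finset.sum_congr rfl fun s _ => Finset.sum_congr rfl fun r _ => by ring
  have h5 : ∑ r, ∑ s, (epsHalf g x l m r s : ℂ) * act eᵀ eᵀ eᵀ T n r s
      = ∑ k, e k n * ∑ p, ∑ q, (Complex.I * S p q) * T k p q := by
    simp only [← h4, act, Matrix.transpose_apply, Finset.mul_sum, Finset.sum_mul]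
    have h6 : ∀ (f : Fin 4 → Fin 4 → Fin 4 → ℂ), ∑ r, ∑ s, ∑ i, f r s i = ∑ i, ∑ r, ∑ s, f r s i := by
      intro f
      symm
      rw [Finset.sum_comm]
      exact Finset.sum_congr rfl fun r _ => Finset.sum_comm
    rw [h6]
    refine Finset.sum_congr rfl fun k _ => ?_
    rw [h6]
    refine Finset.sum_congr rfl fun p _ => ?_
    rw [h6]
    refine Finset.sum_congr rfl fun q _ => Finset.sum_congr rfl fun r _ =>
      Finset.sum_congr rfl fun s _ => ?_
    rw [hH, Matrix.of_apply]; ring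
  rw [h5, hS]
  simp only [act, dualSymb, Matrix.of_apply, Matrix.transpose_apply, Finset.mul_sum, Finset.sum_mul]
  rw [sum_move]
  refine Finset.sum_congr rfl fun a _ => ?_
  rw [sum_move]
  exact Finset.sum_congr rfl fun b _ => Finset.sum_congr rfl fun k _ =>
    Finset.sum_congr rfl fun p _ => Finset.sum_congr rfl fun q _ => by ring

end Frame

theorem act_sub (A B D : CMat) (T S : Fin 4 → Fin 4 → Fin 4 → ℂ) (l m n : Fin 4) :
    act A B D (fun i j k => T i j k - S i j k) l m n = act A B D T l m n - act A B D S l m n := by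
  simp only [act, mul_sub, Finset.sum_sub_distrib]

theorem act_kd_right (A B D : CMat) (v : Fin 4 → ℂ) (l m n : Fin 4) :
    act A B D (fun i j k => v i * kd j k) l m n = (∑ i, A l i * v i) * (B * Dᵀ) m n := by
  rw [act_swap_left, act_swap_right]
  have h2 := act_kd B D A v m n l
  simp only [mul_comm (v _)]
  rw [h2, mul_comm]

theorem act_kd_outer (A B D : CMat) (v : Fin 4 → ℂ) (l m n : Fin 4) :
    act A B D (fun i j k => kd i k * v j) l m n = (A * Dᵀ) l n * ∑ j, B m j * v j := by
  rw [act_swap_right, act_kd]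

theorem act_cycle (A B D : CMat) (T : Fin 4 → Fin 4 → Fin 4 → ℂ) (l m n : Fin 4) :
    act A B D T l m n = act B D A (fun i j k => T k i j) m n l := by
  rw [act_swap_left, act_swap_right]

theorem act_trace {B D : CMat} (h : Bᵀ * D = 1) (A : CMat) (T : Fin 4 → Fin 4 → Fin 4 → ℂ)
    (m : Fin 4) : ∑ r, act A B D T m r r = ∑ i, A m i * ∑ j, T i j j := by
  have h1 : ∀ j k, ∑ r, B r j * D r k = kd j k := by
    intro j k
    have := congrFun (congrFun h j) k
    rw [Matrix.mul_apply, Matrix.one_apply] at this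
    simpa only [Matrix.transpose_apply, kd] using this
  simp only [act, Finset.mul_sum]
  rw [Finset.sum_comm]
  refine Finset.sum_congr rfl fun i _ => ?_
  rw [Finset.sum_comm]
  refine Finset.sum_congr rfl fun j _ => ?_
  rw [Finset.sum_comm]
  have h2 : ∀ k, ∑ r, A m i * (B r j * (D r k * T i j k)) = kd j k * (A m i * T i j k) := by
    intro k
    rw [← h1, Finset.sum_mul]
    exact Finset.sum_congr rfl fun r _ => by ring
  simp only [h2, sum_kd_left]

section Frame

variable {g : MetricField} {x : Coord} {e F : CMat}

theorem IsFrame.act_injective {G : Matrix (Fin 4) (Fin 4) ℝ} (h : IsFrame G e F)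
    {T S : Fin 4 → Fin 4 → Fin 4 → ℂ} (hTS : act eᵀ eᵀ eᵀ T = act eᵀ eᵀ eᵀ S) : T = S := by
  have := congrArg (act Fᵀ Fᵀ Fᵀ) hTS
  simpa only [act_act, h.right_transpose, act_one] using this

theorem IsFrame.exists_act {G : Matrix (Fin 4) (Fin 4) ℝ} (h : IsFrame G e F)
    (T : Fin 4 → Fin 4 → Fin 4 → ℂ) : ∃ t, T = act eᵀ eᵀ eᵀ t :=
  ⟨act Fᵀ Fᵀ Fᵀ T, by rw [act_act, h.left_transpose, act_one]⟩

theorem IsFrame.exists_act_up {G : Matrix (Fin 4) (Fin 4) ℝ} (h : IsFrame G e F)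
    (T : Fin 4 → Fin 4 → Fin 4 → ℂ) : ∃ t, T = act F eᵀ eᵀ t :=
  ⟨act e Fᵀ Fᵀ T, by rw [act_act, h.left, h.left_transpose, act_one]⟩

theorem IsFrame.exists_vec {G : Matrix (Fin 4) (Fin 4) ℝ} (h : IsFrame G e F) (v : Fin 4 → ℂ) :
    ∃ w : Fin 4 → ℂ, ∀ m, v m = ∑ j, eᵀ m j * w j := by
  refine ⟨Fᵀ *ᵥ v, fun m => ?_⟩
  change v m = (eᵀ *ᵥ (Fᵀ *ᵥ v)) m
  rw [Matrix.mulVec_mulVec, h.left_transpose, Matrix.one_mulVec]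

theorem IsFrame.metric_symm {G : Matrix (Fin 4) (Fin 4) ℝ} (h : IsFrame G e F) (m n : Fin 4) :
    (G m n : ℂ) = (eᵀ * e) n m := by
  have h1 : (eᵀ * e)ᵀ = eᵀ * e := by rw [Matrix.transpose_mul, Matrix.transpose_transpose]
  rw [h.metric, ← h1, Matrix.transpose_apply, h1]

/-- The frame Levi-Civita tensor carries a factor i, which multiplies the duality constant, and
passing to frame components is injective. -/
theorem dual_iff (h : IsFrame (g x) e F) {c : ℂ} {V v : Fin 4 → Fin 4 → Fin 4 → ℂ}
    (hV : V = act eᵀ eᵀ eᵀ v) :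
    (∀ l m n, V l m n = c * ∑ r, ∑ s, (epsHalf g x l m r s : ℂ) * V n r s ∧
      V l m n + V m n l + V n l m - V m l n - V l n m - V n m l = 0) ↔
    FlatDual (c * Complex.I) v := by
  have h1 : ∀ l m n, c * ∑ r, ∑ s, (epsHalf g x l m r s : ℂ) * V n r s
      = act eᵀ eᵀ eᵀ (fun i j k => c * Complex.I * dualSymb (v k) i j) l m n := by
    intro l m n
    rw [hV, sum_epsHalf h, act_mul]; ring
  have h2 : ∀ l m n, V l m n + V m n l + V n l m - V m l n - V l n m - V n m l =
      act eᵀ eᵀ eᵀ (fun i j k => v i j k + v j k i + v k i j - v j i k - v i k j - v k j i)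
        l m n := by
    intro l m n
    simp only [act_sub, act_add, hV]
    rw [act_cycle _ _ _ v n l m, act_cycle _ _ _ v m n l, act_cycle _ _ _ _ n l m,
      act_swap_left _ _ _ v m l n, act_swap_right _ _ _ v l n m, act_cycle _ _ _ v n m l,
      act_swap_left _ _ _ _ m l n]
  constructor
  · intro H l m n
    have h3 : act eᵀ eᵀ eᵀ v = act eᵀ eᵀ eᵀ (fun i j k => c * Complex.I * dualSymb (v k) i j) := by
      funext l m n; rw [← h1, ← (H l m n).1, hV]
    have h4 : act eᵀ eᵀ eᵀ (fun i j k => v i j k + v j k i + v k i j - v j i k - v i k j - v k j i)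
        = act eᵀ eᵀ eᵀ (fun _ _ _ => 0) := by
      funext l m n
      rw [← h2, (H l m n).2]; simp [act]
    exact ⟨congrFun (congrFun (congrFun (h.act_injective h3) l) m) n,
      congrFun (congrFun (congrFun (h.act_injective h4) l) m) n⟩
  · intro H l m n
    have h3 : (fun i j k => c * Complex.I * dualSymb (v k) i j) = v := by
      funext i j k; exact (H i j k).1.symm
    have h4 : (fun i j k => v i j k + v j k i + v k i j - v j i k - v i k j - v k j i)
        = fun _ _ _ => 0 := by
      funext i j k; exact (H i j k).2
    refine ⟨?_, ?_⟩
    · rw [h1, h3, hV]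
    · rw [h2, h4]; simp [act]

theorem raise_eq (h : IsFrame (g x) e F) {v w : Fin 4 → ℂ} (hv : ∀ m, v m = ∑ j, eᵀ m j * w j)
    (l : Fin 4) : raise g x v l = ∑ q, F l q * w q := by
  have h1 : v = eᵀ *ᵥ w := by funext m; exact hv m
  have h2 : raise g x v l = ((F * Fᵀ) *ᵥ v) l := by
    simp only [raise, h.inv_apply]; rfl
  rw [h2, h1, Matrix.mulVec_mulVec, Matrix.mul_assoc, h.right_transpose, Matrix.mul_one]
  rfl

theorem lower_eq (h : IsFrame (g x) e F) {v w : Fin 4 → ℂ} (hv : ∀ m, v m = ∑ j, F m j * w j)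
    (l : Fin 4) : lower g x v l = ∑ q, eᵀ l q * w q := by
  have h1 : v = F *ᵥ w := by funext m; exact hv m
  have h2 : lower g x v l = ((eᵀ * e) *ᵥ v) l := by
    simp only [lower, h.metric]; rfl
  rw [h2, h1, Matrix.mulVec_mulVec, Matrix.mul_assoc, h.right, Matrix.mul_one]
  rfl

theorem mul_transpose_left (h : IsFrame (g x) e F) (l m : Fin 4) : (F * eᵀᵀ) l m = kd l m := by
  rw [Matrix.transpose_transpose, h.left]; simp [Matrix.one_apply, kd]

theorem act_proj (h : IsFrame (g x) e F) {v w : Fin 4 → ℂ} (hv : ∀ m, v m = ∑ j, eᵀ m j * w j)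
    (l m n : Fin 4) : act F eᵀ eᵀ (fun i j k => kd i j * w k) l m n = kd l m * v n := by
  rw [act_kd, mul_transpose_left h, hv]

theorem act_proj_outer (h : IsFrame (g x) e F) {v w : Fin 4 → ℂ}
    (hv : ∀ m, v m = ∑ j, eᵀ m j * w j) (l m n : Fin 4) :
    act F eᵀ eᵀ (fun i j k => kd i k * w j) l m n = kd l n * v m := by
  rw [act_kd_outer, mul_transpose_left h, hv]

theorem act_metric (h : IsFrame (g x) e F) (A : CMat) (w : Fin 4 → ℂ) (l m n : Fin 4) :
    act A eᵀ eᵀ (fun i j k => w i * kd j k) l m n = (∑ q, A l q * w q) * (g x m n : ℂ) := by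
  rw [act_kd_right, Matrix.transpose_transpose, h.metric]

/-- The explicit -si and the i from the frame Levi-Civita tensor combine to s. -/
theorem vectorShift_eq (h : IsFrame (g x) e F) (s : ℂ) {ψ : CovectorField} {w : Fin 4 → ℂ}
    (hw : ∀ m, ψ x m = ∑ j, eᵀ m j * w j) (l m n : Fin 4) :
    vectorShift s g ψ x l m n = act F eᵀ eᵀ
      (fun i j k => kd i k * w j - w i * kd j k + s * symbVec w i j k) l m n := by
  have h1 := sum_epsMixed_vec h w l m n
  rw [act_add, act_sub, act_mul, act_proj_outer h hw, act_metric h, vectorShift]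
  simp only [raise_eq h hw, h1]
  linear_combination -s * act F eᵀ eᵀ (symbVec w) l m n * Complex.I_sq

theorem tensorShift_eq (h : IsFrame (g x) e F) {V : Field3} {v : Fin 4 → Fin 4 → Fin 4 → ℂ}
    (hv : V x = act eᵀ eᵀ eᵀ v) (l m n : Fin 4) :
    tensorShift g V x l m n = act F eᵀ eᵀ v l m n := by
  simp only [tensorShift, h.inv_apply, hv]
  rw [act_first, Matrix.mul_assoc, h.right_transpose, Matrix.mul_one]

theorem tensorShiftSix_eq (h : IsFrame (g x) e F) {V : Field3} {v : Fin 4 → Fin 4 → Fin 4 → ℂ}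
    (hv : V x = act eᵀ eᵀ eᵀ v) (l m n : Fin 4) :
    tensorShiftSix g V x l m n = act F eᵀ eᵀ (fun i j k => v i k j + v j k i) l m n := by
  have h1 : ∀ k, V x k n m + V x m n k = act eᵀ eᵀ eᵀ (fun i j k => v i k j + v j k i) k m n := by
    intro k
    rw [hv, act_add, act_swap_right _ _ _ v k n m, act_cycle _ _ _ (fun i j k => v j k i) k m n,
      act_swap_right _ _ _ v m n k, act_swap_right]
  simp only [tensorShiftSix, h.inv_apply, h1]
  rw [act_first, Matrix.mul_assoc, h.right_transpose, Matrix.mul_one]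

variable {Γ : Field3} {L c : Fin 4 → Fin 4 → Fin 4 → ℂ}

/-- The reference connection L is symmetric in its lower indices, so the torsion depends only on the
difference tensor. -/
theorem torsion_eq (hΓ : ∀ l m n, Γ x l m n = L l m n + act F eᵀ eᵀ c l m n)
    (hL : ∀ l m n, L l m n = L l n m) (m n r : Fin 4) :
    torsion Γ x m n r = act eᵀ eᵀ F (flatTorsion c) m n r := by
  have h1 : flatTorsion c = fun i j k => 1 / 2 * (c k i j - c k j i) := by
    funext i j k; rw [flatTorsion]; ring
  rw [torsion, hΓ, hΓ, hL r m n, act_cycle F _ _ c r m n, act_cycle F _ _ c r n m, h1, act_mul,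
    act_sub, act_swap_left _ _ _ _ n m r]
  ring

theorem torsionLow_eq (h : IsFrame (g x) e F)
    (hΓ : ∀ l m n, Γ x l m n = L l m n + act F eᵀ eᵀ c l m n)
    (hL : ∀ l m n, L l m n = L l n m) : torsionLow g Γ x = act eᵀ eᵀ eᵀ (flatTorsion c) := by
  funext m n k
  have h1 : ∀ r, torsion Γ x m n r * (g x r k : ℂ)
      = (eᵀ * e) k r * act eᵀ eᵀ F (flatTorsion c) m n r := fun r => by
    rw [torsion_eq hΓ hL, h.metric_symm]; ring
  simp only [torsionLow, h1]
  rw [act_third, Matrix.mul_assoc, h.right, Matrix.mul_one]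

theorem torsionVec_eq (h : IsFrame (g x) e F)
    (hΓ : ∀ l m n, Γ x l m n = L l m n + act F eᵀ eᵀ c l m n)
    (hL : ∀ l m n, L l m n = L l n m) (m : Fin 4) :
    torsionVec Γ x m = ∑ i, eᵀ m i * flatVec c i := by
  simp only [torsionVec, torsion_eq hΓ hL]
  rw [act_trace (by rw [Matrix.transpose_transpose, h.right])]
  rfl

theorem torsionPseudo_eq (h : IsFrame (g x) e F)
    (hΓ : ∀ l m n, Γ x l m n = L l m n + act F eᵀ eᵀ c l m n)
    (hL : ∀ l m n, L l m n = L l n m) (l : Fin 4) :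
    torsionPseudo g Γ x l = ∑ q, F l q * (Complex.I * flatPseudo c q) := by
  simp only [torsionPseudo, torsionLow_eq h hΓ hL]
  rw [sum_epsUp h, Finset.mul_sum]
  exact Finset.sum_congr rfl fun q _ => by rw [flatPseudo]; ring

/-- The pseudo-vector and the tensor contracted with it each bring a factor i; their product -1
explains the opposite sign of the 1/6 term in `flatTensor`. -/
theorem torsionTensor_eq (h : IsFrame (g x) e F)
    (hΓ : ∀ l m n, Γ x l m n = L l m n + act F eᵀ eᵀ c l m n)
    (hL : ∀ l m n, L l m n = L l n m) : torsionTensor g Γ x = act eᵀ eᵀ eᵀ (flatTensor c) := by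
  funext l m n
  have h1 := sum_epsLow_vec h (fun q => Complex.I * flatPseudo c q) l m n
  have h2 : symbVec (fun q => Complex.I * flatPseudo c q)
      = fun i j k => Complex.I * symbVec (flatPseudo c) i j k := by
    funext i j k; rw [symbVec_mul]
  rw [h2, act_mul] at h1
  have h3 : flatTensor c = fun i j k => flatTorsion c i j k
      - 1 / 3 * (flatVec c i * kd j k - kd i k * flatVec c j)
      + 1 / 6 * symbVec (flatPseudo c) i j k := by
    funext i j k; rw [flatTensor]; ring
  rw [h3, act_add, act_sub, act_mul, act_mul, act_sub, act_metric h, act_kd_outer,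
    Matrix.transpose_transpose, ← h.metric, ← torsionVec_eq h hΓ hL, ← torsionVec_eq h hΓ hL,
    torsionTensor, torsionLow_eq h hΓ hL]
  simp only [torsionPseudo_eq h hΓ hL]
  rw [h1]
  linear_combination -(1 / 6) * act eᵀ eᵀ eᵀ (symbVec (flatPseudo c)) l m n * Complex.I_sq

end Frame

/-! ### The density P and the connection equation in a frame -/

/-- The density `P^{ab}` with entries
`(√(-g)/2) (δ^a_m g^{nb} - δ^b_m g^{na}) + α g_{mr} ε^{rnab}` in row `n` and column `m`; it
represents the Lagrangian density as `∑ tr (P^{ab} R_{ab})`. -/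
def dens (α : ℂ) (G : Matrix (Fin 4) (Fin 4) ℝ) (a b : Fin 4) : CMat :=
  Matrix.of fun n m => 1 / 2 * (Real.sqrt (-G.det) : ℂ) *
      (kd a m * (G⁻¹ n b : ℝ) - kd b m * (G⁻¹ n a : ℝ))
    + α * ∑ r, (G m r : ℂ) * (symb r n a b : ℂ)

/-- The matrices `P^{ab}` of the Euclidean metric. -/
def flatDens (β : ℂ) (i j : Fin 4) : CMat :=
  Matrix.of fun p q => 1 / 2 * (kd i q * kd p j - kd j q * kd p i) + β * (symb q p i j : ℂ)

/-- The matrix `C^m_{na}` with row `m` and column `n`. -/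
def connMat (C : Fin 4 → Fin 4 → Fin 4 → ℂ) (a : Fin 4) : CMat := Matrix.of fun m n => C m n a

/-- The algebraic connection equation `∑ₐ [P^{ab}, C_a]`. -/
def algEq (α : ℂ) (G : Matrix (Fin 4) (Fin 4) ℝ) (C : Fin 4 → Fin 4 → Fin 4 → ℂ) (b : Fin 4) :
    CMat :=
  ∑ a, (dens α G a b * connMat C a - connMat C a * dens α G a b)

theorem dens_swap (α : ℂ) (G : Matrix (Fin 4) (Fin 4) ℝ) (a b : Fin 4) :
    dens α G b a = -dens α G a b := by
  ext n m
  have h : ∀ r, (G m r : ℂ) * (symb r n b a : ℂ) = -((G m r : ℂ) * (symb r n a b : ℂ)) := fun r => by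
    rw [symb_swap_right r n a b]; push_cast; ring
  simp only [dens, Matrix.of_apply, Matrix.neg_apply, h, Finset.sum_neg_distrib]
  ring

/-- Tensoriality of P: both form indices are transformed with F, and the matrix is conjugated. The
Holst term acquires F.det, which √(-g)·i cancels; this is where α turns into iα. -/
theorem dens_eq {α : ℂ} {G : Matrix (Fin 4) (Fin 4) ℝ} {e F : CMat} (h : IsFrame G e F)
    (a b : Fin 4) : dens α G a b = ∑ i, F a i • ((Real.sqrt (-G.det) : ℂ) •
      ∑ j, F b j • (F * flatDens (Complex.I * α) i j * e)) := by
  ext n m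
  have entry : ∀ i j, (F * flatDens (Complex.I * α) i j * e) n m
      = 1 / 2 * (F n j * e i m - F n i * e j m)
        + Complex.I * α * ∑ q, ∑ p, F n p * (symb q p i j : ℂ) * e q m := by
    intro i j
    simp only [Matrix.mul_apply, flatDens, Matrix.of_apply]
    have h1 : ∀ q, ∑ p, F n p * (1 / 2 * (kd i q * kd p j - kd j q * kd p i)
        + Complex.I * α * (symb q p i j : ℂ)) = 1 / 2 * (kd i q * F n j - kd j q * F n i)
        + Complex.I * α * ∑ p, F n p * (symb q p i j : ℂ) := by
      intro q
      have h2 : ∀ p, F n p * (1 / 2 * (kd i q * kd p j - kd j q * kd p i)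
          + Complex.I * α * (symb q p i j : ℂ)) = 1 / 2 * (kd i q * (kd p j * F n p))
          - 1 / 2 * (kd j q * (kd p i * F n p))
          + Complex.I * α * (F n p * (symb q p i j : ℂ)) := fun p => by ring
      simp only [h2, Finset.sum_add_distrib, Finset.sum_sub_distrib, ← Finset.mul_sum,
        sum_kd_right]
      ring
    have h3 : ∀ q, (1 / 2 * (kd i q * F n j - kd j q * F n i)
        + Complex.I * α * ∑ p, F n p * (symb q p i j : ℂ)) * e q m
        = 1 / 2 * F n j * (kd i q * e q m) - 1 / 2 * F n i * (kd j q * e q m)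
          + Complex.I * α * ∑ p, F n p * (symb q p i j : ℂ) * e q m := by
      intro q
      simp only [Finset.mul_sum, add_mul, Finset.sum_mul]
      congr 1
      · ring
      · exact Finset.sum_congr rfl fun p _ => by ring
    simp only [h1, h3, Finset.sum_add_distrib, Finset.sum_sub_distrib, ← Finset.mul_sum,
      sum_kd_left]
    ring
  have hδ : ∀ a m, ∑ i, F a i * e i m = kd a m := by
    intro a m
    rw [← Matrix.mul_apply, h.left]; simp [Matrix.one_apply, kd]
  have hinv : ∀ n b, ((G⁻¹ n b : ℝ) : ℂ) = ∑ j, F n j * F b j := by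
    intro n b
    rw [h.inv_apply, Matrix.mul_apply]; rfl
  have heps : ∑ r, (G m r : ℂ) * (symb r n a b : ℂ) = (Real.sqrt (-G.det) : ℂ) * (Complex.I *
      ∑ q, e q m * ∑ p, ∑ i, ∑ j, F n p * (F a i * (F b j * (symb q p i j : ℂ)))) := by
    have h1 : ∀ q, ∑ p, ∑ i, ∑ j, F n p * (F a i * (F b j * (symb q p i j : ℂ)))
        = F.det * ∑ r, (symb r n a b : ℂ) * e q r := by
      intro q
      have h2 := symb_contract (M := Fᵀ) (N := eᵀ) h.right_transpose n a b q
      rw [Matrix.det_transpose] at h2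
      have h3 : ∀ p i j, F n p * (F a i * (F b j * (symb q p i j : ℂ)))
          = -(Fᵀ p n * (Fᵀ i a * (Fᵀ j b * (symb p i j q : ℂ)))) := fun p i j => by
        rw [symb_cycle q p i j]; simp only [Matrix.transpose_apply]; push_cast; ring
      have h4 : ∀ r, (symb r n a b : ℂ) * e q r = -((symb n a b r : ℂ) * eᵀ r q) := fun r => by
        rw [symb_cycle r n a b]; simp only [Matrix.transpose_apply]; push_cast; ring
      simp only [h3, h4, Finset.sum_neg_distrib, h2, mul_neg]
    have h5 : (Real.sqrt (-G.det) : ℂ) * (Complex.I * F.det) = 1 := by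
      rw [← h.det_inv, h.det]; ring
    have h6 : ∀ r, (G m r : ℂ) = ∑ q, e q m * e q r := fun r => by
      rw [h.metric, Matrix.mul_apply]; rfl
    simp only [h1]
    calc ∑ r, (G m r : ℂ) * (symb r n a b : ℂ)
        = ∑ q, e q m * ∑ r, (symb r n a b : ℂ) * e q r := by
          simp only [h6, Finset.sum_mul, Finset.mul_sum]
          rw [Finset.sum_comm]
          exact Finset.sum_congr rfl fun q _ => Finset.sum_congr rfl fun r _ => by ring
      _ = ((Real.sqrt (-G.det) : ℂ) * (Complex.I * F.det)) *
          ∑ q, e q m * ∑ r, (symb r n a b : ℂ) * e q r := by rw [h5, one_mul]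
      _ = _ := by
          have h7 : ∀ q, e q m * (F.det * ∑ r, (symb r n a b : ℂ) * e q r)
              = F.det * (e q m * ∑ r, (symb r n a b : ℂ) * e q r) := fun q => by ring
          simp only [h7, ← Finset.mul_sum]
          ring
  have hsum : (∑ i, F a i • ((Real.sqrt (-G.det) : ℂ) •
      ∑ j, F b j • (F * flatDens (Complex.I * α) i j * e))) n m
      = (Real.sqrt (-G.det) : ℂ) * ∑ i, ∑ j, F a i * (F b j *
        (F * flatDens (Complex.I * α) i j * e) n m) := by
    simp only [Matrix.sum_apply, Matrix.smul_apply, smul_eq_mul, Finset.mul_sum]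
    exact Finset.sum_congr rfl fun i _ => Finset.sum_congr rfl fun j _ => by ring
  have hA : ∑ i, ∑ j, F a i * (F b j * (F n j * e i m)) = kd a m * (G⁻¹ n b : ℝ) := by
    rw [hinv, ← hδ, Finset.sum_mul_sum]
    exact Finset.sum_congr rfl fun i _ => Finset.sum_congr rfl fun j _ => by ring
  have hB : ∑ i, ∑ j, F a i * (F b j * (F n i * e j m)) = kd b m * (G⁻¹ n a : ℝ) := by
    rw [hinv, ← hδ, mul_comm, Finset.sum_mul_sum]
    exact Finset.sum_congr rfl fun i _ => Finset.sum_congr rfl fun j _ => by ring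
  have hC : ∑ i, ∑ j, F a i * (F b j * ∑ q, ∑ p, F n p * (symb q p i j : ℂ) * e q m)
      = ∑ q, e q m * ∑ p, ∑ i, ∑ j, F n p * (F a i * (F b j * (symb q p i j : ℂ))) := by
    simp only [Finset.mul_sum]
    have h6 : ∀ (f : Fin 4 → Fin 4 → Fin 4 → ℂ), ∑ r, ∑ s, ∑ i, f r s i = ∑ i, ∑ r, ∑ s, f r s i := by
      intro f
      symm
      rw [Finset.sum_comm]
      exact Finset.sum_congr rfl fun r _ => Finset.sum_comm
    rw [h6]
    refine Finset.sum_congr rfl fun q _ => ?_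
    rw [h6]
    exact Finset.sum_congr rfl fun p _ => Finset.sum_congr rfl fun i _ =>
      Finset.sum_congr rfl fun j _ => by ring
  have hD : ∑ i, ∑ j, F a i * (F b j * (F * flatDens (Complex.I * α) i j * e) n m)
      = 1 / 2 * (∑ i, ∑ j, F a i * (F b j * (F n j * e i m))
          - ∑ i, ∑ j, F a i * (F b j * (F n i * e j m)))
        + Complex.I * α *
          ∑ i, ∑ j, F a i * (F b j * ∑ q, ∑ p, F n p * (symb q p i j : ℂ) * e q m) := by
    simp only [entry]
    rw [Finset.mul_sum, ← Finset.sum_sub_distrib, Finset.mul_sum, ← Finset.sum_add_distrib]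
    refine Finset.sum_congr rfl fun i _ => ?_
    rw [Finset.mul_sum, ← Finset.sum_sub_distrib, Finset.mul_sum, ← Finset.sum_add_distrib]
    exact Finset.sum_congr rfl fun j _ => by ring
  rw [hsum, hD, hA, hB, hC, dens, Matrix.of_apply, heps]
  ring

theorem connMat_act (e F : CMat) (c : Fin 4 → Fin 4 → Fin 4 → ℂ) (a : Fin 4) :
    connMat (act F eᵀ eᵀ c) a = ∑ k, e k a • (F * connMat c k * e) := by
  ext l m
  simp only [connMat, act, Matrix.of_apply, Matrix.sum_apply, Matrix.smul_apply, smul_eq_mul,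
    Matrix.mul_apply, Matrix.transpose_apply, Finset.mul_sum, Finset.sum_mul]
  have h6 : ∀ (f : Fin 4 → Fin 4 → Fin 4 → ℂ), ∑ r, ∑ s, ∑ i, f r s i = ∑ i, ∑ s, ∑ r, f r s i := by
    intro f
    rw [Finset.sum_comm]
    conv_rhs => rw [Finset.sum_comm]
    exact Finset.sum_congr rfl fun r _ => Finset.sum_comm
  rw [h6]
  exact Finset.sum_congr rfl fun k _ => Finset.sum_congr rfl fun j _ =>
    Finset.sum_congr rfl fun i _ => by ring

/-- On a contracted index the factors of the coframe and of its inverse cancel. Both orders of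
matrix multiplication are needed for commutators. -/
theorem sum_contract {e F : CMat} (h : e * F = 1) (Q K : Fin 4 → CMat) :
    ∑ a, ((∑ i, F a i • Q i) * ∑ k, e k a • K k) = ∑ i, Q i * K i ∧
    ∑ a, ((∑ k, e k a • K k) * ∑ i, F a i • Q i) = ∑ i, K i * Q i := by
  have h1 : ∀ k i, ∑ a, e k a * F a i = (1 : CMat) k i := fun k i => by
    rw [← Matrix.mul_apply, h]
  constructor
  · simp only [Finset.sum_mul, Finset.mul_sum, smul_mul_smul_comm]
    rw [Finset.sum_comm]
    refine Finset.sum_congr rfl fun k _ => ?_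
    rw [Finset.sum_comm]
    have h2 : ∀ i, ∑ a, F a i * e k a = (1 : CMat) k i := fun i => by
      rw [← h1]; exact Finset.sum_congr rfl fun a _ => mul_comm _ _
    simp only [← Finset.sum_smul, h2]
    simp [Matrix.one_apply]
  · simp only [Finset.sum_mul, Finset.mul_sum, smul_mul_smul_comm]
    rw [Finset.sum_comm]
    refine Finset.sum_congr rfl fun k _ => ?_
    rw [Finset.sum_comm]
    simp only [← Finset.sum_smul, h1]
    simp [Matrix.one_apply]

theorem flat_commutator (β : ℂ) (c : Fin 4 → Fin 4 → Fin 4 → ℂ) (b : Fin 4) :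
    ∑ i, (flatDens β i b * connMat c i - connMat c i * flatDens β i b)
      = Matrix.of fun n m => flatEq β c n m b := by
  have hs1 : ∀ k n i b : Fin 4, symb k n i b = symb b n k i := by decide
  have hs2 : ∀ m k i b : Fin 4, symb m k i b = -symb b m k i := by decide
  ext n m
  have h1 : ∑ i, (flatDens β i b * connMat c i) n m
      = 1 / 2 * (kd n b * ∑ a, c a m a - c b m n)
        + β * dualSymb (fun k a => c k m a) b n := by
    have h2 : ∀ i, (flatDens β i b * connMat c i) n m = 1 / 2 * (kd n b * c i m i)
        - 1 / 2 * (kd n i * c b m i) + β * ∑ k, (symb b n k i : ℂ) * c k m i := by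
      intro i
      have h3 : ∀ k, flatDens β i b n k * connMat c i k m
          = 1 / 2 * (kd n b * (kd i k * c k m i)) - 1 / 2 * (kd n i * (kd b k * c k m i))
            + β * ((symb b n k i : ℂ) * c k m i) := fun k => by
        simp only [flatDens, connMat, Matrix.of_apply, hs1 k n i b]; ring
      simp only [Matrix.mul_apply, h3, Finset.sum_add_distrib, Finset.sum_sub_distrib,
        ← Finset.mul_sum, sum_kd_left]
    simp only [h2, Finset.sum_add_distrib, Finset.sum_sub_distrib, ← Finset.mul_sum, sum_kd_left,
      dualSymb]
    rw [Finset.sum_comm (f := fun i k => (symb b n k i : ℂ) * c k m i)]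
    ring
  have h4 : ∑ i, (connMat c i * flatDens β i b) n m
      = 1 / 2 * (c n b m - kd b m * ∑ a, c n a a)
        - β * dualSymb (fun k a => c n k a) b m := by
    have h2 : ∀ i, (connMat c i * flatDens β i b) n m = 1 / 2 * (kd i m * c n b i)
        - 1 / 2 * (kd b m * c n i i) - β * ∑ k, (symb b m k i : ℂ) * c n k i := by
      intro i
      have h3 : ∀ k, connMat c i n k * flatDens β i b k m
          = 1 / 2 * (kd i m * (kd k b * c n k i)) - 1 / 2 * (kd b m * (kd k i * c n k i))
            - β * ((symb b m k i : ℂ) * c n k i) := fun k => by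
        simp only [flatDens, connMat, Matrix.of_apply, hs2 m k i b]; push_cast; ring
      simp only [Matrix.mul_apply, h3, Finset.sum_sub_distrib, ← Finset.mul_sum, sum_kd_right]
    simp only [h2, Finset.sum_sub_distrib, ← Finset.mul_sum, sum_kd_right, dualSymb]
    rw [Finset.sum_comm (f := fun i k => (symb b m k i : ℂ) * c n k i)]
    ring
  rw [Matrix.sum_apply]
  simp only [Matrix.sub_apply, Finset.sum_sub_distrib, h1, h4, Matrix.of_apply, flatEq]
  ring

/-- Covariance of the connection equation. Up to the invertible factors √(-g), F and e, it is the
Euclidean equation for the frame components, with β = iα. -/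
theorem algEq_act {α : ℂ} {G : Matrix (Fin 4) (Fin 4) ℝ} {e F : CMat} (h : IsFrame G e F)
    (c : Fin 4 → Fin 4 → Fin 4 → ℂ) (b : Fin 4) :
    algEq α G (act F eᵀ eᵀ c) b = (Real.sqrt (-G.det) : ℂ) •
      ∑ j, F b j • (F * (Matrix.of fun n m => flatEq (Complex.I * α) c n m j) * e) := by
  have h1 := sum_contract h.right
    (fun i => (Real.sqrt (-G.det) : ℂ) • ∑ j, F b j • (F * flatDens (Complex.I * α) i j * e))
    (fun k => F * connMat c k * e)
  simp only [algEq, dens_eq h, connMat_act, Finset.sum_sub_distrib]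
  rw [h1.1, h1.2, ← Finset.sum_sub_distrib]
  have hmul : ∀ A B : CMat, (F * A * e) * (F * B * e) = F * (A * B) * e := fun A B => by
    calc (F * A * e) * (F * B * e) = F * A * (e * F) * B * e := by simp only [Matrix.mul_assoc]
      _ = F * (A * B) * e := by rw [h.right]; simp only [Matrix.mul_one, Matrix.mul_assoc]
  simp only [← flat_commutator, Matrix.smul_mul, Matrix.mul_smul, Finset.sum_mul, Finset.mul_sum,
    hmul, ← smul_sub, ← Finset.smul_sum, ← Finset.sum_sub_distrib]
  congr 1
  rw [Finset.sum_comm]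
  refine Finset.sum_congr rfl fun j _ => ?_
  rw [← Finset.smul_sum]
  congr 1
  exact Finset.sum_congr rfl fun i _ => by rw [Matrix.mul_sub, Matrix.sub_mul]

theorem algEq_act_eq_zero_iff {α : ℂ} {G : Matrix (Fin 4) (Fin 4) ℝ} {e F : CMat}
    (h : IsFrame G e F) (c : Fin 4 → Fin 4 → Fin 4 → ℂ) :
    (∀ b, algEq α G (act F eᵀ eᵀ c) b = 0) ↔ ∀ n m b, flatEq (Complex.I * α) c n m b = 0 := by
  constructor
  · intro H n m b
    obtain ⟨X, hX⟩ : ∃ X : Fin 4 → CMat,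
      X = fun j => Matrix.of fun n m => flatEq (Complex.I * α) c n m j := ⟨_, rfl⟩
    have h1 : ∀ b, ∑ j, F b j • (F * X j * e) = 0 := fun b => by
      have := H b
      rw [algEq_act h] at this
      rw [hX]
      exact (smul_eq_zero.mp this).resolve_left h.sqrt_ne
    have h2 : F * X b * e = 0 := by
      have h3 : ∑ a, e b a • ∑ j, F a j • (F * X j * e) = F * X b * e := by
        simp only [Finset.smul_sum, smul_smul]
        rw [Finset.sum_comm]
        simp only [← Finset.sum_smul, ← Matrix.mul_apply, h.right]
        simp [Matrix.one_apply]
      rw [← h3]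
      simp only [h1, smul_zero, Finset.sum_const_zero]
    have h4 : X b = 0 := by
      calc X b = (e * F) * X b * (e * F) := by rw [h.right, Matrix.one_mul, Matrix.mul_one]
        _ = e * (F * X b * e) * F := by simp only [Matrix.mul_assoc]
        _ = 0 := by rw [h2, Matrix.mul_zero, Matrix.zero_mul]
    have h5 := congrFun (congrFun h4 n) m
    rw [hX] at h5
    exact h5
  · intro H b
    rw [algEq_act h]
    have : ∀ j, (Matrix.of fun n m => flatEq (Complex.I * α) c n m j : CMat) = 0 := fun j => by
      ext n m; exact H n m j
    simp [this]

theorem trace_dens_act {α : ℂ} {G : Matrix (Fin 4) (Fin 4) ℝ} {e F : CMat}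
    (h : IsFrame G e F) {c : Fin 4 → Fin 4 → Fin 4 → ℂ}
    (hc : ∀ l m k, flatTr (Complex.I * α) c l m k = 0) (a b k : Fin 4) :
    (dens α G a b * connMat (act F eᵀ eᵀ c) k).trace = 0 := by
  have hs : ∀ q p i j : Fin 4, symb q p i j = symb i j q p := by decide
  have h1 : ∀ i j k, (flatDens (Complex.I * α) i j * connMat c k).trace = 0 := by
    intro i j k
    rw [← hc i j k, Matrix.trace]
    have h3 : ∀ p q, flatDens (Complex.I * α) i j p q * connMat c k q p
        = 1 / 2 * (kd p j * (kd i q * c q p k)) - 1 / 2 * (kd p i * (kd j q * c q p k))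
          + Complex.I * α * ((symb i j q p : ℂ) * c q p k) := fun p q => by
      simp only [flatDens, connMat, Matrix.of_apply, hs q p i j]; ring
    simp only [Matrix.diag_apply, Matrix.mul_apply, h3, Finset.sum_add_distrib,
      Finset.sum_sub_distrib, ← Finset.mul_sum, sum_kd_left, sum_kd_right, flatTr, dualSymb]
    rw [Finset.sum_comm (f := fun p q => (symb i j q p : ℂ) * c q p k)]
    ring
  have h2 : ∀ A B : CMat, ((F * A * e) * (F * B * e)).trace = (A * B).trace := fun A B => by
    calc ((F * A * e) * (F * B * e)).trace = (F * (A * (e * F) * B * e)).trace := by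
          simp only [Matrix.mul_assoc]
      _ = ((A * (e * F) * B) * (e * F)).trace := by
          rw [Matrix.trace_mul_comm]; simp only [Matrix.mul_assoc]
      _ = (A * B).trace := by rw [h.right, Matrix.mul_one, Matrix.mul_one]
  rw [dens_eq h, connMat_act]
  simp only [Finset.sum_mul, Finset.mul_sum, Matrix.smul_mul, Matrix.mul_smul, Matrix.trace_sum,
    Matrix.trace_smul, h2, h1, smul_zero, Finset.sum_const_zero]

/-! ### From the frame back to the manifold -/

theorem I_mul_half (s : ℂ) : Complex.I * (s * Complex.I / 2) = -(s / 2) := by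
  linear_combination (s / 2) * Complex.I_sq

theorem I_mul_sixth (s : ℂ) : Complex.I * (s * Complex.I / 6) = -(s / 6) := by
  linear_combination (s / 6) * Complex.I_sq

theorem IsLorentzMetric.exists_frame {U : Set Coord} {g : MetricField} (hg : IsLorentzMetric U g)
    {x : Coord} (hx : x ∈ U) : ∃ e F : CMat, IsFrame (g x) e F := by
  obtain ⟨e, he, hge⟩ := hg.signature x hx
  exact exists_isFrame he hge

/-- Gauge shifts solve the algebraic connection equation and are invisible to `P^{ab}`. -/
theorem IsGaugeShift.algEq_eq_zero {α : ℂ} {U : Set Coord} {g : MetricField} {N : Field3}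
    (hg : IsLorentzMetric U g) (hN : IsGaugeShift α U g N) {x : Coord} (hx : x ∈ U) :
    (∀ b, algEq α (g x) (N x) b = 0) ∧
      ∀ a b k, (dens α (g x) a b * connMat (N x) k).trace = 0 := by
  obtain ⟨e, F, hF⟩ := hg.exists_frame hx
  -- Both claims are invariant under the change of frame, so they reduce to the Euclidean shifts.
  suffices H : ∃ c, N x = act F eᵀ eᵀ c ∧ ∀ n m b, flatEq (Complex.I * α) c n m b = 0 ∧
      flatTr (Complex.I * α) c n m b = 0 by
    obtain ⟨c, hc, h⟩ := H
    rw [hc]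
    exact ⟨(algEq_act_eq_zero_iff hF c).mpr fun n m b => (h n m b).1,
      trace_dens_act hF fun n m b => (h n m b).2⟩
  obtain ⟨ξ, -, h | ⟨s, hs, hα, ψ, V, -, -, hV, h⟩ | ⟨s, hs, hα, V, -, hV, h⟩⟩ := hN
  · obtain ⟨w, hw⟩ := hF.exists_vec (ξ x)
    refine ⟨fun i j k => kd i j * w k, ?_, fun n m b => ⟨flatEq_proj _ _ _ _ _, flatTr_proj _ _ _ _ _⟩⟩
    funext l m n
    rw [h x hx, act_proj hF hw, projShift]
  · obtain ⟨w, hw⟩ := hF.exists_vec (ξ x)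
    obtain ⟨u, hu⟩ := hF.exists_vec (ψ x)
    obtain ⟨v, hv⟩ := hF.exists_act (V x)
    have hd := (dual_iff hF hv).mp (hV x hx)
    rw [show s * Complex.I * Complex.I = -s by linear_combination s * Complex.I_sq] at hd
    rw [hα, I_mul_half]
    refine ⟨_, ?_, flat_shift_half hs w u hd⟩
    funext l m n
    rw [h x hx, act_add, act_proj hF hw, act_add, ← vectorShift_eq hF s hu, ← tensorShift_eq hF hv]
    simp only [Pi.add_apply, projShift, add_assoc]
  · obtain ⟨w, hw⟩ := hF.exists_vec (ξ x)
    obtain ⟨v, hv⟩ := hF.exists_act (V x)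
    have hd := (dual_iff hF hv).mp (hV x hx)
    rw [show -(s * Complex.I) * Complex.I = s by linear_combination -s * Complex.I_sq] at hd
    rw [hα, I_mul_sixth]
    refine ⟨_, ?_, flat_shift_sixth hs w hd⟩
    funext l m n
    rw [h x hx, act_add, act_proj hF hw, ← tensorShiftSix_eq hF hv]
    simp only [Pi.add_apply, projShift]

section Solved

variable {α : ℂ} {U : Set Coord} {g : MetricField} {Γ : Field3}

/-- Frame components of the difference of a connection and the Levi-Civita connection. -/
theorem exists_frame_components (hg : IsLorentzMetric U g)
    (H : ∀ x ∈ U, ∀ b, algEq α (g x) (Γ x - leviCivita g x) b = 0) {x : Coord} (hx : x ∈ U) :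
    ∃ e F c, IsFrame (g x) e F ∧
      (∀ l m n, Γ x l m n = leviCivita g x l m n + act F eᵀ eᵀ c l m n) ∧
      ∀ n m b, flatEq (Complex.I * α) c n m b = 0 := by
  obtain ⟨e, F, hF⟩ := hg.exists_frame hx
  obtain ⟨c, hc⟩ := hF.exists_act_up (Γ x - leviCivita g x)
  have h1 := H x hx
  rw [hc, algEq_act_eq_zero_iff hF] at h1
  refine ⟨e, F, c, hF, fun l m n => ?_, h1⟩
  rw [← hc]; simp

theorem solvedGeneric_of_algEq (hg : IsLorentzMetric U g)
    (hL : ∀ x ∈ U, ∀ l m n, leviCivita g x l m n = leviCivita g x l n m)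
    (H : ∀ x ∈ U, ∀ b, algEq α (g x) (Γ x - leviCivita g x) b = 0)
    (h1 : α ≠ Complex.I / 2) (h2 : α ≠ -Complex.I / 2) (h3 : α ≠ Complex.I / 6)
    (h4 : α ≠ -Complex.I / 6) : SolvedGeneric U g Γ := by
  intro x hx l m n
  obtain ⟨e, F, c, hF, hΓ, hc⟩ := exists_frame_components hg H hx
  have h5 : 4 * (Complex.I * α) ^ 2 ≠ 1 := fun h => by
    have : (α - Complex.I / 2) * (α - -Complex.I / 2) = 0 := by
      linear_combination -(1 / 4) * h + (α ^ 2 - 1 / 4) * Complex.I_sq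
    rcases mul_eq_zero.mp this with h' | h'
    · exact h1 (sub_eq_zero.mp h')
    · exact h2 (sub_eq_zero.mp h')
  have h6 : 36 * (Complex.I * α) ^ 2 ≠ 1 := fun h => by
    have : (α - Complex.I / 6) * (α - -Complex.I / 6) = 0 := by
      linear_combination -(1 / 36) * h + (α ^ 2 - 1 / 36) * Complex.I_sq
    rcases mul_eq_zero.mp this with h' | h'
    · exact h3 (sub_eq_zero.mp h')
    · exact h4 (sub_eq_zero.mp h')
  have h7 : c = fun i j k => -(2 / 3) * (kd i j * flatVec c k) := by
    funext i j k; rw [flat_generic h5 h6 hc i j k]; ring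
  have h8 := act_proj hF (torsionVec_eq hF hΓ (hL x hx)) l m n
  have h9 : act F eᵀ eᵀ c l m n = -(2 / 3) * (kd l m * torsionVec Γ x n) := by
    conv_lhs => rw [h7]
    rw [act_mul, h8]
  rw [hΓ, h9]; ring

theorem solvedHalf_of_algEq (hg : IsLorentzMetric U g)
    (hL : ∀ x ∈ U, ∀ l m n, leviCivita g x l m n = leviCivita g x l n m)
    (H : ∀ x ∈ U, ∀ b, algEq α (g x) (Γ x - leviCivita g x) b = 0)
    {s : ℂ} (hs : s = 1 ∨ s = -1) (hα : α = s * Complex.I / 2) : SolvedHalf s U g Γ := by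
  refine ⟨fun x hx => ?_, fun x hx l m n => ?_⟩ <;>
  obtain ⟨e, F, c, hF, hΓ, hc⟩ := exists_frame_components hg H hx <;>
  rw [hα, I_mul_half] at hc <;>
  obtain ⟨hd, hform⟩ := flat_half hs hc
  · refine (dual_iff hF (torsionTensor_eq hF hΓ (hL x hx))).mpr ?_
    rwa [show s * Complex.I * Complex.I = -s by linear_combination s * Complex.I_sq]
  · have hp := torsionPseudo_eq hF hΓ (hL x hx)
    have hlow := lower_eq hF hp
    -- The components p absorb the i of `torsionPseudo_eq`; written with p, the Euclidean formula
    -- acquires the coefficients of the spacetime formula.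
    obtain ⟨p, hpd⟩ : ∃ p : Fin 4 → ℂ, p = fun q => Complex.I * flatPseudo c q := ⟨_, rfl⟩
    have hI : flatPseudo c = fun q => -Complex.I * p q := by
      funext q; rw [hpd]; linear_combination flatPseudo c q * Complex.I_sq
    have hlow' : ∀ l, lower g x (torsionPseudo g Γ x) l = ∑ q, eᵀ l q * p q := by
      rw [hpd]; exact hlow
    have hp' : ∀ l, torsionPseudo g Γ x l = ∑ q, F l q * p q := by rw [hpd]; exact hp
    have h7 : c = fun i j k => Complex.I / 6 * symbVec p i j k
        + s * Complex.I / 6 * (kd i j * p k + kd i k * p j - p i * kd j k)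
        - 2 / 3 * (kd i j * flatVec c k) - 2 * flatTensor c i j k := by
      funext i j k
      rw [hform i j k]
      conv_lhs => rw [hI]
      rw [symbVec_mul]; ring
    have heps : ∑ r, (epsMixed g x l m n r : ℂ) * torsionPseudo g Γ x r
        = Complex.I * act F eᵀ eᵀ (symbVec p) l m n := by
      simp only [hp']; exact sum_epsMixed_vec hF p l m n
    have h9 : act F eᵀ eᵀ c l m n = Complex.I / 6 * act F eᵀ eᵀ (symbVec p) l m n
        + s * Complex.I / 6 * (kd l m * lower g x (torsionPseudo g Γ x) n
          + kd l n * lower g x (torsionPseudo g Γ x) m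
          - torsionPseudo g Γ x l * (g x m n : ℂ))
        - 2 / 3 * (kd l m * torsionVec Γ x n)
        - 2 * tensorShift g (torsionTensor g Γ) x l m n := by
      conv_lhs => rw [h7]
      rw [act_sub, act_sub, act_add, act_mul, act_mul, act_mul, act_mul, act_sub, act_add,
        act_proj hF hlow', act_proj_outer hF hlow', act_metric hF, ← hp',
        act_proj hF (torsionVec_eq hF hΓ (hL x hx)),
        tensorShift_eq hF (torsionTensor_eq hF hΓ (hL x hx))]
    rw [hΓ, h9, heps]; ring

theorem solvedSixth_of_algEq (hg : IsLorentzMetric U g)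
    (hL : ∀ x ∈ U, ∀ l m n, leviCivita g x l m n = leviCivita g x l n m)
    (H : ∀ x ∈ U, ∀ b, algEq α (g x) (Γ x - leviCivita g x) b = 0)
    {s : ℂ} (hs : s = 1 ∨ s = -1) (hα : α = s * Complex.I / 6) : SolvedSixth s U g Γ := by
  refine ⟨fun x hx => ?_, fun x hx l m n => ?_⟩ <;>
  obtain ⟨e, F, c, hF, hΓ, hc⟩ := exists_frame_components hg H hx <;>
  rw [hα, I_mul_sixth] at hc <;>
  obtain ⟨hd, hform⟩ := flat_sixth hs hc
  · refine (dual_iff hF (torsionTensor_eq hF hΓ (hL x hx))).mpr ?_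
    rwa [show -(s * Complex.I) * Complex.I = s by linear_combination -s * Complex.I_sq]
  · have h7 : c = fun i j k => -(2 / 3) * (kd i j * flatVec c k)
        + 2 / 3 * (flatTensor c i k j + flatTensor c j k i) := by
      funext i j k
      rw [hform i j k]; ring
    have h9 : act F eᵀ eᵀ c l m n = -(2 / 3) * (kd l m * torsionVec Γ x n)
        + 2 / 3 * tensorShiftSix g (torsionTensor g Γ) x l m n := by
      conv_lhs => rw [h7]
      rw [act_add, act_mul, act_mul, act_proj hF (torsionVec_eq hF hΓ (hL x hx)),
        tensorShiftSix_eq hF (torsionTensor_eq hF hΓ (hL x hx))]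
    rw [hΓ, h9]; ring

end Solved

/-! ### Derivatives of the determinant, the inverse and P along curves of metrics -/

open Filter Topology

theorem contDiffAt_det {E : Type*} [NormedAddCommGroup E] [NormedSpace ℝ E] {n : WithTop ℕ∞}
    {M : E → Matrix (Fin 4) (Fin 4) ℝ} {x : E}
    (hM : ∀ i j, ContDiffAt ℝ n (fun y => M y i j) x) :
    ContDiffAt ℝ n (fun y => (M y).det) x := by
  simp only [Matrix.det_apply]
  exact ContDiffAt.sum fun σ _ => (contDiffAt_prod fun i _ => hM _ _).const_smul _

theorem contDiffAt_inv {E : Type*} [NormedAddCommGroup E] [NormedSpace ℝ E] {n : WithTop ℕ∞}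
    {M : E → Matrix (Fin 4) (Fin 4) ℝ} {x : E}
    (hM : ∀ i j, ContDiffAt ℝ n (fun y => M y i j) x) (hx : (M x).det ≠ 0) (i j : Fin 4) :
    ContDiffAt ℝ n (fun y => (M y)⁻¹ i j) x := by
  have h1 : (fun y => (M y)⁻¹ i j) = fun y => (M y).det⁻¹ * (M y).adjugate i j := by
    funext y
    rw [Matrix.inv_def, Matrix.smul_apply, smul_eq_mul, Ring.inverse_eq_inv']
  rw [h1]
  refine ((contDiffAt_det hM).inv hx).mul ?_
  simp only [Matrix.adjugate_apply]
  refine contDiffAt_det fun k l => ?_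
  by_cases hk : k = j
  · simp only [Matrix.updateRow_apply, hk, if_true]
    exact contDiffAt_const
  · simp only [Matrix.updateRow_apply, hk, if_false]
    exact hM k l

theorem contDiffAt_sqrt_neg_det {E : Type*} [NormedAddCommGroup E] [NormedSpace ℝ E]
    {n : WithTop ℕ∞} {M : E → Matrix (Fin 4) (Fin 4) ℝ} {x : E}
    (hM : ∀ i j, ContDiffAt ℝ n (fun y => M y i j) x) (hx : (M x).det < 0) :
    ContDiffAt ℝ n (fun y => Real.sqrt (-(M y).det)) x :=
  (contDiffAt_det hM).neg.sqrt (by linarith [hx] : -(M x).det ≠ 0)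

theorem ContDiffAt.ofReal {E : Type*} [NormedAddCommGroup E] [NormedSpace ℝ E]
    {n : WithTop ℕ∞} {f : E → ℝ} {x : E} (hf : ContDiffAt ℝ n f x) :
    ContDiffAt ℝ n (fun y => (f y : ℂ)) x :=
  Complex.ofRealCLM.contDiff.contDiffAt.comp x hf

theorem contDiffAt_dens {E : Type*} [NormedAddCommGroup E] [NormedSpace ℝ E]
    {k : WithTop ℕ∞} {M : E → Matrix (Fin 4) (Fin 4) ℝ} {x : E}
    (hM : ∀ i j, ContDiffAt ℝ k (fun y => M y i j) x) (hx : (M x).det < 0) (α : ℂ)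
    (a b n m : Fin 4) : ContDiffAt ℝ k (fun y => dens α (M y) a b n m) x := by
  simp only [dens, Matrix.of_apply]
  have hi := contDiffAt_inv hM hx.ne
  refine ContDiffAt.add (ContDiffAt.mul (ContDiffAt.mul contDiffAt_const
    (ContDiffAt.ofReal (contDiffAt_sqrt_neg_det hM hx))) ?_) (ContDiffAt.mul contDiffAt_const ?_)
  · exact (contDiffAt_const.mul (ContDiffAt.ofReal (hi n b))).sub
      (contDiffAt_const.mul (ContDiffAt.ofReal (hi n a)))
  · exact ContDiffAt.sum fun r _ => (ContDiffAt.ofReal (hM m r)).mul contDiffAt_const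

section Curve

variable {M : ℝ → Matrix (Fin 4) (Fin 4) ℝ} {M' : Matrix (Fin 4) (Fin 4) ℝ} {t : ℝ}

theorem hasDerivAt_comp_entries {E : Type*} [NormedAddCommGroup E] [NormedSpace ℝ E]
    (f : (Fin 4 → Fin 4 → ℝ) → E) (hM : ∀ i j, HasDerivAt (fun s => M s i j) (M' i j) t)
    (hf : DifferentiableAt ℝ f (fun i j => M t i j)) :
    HasDerivAt (fun s => f (fun i j => M s i j)) (fderiv ℝ f (fun i j => M t i j)
      (fun i j => M' i j)) t := by
  have h1 : HasDerivAt (fun s => (fun i j => M s i j : Fin 4 → Fin 4 → ℝ)) (fun i j => M' i j) t :=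
    hasDerivAt_pi.mpr fun i => hasDerivAt_pi.mpr fun j => hM i j
  exact hf.hasFDerivAt.comp_hasDerivAt t h1

/-- Jacobi's formula. The determinant is differentiable, so its derivative along the curve depends
only on the velocity and may be computed on the tangent line, where det(1 + sX) = 1 + s tr X +
O(s²). -/
theorem hasDerivAt_det (hM : ∀ i j, HasDerivAt (fun s => M s i j) (M' i j) t)
    (ht : (M t).det ≠ 0) :
    HasDerivAt (fun s => (M s).det) ((M t).det * ((M t)⁻¹ * M').trace) t := by
  have hf : ContDiff ℝ 1 (fun G : Fin 4 → Fin 4 → ℝ => (Matrix.of G).det) :=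
    contDiff_iff_contDiffAt.mpr fun G => contDiffAt_det fun i j => by
      simp only [Matrix.of_apply]; fun_prop
  have hd := fun G => (hf.differentiable (by norm_num)) G
  have h1 := hasDerivAt_comp_entries _ hM (hd _)
  have hline : ∀ i j, HasDerivAt (fun s : ℝ => (M t + s • M') i j) (M' i j) 0 := by
    intro i j
    simp only [Matrix.add_apply, Matrix.smul_apply, smul_eq_mul]
    simpa using ((hasDerivAt_id (0 : ℝ)).mul_const (M' i j)).const_add (M t i j)
  have h2 := hasDerivAt_comp_entries (M := fun s => M t + s • M') _ hline (hd _)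
  have h3 : ∀ s : ℝ, (M t + s • M').det
      = (M t).det * (1 + ((M t)⁻¹ * M').trace * s + (det (1 + (Polynomial.X : Polynomial ℝ) • ((M t)⁻¹ * M').map Polynomial.C)).divX.divX.eval s * s ^ 2) := by
    intro s
    rw [← Matrix.det_one_add_smul, ← Matrix.det_mul]
    congr 1
    rw [Matrix.mul_add, Matrix.mul_one, Matrix.mul_smul, ← Matrix.mul_assoc,
      Matrix.mul_nonsing_inv _ (isUnit_iff_ne_zero.mpr ht), Matrix.one_mul]
  have h4 : HasDerivAt (fun s : ℝ => (M t + s • M').det) ((M t).det * ((M t)⁻¹ * M').trace) 0 := by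
    simp only [h3]
    obtain ⟨p, hp⟩ : ∃ p : Polynomial ℝ, p = (det (1 + (Polynomial.X : Polynomial ℝ) • ((M t)⁻¹ * M').map Polynomial.C)).divX.divX := ⟨_, rfl⟩
    rw [← hp]
    have h5 := (((hasDerivAt_id (0 : ℝ)).const_mul ((M t)⁻¹ * M').trace).const_add 1).add
      ((p.hasDerivAt 0).mul ((hasDerivAt_id (0 : ℝ)).pow 2))
    have h6 := h5.const_mul (M t).det
    simp at h6
    simpa using h6
  have h5 := h2.unique h4
  simp only [zero_smul, add_zero] at h5
  rw [← h5]
  exact h1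

/-- Differentiability comes from the cofactor formula; the value follows by differentiating M⁻¹M =
1, which holds near t. -/
theorem hasDerivAt_inv (hM : ∀ i j, HasDerivAt (fun s => M s i j) (M' i j) t)
    (ht : (M t).det ≠ 0) (i j : Fin 4) :
    HasDerivAt (fun s => (M s)⁻¹ i j) ((-((M t)⁻¹ * M' * (M t)⁻¹)) i j) t := by
  have hex : ∀ i j, ∃ d, HasDerivAt (fun s => (M s)⁻¹ i j) d t := fun i j =>
    ⟨_, hasDerivAt_comp_entries (fun G => (Matrix.of G)⁻¹ i j) hM
      ((contDiffAt_inv (n := 1) (M := fun G : Fin 4 → Fin 4 → ℝ => Matrix.of G)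
        (fun i j => by simp only [Matrix.of_apply]; fun_prop) ht i j).differentiableAt (by norm_num))⟩
  choose D hD using hex
  have hev : ∀ᶠ s in 𝓝 t, (M s).det ≠ 0 :=
    (hasDerivAt_det hM ht).continuousAt.eventually_ne ht
  have h1 : ∀ i j, ∑ k, (D i k * M t k j + (M t)⁻¹ i k * M' k j) = 0 := by
    intro i j
    have h2 : HasDerivAt (fun s => ∑ k, (M s)⁻¹ i k * M s k j)
        (∑ k, (D i k * M t k j + (M t)⁻¹ i k * M' k j)) t :=
      HasDerivAt.fun_sum fun k _ => (hD i k).mul (hM k j)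
    have h3 : (fun s => ∑ k, (M s)⁻¹ i k * M s k j) =ᶠ[𝓝 t] fun _ => (1 : Matrix (Fin 4) (Fin 4) ℝ) i j := by
      filter_upwards [hev] with s hs
      rw [← Matrix.mul_apply, Matrix.nonsing_inv_mul _ (isUnit_iff_ne_zero.mpr hs)]
    exact h2.unique ((hasDerivAt_const t _).congr_of_eventuallyEq h3)
  have h2 : Matrix.of D * M t = -((M t)⁻¹ * M') := by
    ext i j
    have := h1 i j
    rw [Finset.sum_add_distrib] at this
    simp only [Matrix.mul_apply, Matrix.of_apply, Matrix.neg_apply]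
    linarith
  have h3 : Matrix.of D = -((M t)⁻¹ * M' * (M t)⁻¹) := by
    calc Matrix.of D = Matrix.of D * M t * (M t)⁻¹ := by
          rw [Matrix.mul_assoc, Matrix.mul_nonsing_inv _ (isUnit_iff_ne_zero.mpr ht), Matrix.mul_one]
      _ = _ := by rw [h2, Matrix.neg_mul]
  rw [← h3]
  exact hD i j

/-- Infinitesimal form of `det_mul_symb`. By linearity it suffices to take A a matrix unit, which
leaves a finite integer identity. -/
theorem symb_trace (A : CMat) (r n a b : Fin 4) :
    ∑ k, (A r k * (symb k n a b : ℂ) + A n k * (symb r k a b : ℂ) + A a k * (symb r n k b : ℂ)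
      + A b k * (symb r n a k : ℂ)) = A.trace * (symb r n a b : ℂ) := by
  have key : ∀ r n a b p q : Fin 4, (if r = p then symb q n a b else 0)
      + (if n = p then symb r q a b else 0) + (if a = p then symb r n q b else 0)
      + (if b = p then symb r n a q else 0) = if p = q then symb r n a b else 0 := by
    decide +kernel
  have h1 : ∀ (i : Fin 4) (f : Fin 4 → ℤ), ∑ k, A i k * (f k : ℂ)
      = ∑ p, ∑ k, A p k * ((if i = p then f k else 0 : ℤ) : ℂ) := by
    intro i f
    symm
    rw [Finset.sum_eq_single i]
    · simp
    · intro p _ hp; simp [hp.symm]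
    · simp
  simp only [Finset.sum_add_distrib]
  rw [h1 r fun k => symb k n a b, h1 n fun k => symb r k a b, h1 a fun k => symb r n k b,
    h1 b fun k => symb r n a k]
  simp only [← Finset.sum_add_distrib, ← mul_add, ← Int.cast_add, key]
  simp [Matrix.trace, Finset.sum_mul]

/-- The variation of `P^{ab}` under `δg = g A + Aᵀ g`. -/
def densVar (α : ℂ) (G : Matrix (Fin 4) (Fin 4) ℝ) (A : CMat) (a b : Fin 4) : CMat :=
  A.trace • dens α G a b + dens α G a b * A - A * dens α G a b
    - ∑ r, A a r • dens α G r b - ∑ r, A b r • dens α G a r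

/-- Expands the gl(4) action into variations of √(-g), g⁻¹ and g. In the Holst term `symb_trace`
trades the trace and the rotations of three symbol indices for a rotation of the fourth, so only the
metric factor appears varied. -/
theorem densVar_apply (α : ℂ) (G : Matrix (Fin 4) (Fin 4) ℝ) (A : CMat) (a b n m : Fin 4) :
    densVar α G A a b n m = 1 / 2 * (Real.sqrt (-G.det) : ℂ) *
        (A.trace * (kd a m * (G⁻¹ n b : ℝ) - kd b m * (G⁻¹ n a : ℝ))
        - (kd a m * ∑ k, (A n k * (G⁻¹ k b : ℝ) + (G⁻¹ n k : ℝ) * A b k)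
          - kd b m * ∑ k, (A n k * (G⁻¹ k a : ℝ) + (G⁻¹ n k : ℝ) * A a k)))
      + α * ∑ r, (∑ k, ((G m k : ℂ) * A k r + A k m * (G k r : ℂ))) * (symb r n a b : ℂ) := by
  have h1 : (dens α G a b * A) n m = 1 / 2 * (Real.sqrt (-G.det) : ℂ) *
      (A a m * (G⁻¹ n b : ℝ) - A b m * (G⁻¹ n a : ℝ))
      + α * ∑ r, (∑ k, A k m * (G k r : ℂ)) * (symb r n a b : ℂ) := by
    have h2 : ∀ k, dens α G a b n k * A k m = 1 / 2 * (Real.sqrt (-G.det) : ℂ) *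
        ((G⁻¹ n b : ℝ) * (kd a k * A k m)) - 1 / 2 * (Real.sqrt (-G.det) : ℂ) *
        ((G⁻¹ n a : ℝ) * (kd b k * A k m))
        + α * ∑ r, A k m * (G k r : ℂ) * (symb r n a b : ℂ) := by
      intro k
      simp only [dens, Matrix.of_apply, add_mul, mul_assoc α, Finset.sum_mul]
      congr 1
      · ring
      · congr 1; exact Finset.sum_congr rfl fun r _ => by ring
    simp only [Matrix.mul_apply, h2, Finset.sum_add_distrib, Finset.sum_sub_distrib,
      ← Finset.mul_sum, sum_kd_left, Finset.sum_mul]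
    rw [Finset.sum_comm]
    ring
  have h3 : (A * dens α G a b) n m = 1 / 2 * (Real.sqrt (-G.det) : ℂ) *
      (kd a m * ∑ k, A n k * (G⁻¹ k b : ℝ) - kd b m * ∑ k, A n k * (G⁻¹ k a : ℝ))
      + α * ∑ r, (G m r : ℂ) * ∑ k, A n k * (symb r k a b : ℂ) := by
    have h2 : ∀ k, A n k * dens α G a b k m = 1 / 2 * (Real.sqrt (-G.det) : ℂ) *
        (kd a m * (A n k * (G⁻¹ k b : ℝ))) - 1 / 2 * (Real.sqrt (-G.det) : ℂ) *
        (kd b m * (A n k * (G⁻¹ k a : ℝ)))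
        + α * ∑ r, (G m r : ℂ) * (A n k * (symb r k a b : ℂ)) := by
      intro k
      simp only [dens, Matrix.of_apply, mul_add, Finset.mul_sum]
      congr 1
      · ring
      · exact Finset.sum_congr rfl fun r _ => by ring
    simp only [Matrix.mul_apply, h2, Finset.sum_add_distrib, Finset.sum_sub_distrib,
      ← Finset.mul_sum]
    rw [Finset.sum_comm]
    simp only [← Finset.mul_sum]
    ring
  have h4 : ∑ k, A a k * dens α G k b n m = 1 / 2 * (Real.sqrt (-G.det) : ℂ) *
      (A a m * (G⁻¹ n b : ℝ) - kd b m * ∑ k, (G⁻¹ n k : ℝ) * A a k)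
      + α * ∑ r, (G m r : ℂ) * ∑ k, A a k * (symb r n k b : ℂ) := by
    have h2 : ∀ k, A a k * dens α G k b n m = 1 / 2 * (Real.sqrt (-G.det) : ℂ) *
        ((G⁻¹ n b : ℝ) * (kd k m * A a k)) - 1 / 2 * (Real.sqrt (-G.det) : ℂ) *
        (kd b m * ((G⁻¹ n k : ℝ) * A a k))
        + α * ∑ r, (G m r : ℂ) * (A a k * (symb r n k b : ℂ)) := by
      intro k
      simp only [dens, Matrix.of_apply, mul_add, Finset.mul_sum]
      congr 1
      · ring
      · exact Finset.sum_congr rfl fun r _ => by ring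
    simp only [h2, Finset.sum_add_distrib, Finset.sum_sub_distrib,
      ← Finset.mul_sum, sum_kd_right]
    rw [Finset.sum_comm]
    simp only [← Finset.mul_sum]
    ring
  have h5 : ∑ k, A b k * dens α G a k n m = 1 / 2 * (Real.sqrt (-G.det) : ℂ) *
      (kd a m * ∑ k, (G⁻¹ n k : ℝ) * A b k - A b m * (G⁻¹ n a : ℝ))
      + α * ∑ r, (G m r : ℂ) * ∑ k, A b k * (symb r n a k : ℂ) := by
    have h2 : ∀ k, A b k * dens α G a k n m = 1 / 2 * (Real.sqrt (-G.det) : ℂ) *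
        (kd a m * ((G⁻¹ n k : ℝ) * A b k)) - 1 / 2 * (Real.sqrt (-G.det) : ℂ) *
        ((G⁻¹ n a : ℝ) * (kd k m * A b k))
        + α * ∑ r, (G m r : ℂ) * (A b k * (symb r n a k : ℂ)) := by
      intro k
      simp only [dens, Matrix.of_apply, mul_add, Finset.mul_sum]
      congr 1
      · ring
      · exact Finset.sum_congr rfl fun r _ => by ring
    simp only [h2, Finset.sum_add_distrib, Finset.sum_sub_distrib,
      ← Finset.mul_sum, sum_kd_right]
    rw [Finset.sum_comm]
    simp only [← Finset.mul_sum]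
    ring
  have h6 : ∑ r, (∑ k, (G m k : ℂ) * A k r) * (symb r n a b : ℂ)
      = ∑ r, (G m r : ℂ) * ∑ k, A r k * (symb k n a b : ℂ) := by
    simp only [Finset.sum_mul, Finset.mul_sum]
    rw [Finset.sum_comm]
    exact Finset.sum_congr rfl fun r _ => Finset.sum_congr rfl fun k _ => by ring
  have h7 : A.trace * ∑ r, (G m r : ℂ) * (symb r n a b : ℂ)
      = ∑ r, (G m r : ℂ) * ∑ k, A r k * (symb k n a b : ℂ)
        + ∑ r, (G m r : ℂ) * ∑ k, A n k * (symb r k a b : ℂ)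
        + ∑ r, (G m r : ℂ) * ∑ k, A a k * (symb r n k b : ℂ)
        + ∑ r, (G m r : ℂ) * ∑ k, A b k * (symb r n a k : ℂ) := by
    rw [Finset.mul_sum, ← Finset.sum_add_distrib, ← Finset.sum_add_distrib,
      ← Finset.sum_add_distrib]
    refine Finset.sum_congr rfl fun r _ => ?_
    have h := symb_trace A r n a b
    simp only [Finset.sum_add_distrib] at h
    linear_combination -(G m r : ℂ) * h
  simp only [densVar, Matrix.sub_apply, Matrix.add_apply, Matrix.smul_apply, Matrix.sum_apply,
    smul_eq_mul, h1, h3, h4, h5, Finset.sum_add_distrib, add_mul, h6]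
  simp only [dens, Matrix.of_apply]
  linear_combination α * h7

/-- Serves two purposes: with A the Levi-Civita matrix it yields the covariant constancy of P, and
with A = g⁻¹δg/2 the variation of the action under the metric. -/
theorem hasDerivAt_dens {A : Matrix (Fin 4) (Fin 4) ℝ}
    (hM : ∀ i j, HasDerivAt (fun s => M s i j) ((M t * A + Aᵀ * M t) i j) t)
    (ht : (M t).det < 0) (α : ℂ) (a b n m : Fin 4) :
    HasDerivAt (fun s => dens α (M s) a b n m)
      (densVar α (M t) (A.map (fun r : ℝ => (r : ℂ))) a b n m) t := by
  have hu : IsUnit (M t).det := isUnit_iff_ne_zero.mpr ht.ne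
  have hpos : 0 < Real.sqrt (-(M t).det) := Real.sqrt_pos.mpr (by linarith)
  have hs : HasDerivAt (fun s => Real.sqrt (-(M s).det)) (A.trace * Real.sqrt (-(M t).det)) t := by
    have h0 : HasDerivAt (fun s => -(M s).det)
        (-((M t).det * ((M t)⁻¹ * (M t * A + Aᵀ * M t)).trace)) t := (hasDerivAt_det hM ht.ne).neg
    have h1 := h0.sqrt (by linarith)
    have h2 : ((M t)⁻¹ * (M t * A + Aᵀ * M t)).trace = 2 * A.trace := by
      rw [Matrix.mul_add, Matrix.trace_add, ← Matrix.mul_assoc, Matrix.nonsing_inv_mul _ hu,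
        Matrix.one_mul, Matrix.trace_mul_comm, Matrix.mul_assoc, Matrix.mul_nonsing_inv _ hu,
        Matrix.mul_one, Matrix.trace_transpose]
      ring
    rw [h2] at h1
    refine h1.congr_deriv ?_
    have h3 : Real.sqrt (-(M t).det) ^ 2 = -(M t).det := Real.sq_sqrt (by linarith)
    rw [div_eq_iff (by positivity)]
    linear_combination -2 * A.trace * h3
  have hX : ∀ n b, HasDerivAt (fun s => (M s)⁻¹ n b)
      (-∑ k, (A n k * (M t)⁻¹ k b + (M t)⁻¹ n k * A b k)) t := by
    intro n b
    have h1 := hasDerivAt_inv hM ht.ne n b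
    have h2 : (M t)⁻¹ * (M t * A + Aᵀ * M t) * (M t)⁻¹ = A * (M t)⁻¹ + (M t)⁻¹ * Aᵀ := by
      rw [Matrix.mul_add, Matrix.add_mul, ← Matrix.mul_assoc, Matrix.nonsing_inv_mul _ hu,
        Matrix.one_mul, Matrix.mul_assoc, Matrix.mul_assoc, Matrix.mul_nonsing_inv _ hu,
        Matrix.mul_one]
    rw [h2] at h1
    simpa only [Matrix.neg_apply, Matrix.add_apply, Matrix.mul_apply, Matrix.transpose_apply,
      Finset.sum_add_distrib] using h1
  have h1 := ((hs.ofReal_comp.const_mul (1 / 2 : ℂ)).mul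
    (((hX n b).ofReal_comp.const_mul (kd a m)).sub ((hX n a).ofReal_comp.const_mul (kd b m)))).add
    ((HasDerivAt.fun_sum fun r (_ : r ∈ Finset.univ) =>
      (hM m r).ofReal_comp.mul_const (symb r n a b : ℂ)).const_mul α)
  have h2 : (A.map (fun r : ℝ => (r : ℂ))).trace = (A.trace : ℂ) := by
    simp [Matrix.trace]
  have h3 : HasDerivAt (fun s => dens α (M s) a b n m) _ t := h1
  refine h3.congr_deriv ?_
  rw [densVar_apply, h2]
  simp only [Matrix.map_apply, Matrix.add_apply, Matrix.mul_apply, Matrix.transpose_apply]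
  simp only [Pi.sub_apply]
  push_cast
  simp only [Finset.sum_add_distrib]
  ring

end Curve

/-! ### Coordinate derivatives and the Levi-Civita connection -/

theorem ContDiffAt.pd {E : Type*} [NormedAddCommGroup E] [NormedSpace ℝ E] {f : Coord → E}
    {x : Coord} (hf : ContDiffAt ℝ ∞ f x) (m : Fin 4) : ContDiffAt ℝ ∞ (MetricAffine.pd m f) x :=
  (hf.fderiv_right (m := ∞) (by simp)).clm_apply contDiffAt_const

theorem pd_congr {E : Type*} [NormedAddCommGroup E] [NormedSpace ℝ E] {f h : Coord → E}
    {x : Coord} (hfh : f =ᶠ[𝓝 x] h) (m : Fin 4) : pd m f x = pd m h x := by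
  rw [pd, pd, hfh.fderiv_eq]

theorem hasDerivAt_line {E : Type*} [NormedAddCommGroup E] [NormedSpace ℝ E] {f : Coord → E}
    {x : Coord} (hf : DifferentiableAt ℝ f x) (m : Fin 4) :
    HasDerivAt (fun t : ℝ => f (x + t • Pi.single m 1)) (pd m f x) 0 := by
  have h1 : HasDerivAt (fun t : ℝ => x + t • (Pi.single m 1 : Coord)) (Pi.single m 1) 0 := by
    simpa using ((hasDerivAt_id (0 : ℝ)).smul_const (Pi.single m 1 : Coord)).const_add x
  have h2 : DifferentiableAt ℝ f (x + (0 : ℝ) • (Pi.single m 1 : Coord)) := by simpa using hf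
  have h3 := h2.hasFDerivAt.comp_hasDerivAt (0 : ℝ) h1
  simp only [zero_smul, add_zero] at h3
  exact h3

section Metric

variable {U : Set Coord} {g : MetricField}

theorem IsLorentzMetric.contDiffAt (hU : IsOpen U) (hg : IsLorentzMetric U g) {x : Coord}
    (hx : x ∈ U) (m n : Fin 4) : ContDiffAt ℝ ∞ (fun y => g y m n) x :=
  (hg.smooth m n).contDiffAt (hU.mem_nhds hx)

theorem IsLorentzMetric.isSymm (hg : IsLorentzMetric U g) {x : Coord} (hx : x ∈ U) :
    (g x)ᵀ = g x := by
  obtain ⟨e, -, he⟩ := hg.signature x hx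
  rw [he]
  simp only [Matrix.transpose_mul, Matrix.transpose_transpose, minkowski,
    Matrix.diagonal_transpose, Matrix.mul_assoc]

theorem IsLorentzMetric.symm (hg : IsLorentzMetric U g) {x : Coord} (hx : x ∈ U) (m n : Fin 4) :
    g x m n = g x n m := by
  conv_lhs => rw [← hg.isSymm hx]
  rfl

theorem IsLorentzMetric.det_neg (hg : IsLorentzMetric U g) {x : Coord} (hx : x ∈ U) :
    (g x).det < 0 := by
  obtain ⟨e, he, hge⟩ := hg.signature x hx
  rw [hge, Matrix.det_mul, Matrix.det_mul, Matrix.det_transpose, det_minkowski]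
  nlinarith [sq_nonneg e.det, mul_self_pos.mpr he.ne_zero]

theorem pd_metric_symm (hU : IsOpen U) (hg : IsLorentzMetric U g) {x : Coord} (hx : x ∈ U)
    (c m n : Fin 4) : pd c (fun y => g y m n) x = pd c (fun y => g y n m) x :=
  pd_congr (by filter_upwards [hU.mem_nhds hx] with y hy using hg.symm hy m n) c

/-- The matrix `Γ̃^l_{nc}` of the Levi-Civita connection, over the reals. -/
def lcMat (g : MetricField) (x : Coord) (c : Fin 4) : Matrix (Fin 4) (Fin 4) ℝ :=
  Matrix.of fun l n => 1 / 2 * ∑ r, (g x)⁻¹ r l * (pd n (fun y => g y c r) x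
    + pd c (fun y => g y r n) x - pd r (fun y => g y n c) x)

theorem connMat_leviCivita (g : MetricField) (x : Coord) (c : Fin 4) :
    connMat (leviCivita g x) c = (lcMat g x c).map (fun r : ℝ => (r : ℂ)) := rfl

theorem leviCivita_symm (hU : IsOpen U) (hg : IsLorentzMetric U g) {x : Coord} (hx : x ∈ U)
    (l m n : Fin 4) : leviCivita g x l m n = leviCivita g x l n m := by
  simp only [leviCivita]
  congr 2
  refine Finset.sum_congr rfl fun r _ => ?_
  rw [pd_metric_symm hU hg hx m n r, pd_metric_symm hU hg hx n r m, pd_metric_symm hU hg hx r m n]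
  ring

/-- Metric compatibility, in the form δg = gA + Aᵀg that `hasDerivAt_dens` accepts. -/
theorem lcMat_compat (hU : IsOpen U) (hg : IsLorentzMetric U g) {x : Coord} (hx : x ∈ U)
    (c m n : Fin 4) :
    pd c (fun y => g y m n) x = (g x * lcMat g x c + (lcMat g x c)ᵀ * g x) m n := by
  have hu : IsUnit (g x).det := isUnit_iff_ne_zero.mpr (hg.det_neg hx).ne
  have h1 : ∀ m n, (g x * lcMat g x c) m n = 1 / 2 * (pd n (fun y => g y c m) x
      + pd c (fun y => g y m n) x - pd m (fun y => g y n c) x) := by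
    intro m n
    have h2 : (g x)⁻¹ᵀ = (g x)⁻¹ := by rw [Matrix.transpose_nonsing_inv, hg.isSymm hx]
    have h3 : ∀ r, ∑ l, g x m l * (g x)⁻¹ r l = (1 : Matrix (Fin 4) (Fin 4) ℝ) m r := by
      intro r
      rw [← Matrix.mul_nonsing_inv _ hu, Matrix.mul_apply]
      refine Finset.sum_congr rfl fun l _ => ?_
      conv_lhs => rw [← h2]
      rfl
    simp only [Matrix.mul_apply, lcMat, Matrix.of_apply, Finset.mul_sum]
    rw [Finset.sum_comm]
    have h4 : ∀ r, ∑ l, g x m l * (1 / 2 * ((g x)⁻¹ r l * (pd n (fun y => g y c r) x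
        + pd c (fun y => g y r n) x - pd r (fun y => g y n c) x)))
        = (1 : Matrix (Fin 4) (Fin 4) ℝ) m r * (1 / 2 * (pd n (fun y => g y c r) x
        + pd c (fun y => g y r n) x - pd r (fun y => g y n c) x)) := by
      intro r
      rw [← h3, Finset.sum_mul]
      exact Finset.sum_congr rfl fun l _ => by ring
    simp only [h4]
    simp [Matrix.one_apply]
  have h5 : ((lcMat g x c)ᵀ * g x) m n = (g x * lcMat g x c) n m := by
    conv_lhs => rw [← hg.isSymm hx]
    rw [← Matrix.transpose_mul, Matrix.transpose_apply]
  rw [Matrix.add_apply, h5, h1, h1, pd_metric_symm hU hg hx n m c, pd_metric_symm hU hg hx m n c,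
    pd_metric_symm hU hg hx c n m]
  ring

theorem hasDerivAt_metric_line (hU : IsOpen U) (hg : IsLorentzMetric U g) {x : Coord}
    (hx : x ∈ U) (c i j : Fin 4) :
    HasDerivAt (fun t : ℝ => g (x + t • Pi.single c 1) i j)
      ((g (x + (0 : ℝ) • Pi.single c 1) * lcMat g x c
        + (lcMat g x c)ᵀ * g (x + (0 : ℝ) • Pi.single c 1)) i j) 0 := by
  rw [zero_smul, add_zero, ← lcMat_compat hU hg hx]
  exact hasDerivAt_line ((hg.contDiffAt hU hx i j).differentiableAt (by simp)) c

theorem contDiffAt_dens_metric (hU : IsOpen U) (hg : IsLorentzMetric U g) {x : Coord}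
    (hx : x ∈ U) (α : ℂ) (a b n m : Fin 4) :
    ContDiffAt ℝ ∞ (fun y => dens α (g y) a b n m) x :=
  contDiffAt_dens (hg.contDiffAt hU hx) (hg.det_neg hx) α a b n m

/-- Covariant constancy of `P^{ab}`. -/
theorem pd_dens (hU : IsOpen U) (hg : IsLorentzMetric U g) {x : Coord} (hx : x ∈ U) (α : ℂ)
    (c a b n m : Fin 4) : pd c (fun y => dens α (g y) a b n m) x
      = densVar α (g x) (connMat (leviCivita g x) c) a b n m := by
  have h1 := hasDerivAt_line
    ((contDiffAt_dens_metric hU hg hx α a b n m).differentiableAt (by simp)) c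
  have h2 := hasDerivAt_dens (M := fun t : ℝ => g (x + t • Pi.single c 1)) (A := lcMat g x c)
    (hasDerivAt_metric_line hU hg hx c) (by simpa using hg.det_neg hx) α a b n m
  have h3 := h1.unique h2
  simpa [connMat_leviCivita] using h3

theorem contDiffAt_leviCivita (hU : IsOpen U) (hg : IsLorentzMetric U g) {x : Coord}
    (hx : x ∈ U) (l m n : Fin 4) : ContDiffAt ℝ ∞ (fun y => leviCivita g y l m n) x := by
  refine ContDiffAt.ofReal (contDiffAt_const.mul (ContDiffAt.sum fun r _ => ?_))
  have hp : ∀ a i j, ContDiffAt ℝ ∞ (fun y => pd a (fun z => g z i j) y) x := fun a i j =>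
    ContDiffAt.pd (hg.contDiffAt hU hx i j) a
  exact (contDiffAt_inv (hg.contDiffAt hU hx) (hg.det_neg hx).ne r l).mul
    (((hp m n r).add (hp n r m)).sub (hp r m n))

end Metric

section MatrixField

/-- The entrywise partial derivative of a field of matrices. -/
def pdMat (c : Fin 4) (M : Coord → CMat) (x : Coord) : CMat :=
  Matrix.of fun i j => pd c (fun y => M y i j) x

variable {M N : Coord → CMat} {x : Coord}

theorem pd_add {f h : Coord → ℂ} (hf : DifferentiableAt ℝ f x) (hh : DifferentiableAt ℝ h x)
    (c : Fin 4) : pd c (fun y => f y + h y) x = pd c f x + pd c h x := by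
  simp only [pd, fderiv_fun_add hf hh, _root_.add_apply]

theorem pd_mul {f h : Coord → ℂ} (hf : DifferentiableAt ℝ f x) (hh : DifferentiableAt ℝ h x)
    (c : Fin 4) : pd c (fun y => f y * h y) x = pd c f x * h x + f x * pd c h x := by
  simp only [pd, fderiv_fun_mul hf hh, _root_.add_apply,
    _root_.smul_apply, smul_eq_mul]
  ring

theorem pd_sum {ι : Type*} {s : Finset ι} {f : ι → Coord → ℂ}
    (hf : ∀ i ∈ s, DifferentiableAt ℝ (f i) x) (c : Fin 4) :
    pd c (fun y => ∑ i ∈ s, f i y) x = ∑ i ∈ s, pd c (f i) x := by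
  simp only [pd, fderiv_fun_sum hf, _root_.sum_apply]

theorem pd_const (z : ℂ) (c : Fin 4) : pd c (fun _ => z) x = 0 := by
  simp [pd]

theorem pdMat_add (hM : ∀ i j, DifferentiableAt ℝ (fun y => M y i j) x)
    (hN : ∀ i j, DifferentiableAt ℝ (fun y => N y i j) x) (c : Fin 4) :
    pdMat c (fun y => M y + N y) x = pdMat c M x + pdMat c N x := by
  ext i j
  exact pd_add (hM i j) (hN i j) c

theorem pdMat_mul (hM : ∀ i j, DifferentiableAt ℝ (fun y => M y i j) x)
    (hN : ∀ i j, DifferentiableAt ℝ (fun y => N y i j) x) (c : Fin 4) :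
    pdMat c (fun y => M y * N y) x = pdMat c M x * N x + M x * pdMat c N x := by
  ext i j
  simp only [pdMat, Matrix.of_apply, Matrix.mul_apply, Matrix.add_apply]
  rw [pd_sum fun k _ => (hM i k).fun_mul (hN k j), ← Finset.sum_add_distrib]
  exact Finset.sum_congr rfl fun k _ => pd_mul (hM i k) (hN k j) c

theorem differentiableAt_mul_apply (hM : ∀ i j, DifferentiableAt ℝ (fun y => M y i j) x)
    (hN : ∀ i j, DifferentiableAt ℝ (fun y => N y i j) x) (i j : Fin 4) :
    DifferentiableAt ℝ (fun y => (M y * N y) i j) x := by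
  simp only [Matrix.mul_apply]
  exact DifferentiableAt.fun_sum fun k _ => (hM i k).fun_mul (hN k j)

theorem pd_trace (hM : ∀ i j, DifferentiableAt ℝ (fun y => M y i j) x) (c : Fin 4) :
    pd c (fun y => (M y).trace) x = (pdMat c M x).trace := by
  simp only [Matrix.trace, Matrix.diag_apply]
  exact pd_sum (fun i _ => hM i i) c

theorem pd_trace_mul (hM : ∀ i j, DifferentiableAt ℝ (fun y => M y i j) x)
    (hN : ∀ i j, DifferentiableAt ℝ (fun y => N y i j) x) (c : Fin 4) :
    pd c (fun y => (M y * N y).trace) x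
      = (pdMat c M x * N x).trace + (M x * pdMat c N x).trace := by
  rw [pd_trace (differentiableAt_mul_apply hM hN), pdMat_mul hM hN, Matrix.trace_add]

end MatrixField

/-! ### Trace identities and the Lagrangian density -/

section Algebra

theorem sum_last_first (f : Fin 4 → Fin 4 → Fin 4 → ℂ) :
    ∑ a, ∑ b, ∑ n, f a b n = ∑ n, ∑ a, ∑ b, f a b n := by
  symm
  rw [Finset.sum_comm]
  exact Finset.sum_congr rfl fun a _ => Finset.sum_comm

variable {P : Fin 4 → Fin 4 → CMat}

theorem sum_trace_antisymm (hP : ∀ a b, P b a = -P a b) (X : Fin 4 → Fin 4 → CMat) :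
    ∑ a, ∑ b, (P a b * (X a b - X b a)).trace = 2 * ∑ a, ∑ b, (P a b * X a b).trace := by
  have h : ∑ a, ∑ b, (P a b * X b a).trace = -∑ a, ∑ b, (P a b * X a b).trace := by
    rw [Finset.sum_comm]
    simp only [← Finset.sum_neg_distrib]
    exact Finset.sum_congr rfl fun a _ => Finset.sum_congr rfl fun b _ => by
      rw [hP a b, Matrix.neg_mul, Matrix.trace_neg]
  simp only [Matrix.mul_sub, Matrix.trace_sub, Finset.sum_sub_distrib, h]
  ring

theorem trace_commutator (A B C : CMat) :
    (A * (B * C - C * B)).trace = ((A * B - B * A) * C).trace := by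
  rw [Matrix.mul_sub, Matrix.sub_mul, Matrix.trace_sub, Matrix.trace_sub, ← Matrix.mul_assoc,
    ← Matrix.mul_assoc, Matrix.trace_mul_cycle A C B]

theorem trace_algEq_mul (α : ℂ) (G : Matrix (Fin 4) (Fin 4) ℝ) (C D : Fin 4 → Fin 4 → Fin 4 → ℂ) :
    ∑ b, (algEq α G C b * connMat D b).trace
      = ∑ a, ∑ b, (dens α G a b * (connMat C a * connMat D b - connMat D b * connMat C a)).trace := by
  simp only [trace_commutator, algEq, Finset.sum_mul, Matrix.trace_sum]
  exact Finset.sum_comm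

/-- The bilinear form ∑ tr(E(C) D) is symmetric: exchanging a and b flips the sign of P^{ab},
exchanging C and D that of the commutator. -/
theorem trace_algEq_mul_comm (α : ℂ) (G : Matrix (Fin 4) (Fin 4) ℝ)
    (C D : Fin 4 → Fin 4 → Fin 4 → ℂ) :
    ∑ b, (algEq α G C b * connMat D b).trace = ∑ b, (algEq α G D b * connMat C b).trace := by
  rw [trace_algEq_mul, trace_algEq_mul, Finset.sum_comm]
  refine Finset.sum_congr rfl fun a _ => Finset.sum_congr rfl fun b _ => ?_
  rw [dens_swap α G a b, Matrix.neg_mul, ← Matrix.mul_neg, neg_sub]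

theorem connMat_add (C D : Fin 4 → Fin 4 → Fin 4 → ℂ) (a : Fin 4) :
    connMat (C + D) a = connMat C a + connMat D a := rfl

theorem connMat_neg (C : Fin 4 → Fin 4 → Fin 4 → ℂ) (a : Fin 4) :
    connMat (-C) a = -connMat C a := rfl

theorem connMat_sub (C D : Fin 4 → Fin 4 → Fin 4 → ℂ) (a : Fin 4) :
    connMat (C - D) a = connMat C a - connMat D a := rfl

theorem algEq_neg (α : ℂ) (G : Matrix (Fin 4) (Fin 4) ℝ) (C : Fin 4 → Fin 4 → Fin 4 → ℂ)
    (b : Fin 4) : algEq α G (-C) b = -algEq α G C b := by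
  simp only [algEq, connMat_neg, ← Finset.sum_neg_distrib]
  refine Finset.sum_congr rfl fun a _ => ?_
  rw [Matrix.mul_neg, Matrix.neg_mul, neg_sub_neg, neg_sub]

end Algebra

/-- The curvature as a matrix-valued two-form. -/
def curvMat (Γ : Field3) (x : Coord) (a b : Fin 4) : CMat :=
  Matrix.of fun m n => riemann Γ x m n a b

theorem curvMat_eq (Γ : Field3) (x : Coord) (a b : Fin 4) :
    curvMat Γ x a b = pdMat a (fun y => connMat (Γ y) b) x - pdMat b (fun y => connMat (Γ y) a) x
      + (connMat (Γ x) a * connMat (Γ x) b - connMat (Γ x) b * connMat (Γ x) a) := by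
  ext m n
  simp [curvMat, riemann, pdMat, connMat, Matrix.mul_apply, Finset.sum_sub_distrib]

/-- The Lagrangian density as a contraction of `P^{ab}` with the curvature. -/
def lagDens (α : ℂ) (G : Matrix (Fin 4) (Fin 4) ℝ) (Γ : Field3) (x : Coord) : ℂ :=
  ∑ a, ∑ b, (dens α G a b * curvMat Γ x a b).trace

theorem riemann_swap (Γ : Field3) (x : Coord) (m n a b : Fin 4) :
    riemann Γ x m n b a = -riemann Γ x m n a b := by
  simp only [riemann, Finset.sum_sub_distrib]
  ring

/-- Stated for general coefficients Y and H so that it applies to P itself and to its metric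
variation. The first term reduces to the Ricci tensor by antisymmetry of the curvature in its form
indices. -/
theorem sum_trace_mul_curvMat (s α : ℂ) {Y H : Fin 4 → Fin 4 → ℂ} {W : Fin 4 → Fin 4 → CMat}
    (hW : ∀ a b n m, W a b n m = 1 / 2 * s * (kd a m * Y n b - kd b m * Y n a)
      + α * ∑ r, H m r * (symb r n a b : ℂ)) (Γ : Field3) (x : Coord) :
    ∑ a, ∑ b, (W a b * curvMat Γ x a b).trace = s * ∑ n, ∑ b, Y n b * ricci Γ x n b
      + α * ∑ r, ∑ n, ∑ a, ∑ b, ∑ m, H m r * (symb r n a b : ℂ) * riemann Γ x m n a b := by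
  have h1 : ∀ a b, (W a b * curvMat Γ x a b).trace
      = 1 / 2 * s * ((∑ n, Y n b * riemann Γ x a n a b) - ∑ n, Y n a * riemann Γ x b n a b)
        + α * ∑ n, ∑ m, ∑ r, H m r * (symb r n a b : ℂ) * riemann Γ x m n a b := by
    intro a b
    have h2 : ∀ n m, W a b n m * curvMat Γ x a b m n
        = 1 / 2 * s * (kd a m * (Y n b * riemann Γ x m n a b))
        - 1 / 2 * s * (kd b m * (Y n a * riemann Γ x m n a b))
        + α * ∑ r, H m r * (symb r n a b : ℂ) * riemann Γ x m n a b := by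
      intro n m
      rw [← Finset.sum_mul, hW]
      simp only [curvMat, Matrix.of_apply]
      ring
    simp only [Matrix.trace, Matrix.diag_apply, Matrix.mul_apply, h2, Finset.sum_add_distrib,
      Finset.sum_sub_distrib, ← Finset.mul_sum, sum_kd_left]
    ring
  have hR1 : ∑ a, ∑ b, ∑ n, Y n b * riemann Γ x a n a b = ∑ n, ∑ b, Y n b * ricci Γ x n b := by
    simp only [ricci, Finset.mul_sum]
    rw [sum_last_first]
    exact Finset.sum_congr rfl fun n _ => Finset.sum_comm
  have hR2 : ∑ a, ∑ b, ∑ n, Y n a * riemann Γ x b n a b = -∑ n, ∑ b, Y n b * ricci Γ x n b := by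
    rw [← hR1, Finset.sum_comm]
    simp only [← Finset.sum_neg_distrib]
    exact Finset.sum_congr rfl fun a _ => Finset.sum_congr rfl fun b _ =>
      Finset.sum_congr rfl fun n _ => by rw [riemann_swap Γ x a n a b]; ring
  have hH : ∑ a, ∑ b, ∑ n, ∑ m, ∑ r, H m r * (symb r n a b : ℂ) * riemann Γ x m n a b
      = ∑ r, ∑ n, ∑ a, ∑ b, ∑ m, H m r * (symb r n a b : ℂ) * riemann Γ x m n a b := by
    rw [sum_last_first]
    have h3 : ∀ n a b, ∑ m, ∑ r, H m r * (symb r n a b : ℂ) * riemann Γ x m n a b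
        = ∑ r, ∑ m, H m r * (symb r n a b : ℂ) * riemann Γ x m n a b :=
      fun n a b => Finset.sum_comm
    simp only [h3]
    have h5 : ∀ n, ∑ a, ∑ b, ∑ r, ∑ m, H m r * (symb r n a b : ℂ) * riemann Γ x m n a b
        = ∑ r, ∑ a, ∑ b, ∑ m, H m r * (symb r n a b : ℂ) * riemann Γ x m n a b :=
      fun n => sum_last_first _
    simp only [h5]
    exact Finset.sum_comm
  simp only [h1, Finset.sum_add_distrib, Finset.sum_sub_distrib, ← Finset.mul_sum, hR1, hR2, hH]
  ring

theorem sqrt_mul_lagrangian {α : ℂ} {g : MetricField} {x : Coord} (hg : (g x).det < 0)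
    (hs : (g x)ᵀ = g x) (Γ : Field3) :
    (sqrtNegDet g x : ℂ) * lagrangian α g Γ x = lagDens α (g x) Γ x := by
  have hsq : (Real.sqrt (-(g x).det) : ℂ) ≠ 0 := by
    exact_mod_cast (Real.sqrt_pos.mpr (by linarith)).ne'
  have hH : ∑ r, ∑ n, ∑ a, ∑ b, ∑ m, (g x m r : ℂ) * (symb r n a b : ℂ) * riemann Γ x m n a b
      = (Real.sqrt (-(g x).det) : ℂ) * holst g Γ x := by
    simp only [holst, epsUp, sqrtNegDet, Finset.mul_sum]
    have h4 : ∀ m r, g x m r = g x r m := fun m r => congrFun (congrFun hs r) m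
    refine Finset.sum_congr rfl fun r _ => Finset.sum_congr rfl fun n _ => Finset.sum_congr rfl
      fun a _ => Finset.sum_congr rfl fun b _ => Finset.sum_congr rfl fun m _ => ?_
    rw [h4 m r]
    push_cast
    field_simp
  rw [lagDens, sum_trace_mul_curvMat (W := dens α (g x)) (Real.sqrt (-(g x).det) : ℂ) α
    (Y := fun n b => ((g x)⁻¹ n b : ℂ)) (H := fun m r => (g x m r : ℂ)) (fun a b n m => rfl), hH,
    lagrangian, sqrtNegDet, scalarCurv]
  ring

/-- The derivative `∂_a C_b + [Γ_a, C_b]` of a matrix-valued one-form. -/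
def covDer (Γ C : Field3) (x : Coord) (a b : Fin 4) : CMat :=
  pdMat a (fun y => connMat (C y) b) x
    + (connMat (Γ x) a * connMat (C x) b - connMat (C x) b * connMat (Γ x) a)

theorem curvMat_add {Γ C : Field3} {x : Coord}
    (hΓ : ∀ l m n, DifferentiableAt ℝ (fun y => Γ y l m n) x)
    (hC : ∀ l m n, DifferentiableAt ℝ (fun y => C y l m n) x) (a b : Fin 4) :
    curvMat (Γ + C) x a b = curvMat Γ x a b + (covDer Γ C x a b - covDer Γ C x b a)
      + (connMat (C x) a * connMat (C x) b - connMat (C x) b * connMat (C x) a) := by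
  have h : ∀ a b, pdMat a (fun y => connMat ((Γ + C) y) b) x
      = pdMat a (fun y => connMat (Γ y) b) x + pdMat a (fun y => connMat (C y) b) x :=
    fun a b => pdMat_add (fun i j => hΓ i j b) (fun i j => hC i j b) a
  rw [curvMat_eq, curvMat_eq, h, h, Pi.add_apply, connMat_add, connMat_add, covDer, covDer]
  noncomm_ring

section Metric

variable {U : Set Coord} {g : MetricField} {α : ℂ} {x : Coord}

theorem pdMat_dens (hU : IsOpen U) (hg : IsLorentzMetric U g) (hx : x ∈ U) (c a b : Fin 4) :
    pdMat c (fun y => dens α (g y) a b) x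
      = densVar α (g x) (connMat (leviCivita g x) c) a b := by
  ext n m
  exact pd_dens hU hg hx α c a b n m

theorem differentiableAt_dens (hU : IsOpen U) (hg : IsLorentzMetric U g) (hx : x ∈ U)
    (a b n m : Fin 4) : DifferentiableAt ℝ (fun y => dens α (g y) a b n m) x :=
  (contDiffAt_dens_metric hU hg hx α a b n m).differentiableAt (by simp)

/-- The Levi-Civita divergence of `P^{ab}` vanishes. -/
theorem sum_pdMat_dens (hU : IsOpen U) (hg : IsLorentzMetric U g) (hx : x ∈ U) (b : Fin 4) :
    ∑ a, pdMat a (fun y => dens α (g y) a b) x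
      = algEq α (g x) (leviCivita g x) b := by
  have hL := leviCivita_symm hU hg hx
  simp only [pdMat_dens hU hg hx, algEq, densVar, Finset.sum_sub_distrib, Finset.sum_add_distrib]
  -- Symmetry of Γ̃ in its lower indices makes the trace term cancel the rotation of the contracted
  -- form index.
  have h1 : ∑ a, (connMat (leviCivita g x) a).trace • dens α (g x) a b
      = ∑ a, ∑ r, connMat (leviCivita g x) a a r • dens α (g x) r b := by
    rw [Finset.sum_comm]
    simp only [← Finset.sum_smul]
    refine Finset.sum_congr rfl fun r _ => ?_
    congr 1
    exact Finset.sum_congr rfl fun a _ => hL a a r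
  -- A contraction of the symmetric pair of Γ̃ with the antisymmetric pair of P.
  have h2 : ∑ a, ∑ r, connMat (leviCivita g x) a b r • dens α (g x) a r = 0 := by
    have h3 : ∑ a, ∑ r, connMat (leviCivita g x) a b r • dens α (g x) a r
        = -∑ a, ∑ r, connMat (leviCivita g x) a b r • dens α (g x) a r := by
      conv_lhs => rw [Finset.sum_comm]
      simp only [← Finset.sum_neg_distrib]
      refine Finset.sum_congr rfl fun a _ => Finset.sum_congr rfl fun r _ => ?_
      rw [dens_swap α (g x) a r, smul_neg]
      congr 2
      exact hL b a r
    ext i j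
    have h4 := congrFun (congrFun h3 i) j
    rw [Matrix.neg_apply] at h4
    rw [Matrix.zero_apply]
    linear_combination h4 / 2
  rw [h1, h2]
  abel

/-- The change of the Lagrangian density under a change of the connection: a divergence, the
connection equation and a quadratic term. -/
theorem lagDens_add (hU : IsOpen U) (hg : IsLorentzMetric U g) (hx : x ∈ U) {Γ C : Field3}
    (hΓ : ∀ l m n, DifferentiableAt ℝ (fun y => Γ y l m n) x)
    (hC : ∀ l m n, DifferentiableAt ℝ (fun y => C y l m n) x) :
    lagDens α (g x) (Γ + C) x = lagDens α (g x) Γ x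
      + 2 * (∑ a, pd a (fun y => ∑ b, (dens α (g y) a b * connMat (C y) b).trace) x
        + ∑ b, (algEq α (g x) (Γ x - leviCivita g x) b * connMat (C x) b).trace)
      + ∑ b, (algEq α (g x) (C x) b * connMat (C x) b).trace := by
  have hPd := differentiableAt_dens (α := α) hU hg hx
  have hCd : ∀ b i j, DifferentiableAt ℝ (fun y => connMat (C y) b i j) x := fun b i j => hC i j b
  have h1 : ∀ a, pd a (fun y => ∑ b, (dens α (g y) a b * connMat (C y) b).trace) x
      = ∑ b, ((pdMat a (fun y => dens α (g y) a b) x * connMat (C x) b).trace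
        + (dens α (g x) a b * pdMat a (fun y => connMat (C y) b) x).trace) := by
    intro a
    rw [pd_sum fun b _ => ?_]
    · exact Finset.sum_congr rfl fun b _ => pd_trace_mul (hPd a b) (hCd b) a
    · simp only [Matrix.trace, Matrix.diag_apply]
      exact DifferentiableAt.fun_sum fun i _ => differentiableAt_mul_apply (hPd a b) (hCd b) i i
  -- The Leibniz term in which P is differentiated contributes E(Γ̃), so that Γ enters only through
  -- Γ - Γ̃.
  have h2 : ∑ a, ∑ b, (pdMat a (fun y => dens α (g y) a b) x * connMat (C x) b).trace
      = ∑ b, (algEq α (g x) (leviCivita g x) b * connMat (C x) b).trace := by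
    rw [Finset.sum_comm]
    refine Finset.sum_congr rfl fun b _ => ?_
    rw [← sum_pdMat_dens hU hg hx b, Finset.sum_mul, Matrix.trace_sum]
  have h3 : ∀ b, algEq α (g x) (Γ x - leviCivita g x) b
      = algEq α (g x) (Γ x) b - algEq α (g x) (leviCivita g x) b := by
    intro b
    simp only [algEq, connMat_sub, ← Finset.sum_sub_distrib]
    exact Finset.sum_congr rfl fun a _ => by noncomm_ring
  have h4 := sum_trace_antisymm (dens_swap α (g x)) (covDer Γ C x)
  have h5 : ∀ a b, (dens α (g x) a b * covDer Γ C x a b).trace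
      = (dens α (g x) a b * pdMat a (fun y => connMat (C y) b) x).trace
      + (dens α (g x) a b * (connMat (Γ x) a * connMat (C x) b
        - connMat (C x) b * connMat (Γ x) a)).trace := fun a b => by
    rw [covDer, Matrix.mul_add, Matrix.trace_add]
  simp only [lagDens, curvMat_add hΓ hC, Matrix.mul_add, Matrix.trace_add, Finset.sum_add_distrib,
    h4, h5, ← trace_algEq_mul, h1, h2, h3, Matrix.sub_mul, Matrix.trace_sub,
    Finset.sum_sub_distrib]
  ring

theorem IsLorentzMetric.sqrt_ne_zero (hg : IsLorentzMetric U g) (hx : x ∈ U) :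
    (sqrtNegDet g x : ℂ) ≠ 0 := by
  exact_mod_cast (Real.sqrt_pos.mpr (by linarith [hg.det_neg hx])).ne'

/-- A field that is invisible to `P^{ab}` and solves the algebraic connection equation is a
symmetry of the Lagrangian. -/
theorem lagrangian_add_eq (hU : IsOpen U) (hg : IsLorentzMetric U g) {Γ N : Field3} (hx : x ∈ U)
    (hΓ : ∀ l m n, DifferentiableAt ℝ (fun y => Γ y l m n) x)
    (hN : ∀ l m n, DifferentiableAt ℝ (fun y => N y l m n) x)
    (hE : ∀ b, algEq α (g x) (N x) b = 0)
    (hS : ∀ y ∈ U, ∀ a b k, (dens α (g y) a b * connMat (N y) k).trace = 0) :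
    lagrangian α g (Γ + N) x = lagrangian α g Γ x := by
  apply mul_left_cancel₀ (hg.sqrt_ne_zero hx)
  -- By symmetry of the bilinear form the cross term is written with E(N), which vanishes whatever Γ
  -- is.
  rw [sqrt_mul_lagrangian (hg.det_neg hx) (hg.isSymm hx),
    sqrt_mul_lagrangian (hg.det_neg hx) (hg.isSymm hx), lagDens_add hU hg hx hΓ hN,
    trace_algEq_mul_comm]
  have h1 : ∀ a, pd a (fun y => ∑ b, (dens α (g y) a b * connMat (N y) b).trace) x = 0 := by
    intro a
    rw [← pd_const (x := x) 0 a]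
    refine pd_congr ?_ a
    filter_upwards [hU.mem_nhds hx] with y hy
    simp [hS y hy]
  simp [h1, hE]

/-! ### Invariance of the metric equation under shifts -/

section Symmetry

variable {N : Field3}

theorem trace_mul_commutator (A B C : CMat) :
    ((A * B - B * A) * C).trace = (B * (C * A - A * C)).trace := by
  rw [Matrix.mul_sub, Matrix.sub_mul, Matrix.trace_sub, Matrix.trace_sub, ← Matrix.mul_assoc,
    ← Matrix.mul_assoc, Matrix.trace_mul_cycle A B C, Matrix.trace_mul_cycle C A B]

/-- The covariant derivative of tr(P^{cd} N_b) = 0. By covariant constancy of P the derivative falls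
on N alone, and the terms with rotated form indices vanish by the relation itself. -/
theorem trace_dens_covDer (hU : IsOpen U) (hg : IsLorentzMetric U g)
    (hN : ∀ x ∈ U, ∀ l m n, DifferentiableAt ℝ (fun y => N y l m n) x)
    (hS : ∀ x ∈ U, ∀ a b k, (dens α (g x) a b * connMat (N x) k).trace = 0)
    (hx : x ∈ U) (c d a b : Fin 4) :
    (dens α (g x) c d * covDer (leviCivita g) N x a b).trace = 0 := by
  have h1 : pd a (fun y => (dens α (g y) c d * connMat (N y) b).trace) x = 0 := by
    rw [← pd_const (x := x) 0 a]
    refine pd_congr ?_ a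
    filter_upwards [hU.mem_nhds hx] with y hy
    exact hS y hy c d b
  have hNd : ∀ i j, DifferentiableAt ℝ (fun y => connMat (N y) b i j) x := fun i j => hN x hx i j b
  rw [pd_trace_mul (differentiableAt_dens hU hg hx c d) hNd,
    pdMat_dens hU hg hx] at h1
  have h2 : (densVar α (g x) (connMat (leviCivita g x) a) c d * connMat (N x) b).trace
      = (dens α (g x) c d * (connMat (leviCivita g x) a * connMat (N x) b
        - connMat (N x) b * connMat (leviCivita g x) a)).trace := by
    simp only [trace_commutator, densVar, Matrix.sub_mul, Matrix.add_mul, Matrix.smul_mul,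
      Finset.sum_mul, Matrix.trace_sub, Matrix.trace_add, Matrix.trace_sum, Matrix.trace_smul,
      hS x hx, smul_zero, Finset.sum_const_zero]
    ring
  rw [covDer, Matrix.mul_add, Matrix.trace_add, ← h2, add_comm]
  exact h1

/-- The divergence of E(N) = 0. The Levi-Civita divergence of P is a commutator with Γ̃, which the
Jacobi identity reassembles into the covariant derivative of N. -/
theorem sum_commutator_covDer (hU : IsOpen U) (hg : IsLorentzMetric U g)
    (hN : ∀ x ∈ U, ∀ l m n, DifferentiableAt ℝ (fun y => N y l m n) x)
    (hE : ∀ x ∈ U, ∀ b, algEq α (g x) (N x) b = 0)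
    (hx : x ∈ U) :
    ∑ a, ∑ b, (dens α (g x) a b * covDer (leviCivita g) N x a b
      - covDer (leviCivita g) N x a b * dens α (g x) a b) = 0 := by
  have hPd := differentiableAt_dens (α := α) hU hg hx
  have hNd : ∀ b i j, DifferentiableAt ℝ (fun y => connMat (N y) b i j) x :=
    fun b i j => hN x hx i j b
  have h1 : ∀ a, ∑ b, ((pdMat a (fun y => dens α (g y) b a) x * connMat (N x) b
        + dens α (g x) b a * pdMat a (fun y => connMat (N y) b) x)
      - (pdMat a (fun y => connMat (N y) b) x * dens α (g x) b a
        + connMat (N x) b * pdMat a (fun y => dens α (g y) b a) x)) = 0 := by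
    intro a
    ext i j
    have h2 : pd a (fun y => algEq α (g y) (N y) a i j) x = 0 := by
      rw [← pd_const (x := x) 0 a]
      refine pd_congr ?_ a
      filter_upwards [hU.mem_nhds hx] with y hy
      rw [hE y hy]; rfl
    have hd1 := fun b => differentiableAt_mul_apply (hPd b a) (hNd b) i j
    have hd2 := fun b => differentiableAt_mul_apply (hNd b) (hPd b a) i j
    have h3 : ∀ b, pd a (fun y => (dens α (g y) b a * connMat (N y) b
        - connMat (N y) b * dens α (g y) b a) i j) x
        = ((pdMat a (fun y => dens α (g y) b a) x * connMat (N x) b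
        + dens α (g x) b a * pdMat a (fun y => connMat (N y) b) x)
      - (pdMat a (fun y => connMat (N y) b) x * dens α (g x) b a
        + connMat (N x) b * pdMat a (fun y => dens α (g y) b a) x)) i j := by
      intro b
      rw [← pdMat_mul (hPd b a) (hNd b), ← pdMat_mul (hNd b) (hPd b a)]
      simp only [Matrix.sub_apply, pdMat, Matrix.of_apply]
      simp only [pd, fderiv_fun_sub (hd1 b) (hd2 b), _root_.sub_apply]
    simp only [algEq, Matrix.sum_apply] at h2
    rw [pd_sum fun b _ => ?_] at h2
    · rw [Matrix.sum_apply, Matrix.zero_apply, ← h2]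
      exact Finset.sum_congr rfl fun b _ => (h3 b).symm
    · exact (hd1 b).fun_sub (hd2 b)
  have h4 : ∀ b, ∑ a, pdMat a (fun y => dens α (g y) b a) x
      = ∑ a, (dens α (g x) b a * connMat (leviCivita g x) a
        - connMat (leviCivita g x) a * dens α (g x) b a) := by
    intro b
    have h5 := sum_pdMat_dens (α := α) hU hg hx b
    have h6 : ∀ a, pdMat a (fun y => dens α (g y) b a) x
        = -pdMat a (fun y => dens α (g y) a b) x := by
      intro a
      ext i j
      have : (fun y => dens α (g y) b a i j) = fun y => -dens α (g y) a b i j := by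
        funext y; rw [dens_swap α (g y) a b]; rfl
      simp only [pdMat, Matrix.of_apply, Matrix.neg_apply, this]
      simp only [pd, fderiv_fun_neg, _root_.neg_apply]
    simp only [h6, Finset.sum_neg_distrib, h5, algEq]
    rw [← Finset.sum_neg_distrib]
    exact Finset.sum_congr rfl fun a _ => by rw [dens_swap α (g x) a b]; noncomm_ring
  have h7 : ∑ a, ∑ b, (pdMat a (fun y => dens α (g y) b a) x * connMat (N x) b
      - connMat (N x) b * pdMat a (fun y => dens α (g y) b a) x)
      = ∑ a, ∑ b, ((dens α (g x) b a * connMat (leviCivita g x) a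
        - connMat (leviCivita g x) a * dens α (g x) b a) * connMat (N x) b
      - connMat (N x) b * (dens α (g x) b a * connMat (leviCivita g x) a
        - connMat (leviCivita g x) a * dens α (g x) b a)) := by
    rw [Finset.sum_comm]
    conv_rhs => rw [Finset.sum_comm]
    refine Finset.sum_congr rfl fun b _ => ?_
    rw [Finset.sum_sub_distrib, Finset.sum_sub_distrib, ← Finset.sum_mul, ← Finset.mul_sum, h4,
      Finset.sum_mul, Finset.mul_sum]
  have h8 : ∀ a, ∑ b, (connMat (leviCivita g x) a * (dens α (g x) b a * connMat (N x) b
      - connMat (N x) b * dens α (g x) b a) - (dens α (g x) b a * connMat (N x) b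
      - connMat (N x) b * dens α (g x) b a) * connMat (leviCivita g x) a) = 0 := by
    intro a
    rw [Finset.sum_sub_distrib, ← Finset.sum_mul, ← Finset.mul_sum]
    have := hE x hx a
    rw [algEq] at this
    rw [this]; simp
  have h9 : ∑ a, ∑ b, ((pdMat a (fun y => dens α (g y) b a) x * connMat (N x) b
        + dens α (g x) b a * pdMat a (fun y => connMat (N y) b) x)
      - (pdMat a (fun y => connMat (N y) b) x * dens α (g x) b a
        + connMat (N x) b * pdMat a (fun y => dens α (g y) b a) x)) = 0 :=
    Finset.sum_eq_zero fun a _ => h1 a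
  have h10 : ∑ a, ∑ b, (connMat (leviCivita g x) a * (dens α (g x) b a * connMat (N x) b
      - connMat (N x) b * dens α (g x) b a) - (dens α (g x) b a * connMat (N x) b
      - connMat (N x) b * dens α (g x) b a) * connMat (leviCivita g x) a) = 0 :=
    Finset.sum_eq_zero fun a _ => h8 a
  rw [← sub_eq_zero] at h7
  rw [← neg_eq_zero]
  refine Eq.trans ?_ (show (0 : CMat) - 0 + 0 = 0 by simp)
  -- Differentiated equation, minus the formula for the divergence of P, plus the commutator of Γ̃_a
  -- with E^a(N): term by term this is the Jacobi identity for P, Γ̃ and N.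
  refine Eq.trans ?_ (congrArg₂ (· + ·) (congrArg₂ (· - ·) h9 h7) h10)
  simp only [← Finset.sum_neg_distrib, ← Finset.sum_sub_distrib, ← Finset.sum_add_distrib]
  refine Finset.sum_congr rfl fun a _ => Finset.sum_congr rfl fun b _ => ?_
  rw [dens_swap α (g x) b a, covDer]
  noncomm_ring

/-- The metric variation of the Lagrangian density does not see such a field. -/
theorem sum_densVar_curvMat_add (hU : IsOpen U) (hg : IsLorentzMetric U g)
    (hN : ∀ x ∈ U, ∀ l m n, DifferentiableAt ℝ (fun y => N y l m n) x)
    (hE : ∀ x ∈ U, ∀ b, algEq α (g x) (N x) b = 0)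
    (hS : ∀ x ∈ U, ∀ a b k, (dens α (g x) a b * connMat (N x) k).trace = 0)
    (hx : x ∈ U)
    (hL : ∀ l m n, DifferentiableAt ℝ (fun y => leviCivita g y l m n) x) (A : CMat) :
    ∑ a, ∑ b, (densVar α (g x) A a b * curvMat (leviCivita g + N) x a b).trace
      = ∑ a, ∑ b, (densVar α (g x) A a b * curvMat (leviCivita g) x a b).trace := by
  have hsw : ∀ a b, densVar α (g x) A b a = -densVar α (g x) A a b := by
    intro a b
    simp only [densVar, dens_swap α (g x) a b]
    have h1 : ∀ r, dens α (g x) r a = -dens α (g x) a r := fun r => dens_swap α (g x) a r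
    have h2 : ∀ r, dens α (g x) b r = -dens α (g x) r b := fun r => dens_swap α (g x) r b
    simp only [h1, h2, smul_neg, Finset.sum_neg_distrib, Matrix.mul_neg, Matrix.neg_mul]
    abel
  have hE' : ∀ a, ∑ b, (dens α (g x) a b * connMat (N x) b
      - connMat (N x) b * dens α (g x) a b) = 0 := by
    intro a
    have h := hE x hx a
    rw [algEq] at h
    rw [← neg_eq_zero, ← h, ← Finset.sum_neg_distrib]
    exact Finset.sum_congr rfl fun b _ => by rw [dens_swap α (g x) a b]; noncomm_ring
  -- Moving the commutator onto P^{rb} exposes the connection equation for N.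
  have hquad : ∀ a r, ∑ b, (dens α (g x) r b * (connMat (N x) a * connMat (N x) b
      - connMat (N x) b * connMat (N x) a)).trace = 0 := by
    intro a r
    have h1 : ∀ b, (dens α (g x) r b * (connMat (N x) a * connMat (N x) b
      - connMat (N x) b * connMat (N x) a)).trace = -((dens α (g x) r b * connMat (N x) b
      - connMat (N x) b * dens α (g x) r b) * connMat (N x) a).trace := fun b => by
      rw [← trace_commutator, ← Matrix.trace_neg, ← Matrix.mul_neg, neg_sub]
    simp only [h1, Finset.sum_neg_distrib, ← Matrix.trace_sum, ← Finset.sum_mul, hE' r]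
    simp
  have hX := trace_dens_covDer hU hg hN hS hx
  -- `trace_dens_covDer` kills every term with an untwisted P. The commutator of A with P survives
  -- and, by cyclicity of the trace, becomes A paired with the sum in `sum_commutator_covDer`.
  have h1 : ∑ a, ∑ b, (densVar α (g x) A a b * covDer (leviCivita g) N x a b).trace = 0 := by
    have h2 : ∀ a b, (densVar α (g x) A a b * covDer (leviCivita g) N x a b).trace
        = -(A * (dens α (g x) a b * covDer (leviCivita g) N x a b
          - covDer (leviCivita g) N x a b * dens α (g x) a b)).trace := by
      intro a b
      rw [← Matrix.trace_neg, ← Matrix.mul_neg, neg_sub, ← trace_mul_commutator]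
      simp only [densVar, Matrix.sub_mul, Matrix.add_mul, Matrix.smul_mul,
        Finset.sum_mul, Matrix.trace_sub, Matrix.trace_add, Matrix.trace_sum, Matrix.trace_smul,
        hX, smul_zero, Finset.sum_const_zero]
      ring
    simp only [h2, Finset.sum_neg_distrib, ← Matrix.trace_sum, ← Finset.mul_sum,
      sum_commutator_covDer hU hg hN hE hx]
    simp
  have h2 : ∑ a, ∑ b, (densVar α (g x) A a b * (connMat (N x) a * connMat (N x) b
      - connMat (N x) b * connMat (N x) a)).trace = 0 := by
    have h3 : ∑ a, ∑ b, (A * (dens α (g x) a b * (connMat (N x) a * connMat (N x) b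
        - connMat (N x) b * connMat (N x) a) - (connMat (N x) a * connMat (N x) b
        - connMat (N x) b * connMat (N x) a) * dens α (g x) a b)).trace = 0 := by
      -- The Jacobi identity for P^{ab}, N_a and N_b; summed over a or over b, each half contains
      -- E(N).
      have h4 : ∀ a b, dens α (g x) a b * (connMat (N x) a * connMat (N x) b
          - connMat (N x) b * connMat (N x) a) - (connMat (N x) a * connMat (N x) b
          - connMat (N x) b * connMat (N x) a) * dens α (g x) a b
          = ((dens α (g x) a b * connMat (N x) a - connMat (N x) a * dens α (g x) a b)
              * connMat (N x) b
            - connMat (N x) b * (dens α (g x) a b * connMat (N x) a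
              - connMat (N x) a * dens α (g x) a b))
          + (connMat (N x) a * (dens α (g x) a b * connMat (N x) b
              - connMat (N x) b * dens α (g x) a b)
            - (dens α (g x) a b * connMat (N x) b - connMat (N x) b * dens α (g x) a b)
              * connMat (N x) a) := fun a b => by noncomm_ring
      simp only [← Matrix.trace_sum, ← Finset.mul_sum, h4, Finset.sum_add_distrib]
      have h5 : ∀ a, ∑ b, (connMat (N x) a * (dens α (g x) a b * connMat (N x) b
              - connMat (N x) b * dens α (g x) a b)
            - (dens α (g x) a b * connMat (N x) b - connMat (N x) b * dens α (g x) a b)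
              * connMat (N x) a) = 0 := fun a => by
        rw [Finset.sum_sub_distrib, ← Finset.mul_sum, ← Finset.sum_mul, hE' a]; simp
      have h6 : ∀ b, ∑ a, ((dens α (g x) a b * connMat (N x) a
              - connMat (N x) a * dens α (g x) a b) * connMat (N x) b
            - connMat (N x) b * (dens α (g x) a b * connMat (N x) a
              - connMat (N x) a * dens α (g x) a b)) = 0 := fun b => by
        have h := hE x hx b
        rw [algEq] at h
        rw [Finset.sum_sub_distrib, ← Finset.mul_sum, ← Finset.sum_mul, h]; simp
      rw [Finset.sum_comm]
      simp [h5, h6]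
    have h7 : ∀ a b, (densVar α (g x) A a b * (connMat (N x) a * connMat (N x) b
        - connMat (N x) b * connMat (N x) a)).trace
        = A.trace * (dens α (g x) a b * (connMat (N x) a * connMat (N x) b
          - connMat (N x) b * connMat (N x) a)).trace
        - (A * (dens α (g x) a b * (connMat (N x) a * connMat (N x) b
        - connMat (N x) b * connMat (N x) a) - (connMat (N x) a * connMat (N x) b
        - connMat (N x) b * connMat (N x) a) * dens α (g x) a b)).trace
        - ∑ r, A a r * (dens α (g x) r b * (connMat (N x) a * connMat (N x) b
          - connMat (N x) b * connMat (N x) a)).trace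
        - ∑ r, A b r * (dens α (g x) r a * (connMat (N x) b * connMat (N x) a
          - connMat (N x) a * connMat (N x) b)).trace := by
      intro a b
      obtain ⟨Y, hY⟩ : ∃ Y, Y = connMat (N x) a * connMat (N x) b
        - connMat (N x) b * connMat (N x) a := ⟨_, rfl⟩
      have hY' : connMat (N x) b * connMat (N x) a - connMat (N x) a * connMat (N x) b = -Y := by
        rw [hY, neg_sub]
      have h8 : ∀ r, dens α (g x) r a = -dens α (g x) a r := fun r => dens_swap α (g x) a r
      rw [← hY, hY']
      simp only [h8, neg_mul_neg, densVar, Matrix.sub_mul, Matrix.add_mul, Matrix.smul_mul,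
        Finset.sum_mul, Matrix.trace_sub, Matrix.trace_add, Matrix.trace_sum, Matrix.trace_smul,
        smul_eq_mul, Matrix.mul_sub, ← Matrix.mul_assoc]
      rw [Matrix.trace_mul_cycle (dens α (g x) a b) A Y,
        Matrix.trace_mul_cycle Y (dens α (g x) a b) A]
      ring
    have h8 : ∑ a, ∑ b, ∑ r, A a r * (dens α (g x) r b * (connMat (N x) a * connMat (N x) b
        - connMat (N x) b * connMat (N x) a)).trace = 0 := by
      refine Finset.sum_eq_zero fun a _ => ?_
      rw [Finset.sum_comm]
      simp only [← Finset.mul_sum, hquad, mul_zero, Finset.sum_const_zero]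
    have h9 : ∑ a, ∑ b, ∑ r, A b r * (dens α (g x) r a * (connMat (N x) b * connMat (N x) a
        - connMat (N x) a * connMat (N x) b)).trace = 0 := by
      rw [Finset.sum_comm, ← h8]
    simp only [h7, Finset.sum_sub_distrib, h8, h9, h3, ← Finset.mul_sum, hquad,
      Finset.sum_const_zero, mul_zero, sub_zero]
  simp only [curvMat_add hL (hN x hx), Matrix.mul_add, Matrix.trace_add, Finset.sum_add_distrib,
    sum_trace_antisymm hsw (covDer (leviCivita g) N x), h1, h2]
  ring

end Symmetry
end Metric

/-! ### The metric equation at the Levi-Civita connection -/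

section Metric

variable {U : Set Coord} {g : MetricField} {x : Coord}

theorem riemann_cyclic {Γ : Field3}
    (hΓ : ∀ᶠ y in 𝓝 x, ∀ l m n, Γ y l m n = Γ y l n m) (m n a b : Fin 4) :
    riemann Γ x m n a b + riemann Γ x m a b n + riemann Γ x m b n a = 0 := by
  have h1 : ∀ c m n k, pd c (fun y => Γ y m n k) x = pd c (fun y => Γ y m k n) x :=
    fun c m n k => pd_congr (by filter_upwards [hΓ] with y hy using hy m n k) c
  have h2 := hΓ.self_of_nhds
  simp only [riemann, Finset.sum_sub_distrib, h1 a m n b, h1 b m n a, h1 n m a b]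
  have h4 : ∀ p q r, ∑ k, Γ x m k p * Γ x k q r = ∑ k, Γ x m k p * Γ x k r q := fun p q r =>
    Finset.sum_congr rfl fun k _ => by rw [h2 k q r]
  rw [h4 a n b, h4 b a n, h4 n b a]
  ring

/-- The symbol is invariant under cycling its last three indices, so the first Bianchi identity
becomes three times this contraction. It removes the Holst term for torsion-free connections. -/
theorem sum_symb_riemann {Γ : Field3}
    (hΓ : ∀ᶠ y in 𝓝 x, ∀ l m n, Γ y l m n = Γ y l n m) (m r : Fin 4) :
    ∑ n, ∑ a, ∑ b, (symb r n a b : ℂ) * riemann Γ x m n a b = 0 := by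
  have hs : ∀ r n a b : Fin 4, symb r a b n = symb r n a b := by decide
  have h1 : ∑ n, ∑ a, ∑ b, (symb r n a b : ℂ) * riemann Γ x m a b n
      = ∑ n, ∑ a, ∑ b, (symb r n a b : ℂ) * riemann Γ x m n a b := by
    rw [← sum_last_first]
    exact Finset.sum_congr rfl fun n _ => Finset.sum_congr rfl fun a _ =>
      Finset.sum_congr rfl fun b _ => by rw [hs r b n a]
  have h2 : ∑ n, ∑ a, ∑ b, (symb r n a b : ℂ) * riemann Γ x m b n a
      = ∑ n, ∑ a, ∑ b, (symb r n a b : ℂ) * riemann Γ x m n a b := by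
    rw [sum_last_first]
    exact Finset.sum_congr rfl fun n _ => Finset.sum_congr rfl fun a _ =>
      Finset.sum_congr rfl fun b _ => by rw [hs r n a b]
  have h3 : ∑ n, ∑ a, ∑ b, (symb r n a b : ℂ) *
      (riemann Γ x m n a b + riemann Γ x m a b n + riemann Γ x m b n a) = 0 := by
    simp only [riemann_cyclic hΓ, mul_zero, Finset.sum_const_zero]
  simp only [mul_add, Finset.sum_add_distrib, h1, h2] at h3
  linear_combination h3 / 3

theorem pd_log_det (hU : IsOpen U) (hg : IsLorentzMetric U g) (hx : x ∈ U) (m : Fin 4) :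
    pd m (fun y => Real.log (-(g y).det)) x = 2 * (lcMat g x m).trace := by
  have hneg := hg.det_neg hx
  have hu : IsUnit (g x).det := isUnit_iff_ne_zero.mpr hneg.ne
  have hd : DifferentiableAt ℝ (fun y => Real.log (-(g y).det)) x :=
    ((contDiffAt_det (hg.contDiffAt hU hx)).differentiableAt (by simp)).neg.log
      (neg_ne_zero.mpr hneg.ne)
  have h1 := hasDerivAt_line hd m
  have h2 := hasDerivAt_det (M := fun t : ℝ => g (x + t • Pi.single m 1))
    (M' := g x * lcMat g x m + (lcMat g x m)ᵀ * g x) (t := 0)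
    (fun i j => by simpa using hasDerivAt_metric_line hU hg hx m i j) (by simpa using hneg.ne)
  have h3 : HasDerivAt (fun t : ℝ => -(g (x + t • Pi.single m 1)).det) _ 0 := h2.neg
  have h4 := h3.log (by simpa using hneg.ne)
  rw [h1.unique h4]
  simp only [zero_smul, add_zero]
  rw [neg_div_neg_eq, mul_div_cancel_left₀ _ hneg.ne, Matrix.mul_add, Matrix.trace_add,
    ← Matrix.mul_assoc, Matrix.nonsing_inv_mul _ hu,
    Matrix.one_mul, Matrix.trace_mul_comm, Matrix.mul_assoc, Matrix.mul_nonsing_inv _ hu,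
    Matrix.mul_one, Matrix.trace_transpose]
  ring

theorem pd_pd_comm {f : Coord → ℝ} (hf : ContDiffAt ℝ ∞ f x) (m n : Fin 4) :
    pd n (pd m f) x = pd m (pd n f) x := by
  have h1 : ∀ m n, pd n (pd m f) x
      = fderiv ℝ (fderiv ℝ f) x (Pi.single n 1) (Pi.single m 1) := by
    intro m n
    have hd : DifferentiableAt ℝ (fderiv ℝ f) x :=
      (hf.fderiv_right (m := ∞) (by simp)).differentiableAt (by simp)
    have h2 : pd m f = fun y => fderiv ℝ f y (Pi.single m 1) := rfl
    rw [h2, pd, fderiv_clm_apply hd (differentiableAt_const _)]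
    simp
  rw [h1, h1]
  refine (hf.isSymmSndFDerivAt ?_) _ _
  rw [minSmoothness_of_isRCLikeNormedField]
  exact WithTop.coe_le_coe.mpr le_top

theorem pd_ofReal {f : Coord → ℝ} (hf : DifferentiableAt ℝ f x) (m : Fin 4) :
    pd m (fun y => (f y : ℂ)) x = ((pd m f x : ℝ) : ℂ) := by
  have h := (Complex.ofRealCLM.hasFDerivAt (x := f x)).comp x hf.hasFDerivAt
  have h2 : HasFDerivAt (fun y => (f y : ℂ)) _ x := h
  rw [pd, h2.fderiv]
  rfl

/-- The only term not visibly symmetric is ∂_n Γ̃^r_{mr}. By `pd_log_det` it is half the Hessian of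
log(-det g). -/
theorem ricci_leviCivita_symm (hU : IsOpen U) (hg : IsLorentzMetric U g) (hx : x ∈ U)
    (m n : Fin 4) : ricci (leviCivita g) x m n = ricci (leviCivita g) x n m := by
  have hL := leviCivita_symm hU hg hx
  have hd : ∀ l m n, DifferentiableAt ℝ (fun y => leviCivita g y l m n) x := fun l m n =>
    (contDiffAt_leviCivita hU hg hx l m n).differentiableAt (by simp)
  have hlog : ContDiffAt ℝ ∞ (fun y => Real.log (-(g y).det)) x :=
    (contDiffAt_det (hg.contDiffAt hU hx)).neg.log (neg_ne_zero.mpr (hg.det_neg hx).ne)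
  have h1 : ∀ m n, ∑ r, pd n (fun y => leviCivita g y r m r) x
      = ((1 / 2 * pd n (pd m (fun y => Real.log (-(g y).det))) x : ℝ) : ℂ) := by
    intro m n
    have hp : DifferentiableAt ℝ (pd m (fun y => Real.log (-(g y).det))) x :=
      (ContDiffAt.pd hlog m).differentiableAt (by simp)
    have hpc : DifferentiableAt ℝ
        (fun y => ((pd m (fun z => Real.log (-(g z).det)) y : ℝ) : ℂ)) x :=
      Complex.ofRealCLM.differentiableAt.comp x hp
    rw [← pd_sum fun r _ => hd r m r, Complex.ofReal_mul, ← pd_ofReal hp,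
      ← zero_add (_ * _), ← zero_mul ((pd m (fun y => Real.log (-(g y).det)) x : ℝ) : ℂ),
      ← pd_const (x := x) ((1 / 2 : ℝ) : ℂ) n, ← pd_mul (differentiableAt_const _) hpc]
    refine pd_congr ?_ n
    filter_upwards [hU.mem_nhds hx] with y hy
    rw [pd_log_det hU hg hy]
    have h2 : ∀ r, leviCivita g y r m r = ((lcMat g y m r r : ℝ) : ℂ) := fun r => by
      rw [leviCivita_symm hU hg hy]; rfl
    simp only [h2, Matrix.trace, Matrix.diag_apply]
    push_cast
    ring
  have h3 : ∀ m n r, pd r (fun y => leviCivita g y r m n) x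
      = pd r (fun y => leviCivita g y r n m) x := fun m n r =>
    pd_congr (by filter_upwards [hU.mem_nhds hx] with y hy using leviCivita_symm hU hg hy r m n) r
  have h4 : ∀ m n, ∑ r, ∑ s, leviCivita g x r s n * leviCivita g x s m r
      = ∑ r, ∑ s, leviCivita g x r s m * leviCivita g x s n r := by
    intro m n
    rw [Finset.sum_comm]
    exact Finset.sum_congr rfl fun r _ => Finset.sum_congr rfl fun s _ => by
      rw [hL r m s, hL s r n]; ring
  have h5 : ∀ m n, ∑ r, ∑ s, leviCivita g x r s r * leviCivita g x s m n
      = ∑ r, ∑ s, leviCivita g x r s r * leviCivita g x s n m := fun m n =>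
    Finset.sum_congr rfl fun r _ => Finset.sum_congr rfl fun s _ => by rw [hL s m n]
  simp only [ricci, riemann, Finset.sum_add_distrib, Finset.sum_sub_distrib, h1, h4 m n, h5 m n,
    pd_pd_comm hlog m n, h3 m n]

/-- The metric equation at the Levi-Civita connection. -/
theorem sum_densVar_curvMat_leviCivita (hU : IsOpen U) (hg : IsLorentzMetric U g) (hx : x ∈ U)
    (α : ℂ) {H : Matrix (Fin 4) (Fin 4) ℝ} (hH : Hᵀ = H) :
    ∑ a, ∑ b, (densVar α (g x) (((1 / 2 : ℝ) • ((g x)⁻¹ * H)).map (fun r : ℝ => (r : ℂ))) a b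
      * curvMat (leviCivita g) x a b).trace
      = (Real.sqrt (-(g x).det) : ℂ) * ∑ n, ∑ b, ((1 / 2 * ((g x)⁻¹ * H).trace * (g x)⁻¹ n b
        - ((g x)⁻¹ * H * (g x)⁻¹) n b : ℝ) : ℂ) * ricci (leviCivita g) x n b := by
  have hu : IsUnit (g x).det := isUnit_iff_ne_zero.mpr (hg.det_neg hx).ne
  have hX : (g x)⁻¹ᵀ = (g x)⁻¹ := by rw [Matrix.transpose_nonsing_inv, hg.isSymm hx]
  obtain ⟨B, hB⟩ : ∃ B : Matrix (Fin 4) (Fin 4) ℝ, B = (1 / 2 : ℝ) • ((g x)⁻¹ * H) := ⟨_, rfl⟩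
  have hBt : Bᵀ = (1 / 2 : ℝ) • (H * (g x)⁻¹) := by
    rw [hB, Matrix.transpose_smul, Matrix.transpose_mul, hH, hX]
  have h1 : B * (g x)⁻¹ + (g x)⁻¹ * Bᵀ = (g x)⁻¹ * H * (g x)⁻¹ := by
    rw [hBt, hB, Matrix.smul_mul, Matrix.mul_smul, ← Matrix.mul_assoc, ← add_smul]
    norm_num
  have h2 : g x * B + Bᵀ * g x = H := by
    rw [hBt, hB, Matrix.mul_smul, Matrix.smul_mul, ← Matrix.mul_assoc, Matrix.mul_assoc H,
      Matrix.mul_nonsing_inv _ hu, Matrix.nonsing_inv_mul _ hu, Matrix.one_mul, Matrix.mul_one,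
      ← add_smul]
    norm_num
  have h3 : (B.map (fun r : ℝ => (r : ℂ))).trace = ((1 / 2 * ((g x)⁻¹ * H).trace : ℝ) : ℂ) := by
    rw [← smul_eq_mul, ← Matrix.trace_smul, ← hB]
    simp [Matrix.trace]
  rw [← hB, sum_trace_mul_curvMat
    (W := densVar α (g x) (B.map (fun r : ℝ => (r : ℂ)))) (Real.sqrt (-(g x).det) : ℂ) α
    (Y := fun n b => ((1 / 2 * ((g x)⁻¹ * H).trace * (g x)⁻¹ n b
        - ((g x)⁻¹ * H * (g x)⁻¹) n b : ℝ) : ℂ)) (H := fun m r => (H m r : ℂ))]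
  · have h4 : ∀ r, ∑ n, ∑ a, ∑ b, ∑ m, (H m r : ℂ) * (symb r n a b : ℂ)
        * riemann (leviCivita g) x m n a b = 0 := by
      intro r
      have h5 : ∀ n, ∑ a, ∑ b, ∑ m, (H m r : ℂ) * (symb r n a b : ℂ)
          * riemann (leviCivita g) x m n a b = ∑ m, ∑ a, ∑ b, (H m r : ℂ) * (symb r n a b : ℂ)
          * riemann (leviCivita g) x m n a b := fun n => sum_last_first _
      simp only [h5]
      rw [Finset.sum_comm]
      refine Finset.sum_eq_zero fun m _ => ?_
      simp only [mul_assoc, ← Finset.mul_sum]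
      rw [sum_symb_riemann, mul_zero]
      filter_upwards [hU.mem_nhds hx] with y hy l m n using leviCivita_symm hU hg hy l m n
    simp only [h4, Finset.sum_const_zero, mul_zero, add_zero]
  · intro a b n m
    have h6 : ∀ n b, ∑ k, (B.map (fun r : ℝ => (r : ℂ)) n k * ((g x)⁻¹ k b : ℝ)
        + ((g x)⁻¹ n k : ℝ) * B.map (fun r : ℝ => (r : ℂ)) b k)
        = (((g x)⁻¹ * H * (g x)⁻¹) n b : ℝ) := by
      intro n b
      rw [← h1]
      simp [Matrix.mul_apply, Finset.sum_add_distrib]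
    have h7 : ∀ r, ∑ k, ((g x m k : ℂ) * B.map (fun r : ℝ => (r : ℂ)) k r
        + B.map (fun r : ℝ => (r : ℂ)) k m * (g x k r : ℂ)) = (H m r : ℂ) := by
      intro r
      conv_rhs => rw [← h2]
      simp [Matrix.mul_apply, Finset.sum_add_distrib]
    rw [densVar_apply, h3, h6, h6]
    simp only [h7]
    push_cast
    ring

/-- With X = g⁻¹ and S the Ricci matrix, the equation for all H reads tr(XS) X / 2 = XSX, the
vanishing of the Einstein tensor. -/
theorem metricEq_leviCivita_iff (hU : IsOpen U) (hg : IsLorentzMetric U g) (hx : x ∈ U) (α : ℂ) :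
    (∀ H : Matrix (Fin 4) (Fin 4) ℝ, Hᵀ = H →
      ∑ a, ∑ b, (densVar α (g x) (((1 / 2 : ℝ) • ((g x)⁻¹ * H)).map (fun r : ℝ => (r : ℂ))) a b
        * curvMat (leviCivita g) x a b).trace = 0)
      ↔ ∀ m n, ricci (leviCivita g) x m n = 0 := by
  constructor
  · intro h
    have hne := hg.sqrt_ne_zero hx
    have hu : IsUnit (g x).det := isUnit_iff_ne_zero.mpr (hg.det_neg hx).ne
    have hXs : (g x)⁻¹ᵀ = (g x)⁻¹ := by rw [Matrix.transpose_nonsing_inv, hg.isSymm hx]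
    obtain ⟨X, hX⟩ : ∃ X : CMat, X = (g x)⁻¹.map (fun r : ℝ => (r : ℂ)) := ⟨_, rfl⟩
    obtain ⟨G, hG⟩ : ∃ G : CMat, G = (g x).map (fun r : ℝ => (r : ℂ)) := ⟨_, rfl⟩
    obtain ⟨S, hS⟩ : ∃ S : CMat, S = Matrix.of (ricci (leviCivita g) x) := ⟨_, rfl⟩
    have hXt : Xᵀ = X := by rw [hX, ← Matrix.transpose_map, hXs]
    have hSt : Sᵀ = S := by
      ext m n; rw [hS]; exact ricci_leviCivita_symm hU hg hx n m
    have hXG : X * G = 1 := by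
      have h1 := congrArg (fun M : Matrix (Fin 4) (Fin 4) ℝ => M.map Complex.ofRealHom)
        (Matrix.nonsing_inv_mul _ hu)
      rw [hX, hG]
      simp only [Matrix.map_mul] at h1
      rw [Matrix.map_one _ (map_zero _) (map_one _)] at h1
      exact h1
    have hGX : G * X = 1 := mul_eq_one_comm.mp hXG
    have hK : ∀ p q, 1 / 2 * (X * S).trace * X p q - (X * S * X) p q = 0 := by
      intro p q
      -- Only symmetric directions are available; symmetrised matrix units suffice because the
      -- Einstein matrix is symmetric.
      have h1 := h (Matrix.single p q 1 + Matrix.single q p 1) (by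
        rw [Matrix.transpose_add, Matrix.transpose_single, Matrix.transpose_single, add_comm])
      rw [sum_densVar_curvMat_leviCivita hU hg hx α (by
        rw [Matrix.transpose_add, Matrix.transpose_single, Matrix.transpose_single, add_comm])] at h1
      have h2 := (mul_eq_zero.mp h1).resolve_left hne
      have h3 : ∀ H : Matrix (Fin 4) (Fin 4) ℝ, ∑ n, ∑ b, ((1 / 2 * ((g x)⁻¹ * H).trace * (g x)⁻¹ n b
          - ((g x)⁻¹ * H * (g x)⁻¹) n b : ℝ) : ℂ) * ricci (leviCivita g) x n b
          = (H.map (fun r : ℝ => (r : ℂ))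
            * ((1 / 2 * (X * S).trace) • X - X * S * X)).trace := by
        intro H
        obtain ⟨K, hK⟩ : ∃ K : CMat, K = H.map (fun r : ℝ => (r : ℂ)) := ⟨_, rfl⟩
        have h4 : (((g x)⁻¹ * H).trace : ℂ) = (X * K).trace := by
          rw [hX, hK]; simp [Matrix.trace, Matrix.mul_apply]
        have h5 : ∀ n b, ((((g x)⁻¹ * H * (g x)⁻¹) n b : ℝ) : ℂ) = (X * K * X) n b := by
          intro n b; rw [hX, hK]; simp [Matrix.mul_apply]
        have h6 : ∀ n b, (((g x)⁻¹ n b : ℝ) : ℂ) = X n b := fun n b => by rw [hX]; rfl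
        have h7 : ∀ Y : CMat, ∑ n, ∑ b, Y n b * ricci (leviCivita g) x n b = (Y * S).trace := by
          intro Y
          simp only [Matrix.trace, Matrix.diag_apply, Matrix.mul_apply]
          refine Finset.sum_congr rfl fun n _ => Finset.sum_congr rfl fun b _ => ?_
          rw [hS, Matrix.of_apply, ricci_leviCivita_symm hU hg hx b n]
        have h8 := h7 ((1 / 2 * (X * K).trace) • X - X * K * X)
        rw [← hK]
        calc _ = ∑ n, ∑ b, ((1 / 2 * (X * K).trace) • X - X * K * X) n b
              * ricci (leviCivita g) x n b := by
              refine Finset.sum_congr rfl fun n _ => Finset.sum_congr rfl fun b _ => ?_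
              rw [Matrix.sub_apply, Matrix.smul_apply, smul_eq_mul, ← h5, ← h4, ← h6]
              push_cast
              ring
          _ = _ := by
              rw [h8, Matrix.sub_mul, Matrix.smul_mul, Matrix.trace_sub, Matrix.trace_smul,
                Matrix.mul_sub, Matrix.mul_smul, Matrix.trace_sub, Matrix.trace_smul,
                Matrix.trace_mul_comm K X, smul_eq_mul, smul_eq_mul,
                show X * K * X * S = X * (K * (X * S)) by simp only [Matrix.mul_assoc],
                Matrix.trace_mul_comm X (K * (X * S)), Matrix.mul_assoc K]
              ring
      obtain ⟨Q, hQ⟩ : ∃ Q : CMat, Q = (1 / 2 * (X * S).trace) • X - X * S * X := ⟨_, rfl⟩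
      have hQt : Q q p = Q p q := by
        have : Qᵀ = Q := by
          rw [hQ, Matrix.transpose_sub, Matrix.transpose_smul, Matrix.transpose_mul,
            Matrix.transpose_mul, hXt, hSt, Matrix.mul_assoc]
        exact congrFun (congrFun this p) q
      have hmap : (Matrix.single p q (1 : ℝ) + Matrix.single q p 1).map (fun r : ℝ => (r : ℂ))
          = Matrix.single p q 1 + Matrix.single q p 1 := by
        ext i j
        simp only [Matrix.map_apply, Matrix.add_apply, Matrix.single_apply]
        split_ifs <;> simp
      rw [h3, ← hQ, hmap, Matrix.add_mul, Matrix.trace_add, Matrix.trace_single_mul,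
        Matrix.trace_single_mul, hQt] at h2
      have h9 : Q p q = 0 := by simpa using h2
      rw [hQ] at h9
      exact h9
    have hM : (1 / 2 * (X * S).trace) • X = X * S * X := by
      ext p q
      have := hK p q
      rw [Matrix.smul_apply, smul_eq_mul]
      linear_combination this
    have hXS : (1 / 2 * (X * S).trace) • (1 : CMat) = X * S := by
      calc _ = ((1 / 2 * (X * S).trace) • X) * G := by rw [Matrix.smul_mul, hXG]
        _ = X * S := by rw [hM, Matrix.mul_assoc, hXG, Matrix.mul_one]
    -- In dimension four the trace of the equation reads 2 tr(XS) = tr(XS).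
    have htr : (X * S).trace = 0 := by
      have := congrArg Matrix.trace hXS
      rw [Matrix.trace_smul, Matrix.trace_one] at this
      simp at this
      linear_combination this
    have hXS0 : X * S = 0 := by rw [← hXS, htr]; simp
    have hS0 : S = 0 := by
      rw [← Matrix.one_mul S, ← hGX, Matrix.mul_assoc, hXS0, Matrix.mul_zero]
    intro m n
    have := congrFun (congrFun hS0 m) n
    rw [hS] at this
    exact this
  · intro h H hH
    rw [sum_densVar_curvMat_leviCivita hU hg hx α hH]
    simp [h]

end Metric

/-! ### Variational calculus for the action -/

open MeasureTheory

/-- Being C¹ is an open condition, so by the tube lemma F is C¹ near a product of a closed interval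
around 0 with K. By compactness its t-derivative is bounded there, and dominated differentiation
applies. -/
theorem hasDerivAt_setIntegral_of_contDiffAt {K : Set Coord} (hK : IsCompact K)
    {F : ℝ × Coord → ℂ} (hF : ∀ x ∈ K, ContDiffAt ℝ 1 F (0, x)) :
    HasDerivAt (fun t : ℝ => ∫ x in K, F (t, x)) (∫ x in K, deriv (fun t : ℝ => F (t, x)) 0) 0 := by
  have hO : IsOpen {p | ContDiffAt ℝ 1 F p} := by
    rw [isOpen_iff_mem_nhds]
    intro p hp
    exact ContDiffAt.eventually hp (by simp)
  obtain ⟨u, v, hu, hv, h0, hKv, huv⟩ := generalized_tube_lemma (isCompact_singleton (x := (0 : ℝ)))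
    hK hO (by
      rintro ⟨t, x⟩ ⟨ht, hx⟩
      obtain rfl : t = 0 := ht
      exact hF x hx)
  obtain ⟨ε, hε, hball⟩ := Metric.nhds_basis_closedBall.mem_iff.mp
    (hu.mem_nhds (h0 (Set.mem_singleton 0)))
  have hreg : ∀ t ∈ Metric.closedBall (0 : ℝ) ε, ∀ x ∈ K, ContDiffAt ℝ 1 F (t, x) :=
    fun t ht x hx => huv ⟨hball ht, hKv hx⟩
  have hder : ∀ t ∈ Metric.closedBall (0 : ℝ) ε, ∀ x ∈ K,
      HasDerivAt (fun s : ℝ => F (s, x)) (fderiv ℝ F (t, x) (1, 0)) t := by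
    intro t ht x hx
    have h1 : HasDerivAt (fun s : ℝ => (s, x)) ((1, 0) : ℝ × Coord) t :=
      (hasDerivAt_id t).prodMk (hasDerivAt_const t x)
    exact ((hreg t ht x hx).differentiableAt (by norm_num)).hasFDerivAt.comp_hasDerivAt t h1
  have hcont : ContinuousOn (fun p => fderiv ℝ F p (1, 0)) (Metric.closedBall (0 : ℝ) ε ×ˢ K) := by
    rintro ⟨t, x⟩ ⟨ht, hx⟩
    have h1 : ContDiffAt ℝ 0 (fderiv ℝ F) (t, x) := (hreg t ht x hx).fderiv_right (by norm_num)
    exact (h1.continuousAt.clm_apply continuousAt_const).continuousWithinAt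
  obtain ⟨C, hC⟩ := ((isCompact_closedBall (0 : ℝ) ε).prod hK).exists_bound_of_continuousOn hcont
  have hFc : ∀ t ∈ Metric.closedBall (0 : ℝ) ε, ContinuousOn (fun x => F (t, x)) K := by
    intro t ht x hx
    exact ((hreg t ht x hx).continuousAt.comp (f := fun x : Coord => (t, x))
      (by fun_prop)).continuousWithinAt
  have h0mem : (0 : ℝ) ∈ Metric.closedBall (0 : ℝ) ε := Metric.mem_closedBall_self hε.le
  have hmeas := hK.measurableSet
  have key := hasDerivAt_integral_of_dominated_loc_of_deriv_le (𝕜 := ℝ) (μ := volume.restrict K)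
    (F := fun t x => F (t, x)) (F' := fun t x => fderiv ℝ F (t, x) (1, 0)) (x₀ := 0)
    (bound := fun _ => C) (Metric.closedBall_mem_nhds (0 : ℝ) hε)
    (by
      filter_upwards [Metric.closedBall_mem_nhds (0 : ℝ) hε] with t ht
      exact (hFc t ht).aestronglyMeasurable hmeas)
    ((hFc 0 h0mem).integrableOn_compact hK)
    (ContinuousOn.aestronglyMeasurable (fun x hx =>
      (hcont (0, x) ⟨h0mem, hx⟩).comp (f := fun x : Coord => ((0 : ℝ), x))
        (by fun_prop) fun y hy => ⟨h0mem, hy⟩) hmeas)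
    ((ae_restrict_iff' hmeas).mpr (ae_of_all _ fun x hx t ht => hC (t, x) ⟨ht, hx⟩))
    (by
      have : IsFiniteMeasure (volume.restrict K) := ⟨by
        rw [Measure.restrict_apply_univ]; exact hK.measure_lt_top⟩
      exact integrable_const C)
    ((ae_restrict_iff' hmeas).mpr (ae_of_all _ fun x hx t ht => hder t ht x hx))
  refine key.2.congr_deriv (setIntegral_congr_fun hmeas fun x hx => ?_)
  exact (hder 0 h0mem x hx).deriv.symm

/-- Integration by parts against the constant function 1. -/
theorem setIntegral_pd_eq_zero {K : Set Coord} (hK : IsCompact K) {w : Coord → ℂ}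
    (hw : ContDiff ℝ ∞ w) (h0 : ∀ x ∉ K, w x = 0) (a : Fin 4) : ∫ x in K, pd a w x = 0 := by
  have hs : HasCompactSupport w := HasCompactSupport.intro hK h0
  have hp : ∀ x ∉ K, pd a w x = 0 := by
    intro x hx
    rw [← pd_const (x := x) 0 a]
    refine pd_congr ?_ a
    filter_upwards [hK.isClosed.isOpen_compl.mem_nhds hx] with y hy using h0 y hy
  rw [setIntegral_eq_integral_of_forall_compl_eq_zero hp]
  have hc : Continuous (fun x => fderiv ℝ w x (Pi.single a 1)) :=
    (hw.continuous_fderiv (by simp)).clm_apply continuous_const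
  have hi : Integrable (fun x => fderiv ℝ w x (Pi.single a 1)) :=
    hc.integrable_of_hasCompactSupport (HasCompactSupport.intro hK hp)
  have h := integral_mul_fderiv_eq_neg_fderiv_mul_of_integrable (μ := (volume : Measure Coord))
    (f := fun _ => (1 : ℂ)) (g := w) (v := Pi.single a 1) (by simp) (by simpa using hi)
    (by simpa using hw.continuous.integrable_of_hasCompactSupport hs) (by simp)
    (fun x _ => (hw.differentiable (by simp)) x)
  have h' : ∫ x, fderiv ℝ w x (Pi.single a 1) = 0 := by simpa using h
  exact h'

/-- The fundamental lemma of the calculus of variations, with continuity upgrading almost everywhere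
to everywhere. Integrals run over the support of the test function, the region K used for
stationarity. -/
theorem eqOn_zero_of_integral_smul {U : Set Coord} (hU : IsOpen U) {f : Coord → ℂ}
    (hf : ContinuousOn f U)
    (h : ∀ φ : Coord → ℝ, ContDiff ℝ ∞ φ → IsCompact (tsupport φ) → tsupport φ ⊆ U →
      ∫ x in tsupport φ, φ x • f x = 0) : ∀ x ∈ U, f x = 0 := by
  have h1 := hU.ae_eq_zero_of_integral_contDiff_smul_eq_zero (μ := (volume : Measure Coord))
    (hf.locallyIntegrableOn hU.measurableSet) (fun φ h1 h2 h3 => by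
      rw [← h φ h1 h2 h3, setIntegral_eq_integral_of_forall_compl_eq_zero]
      intro x hx
      rw [image_eq_zero_of_notMem_tsupport hx, zero_smul])
  exact Measure.eqOn_open_of_ae_eq ((ae_restrict_iff' hU.measurableSet).mpr h1) hU hf
    continuousOn_const

theorem contDiffOn_field3_iff {U : Set Coord} {Γ : Field3} :
    ContDiffOn ℝ ∞ Γ U ↔ ∀ l m n, ContDiffOn ℝ ∞ (fun y => Γ y l m n) U := by
  simp only [contDiffOn_pi]

theorem ContDiffOn.component {U : Set Coord} (hU : IsOpen U) {Γ : Field3}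
    (hΓ : ContDiffOn ℝ ∞ Γ U) {x : Coord} (hx : x ∈ U) (l m n : Fin 4) :
    ContDiffAt ℝ ∞ (fun y => Γ y l m n) x :=
  (contDiffOn_field3_iff.mp hΓ l m n).contDiffAt (hU.mem_nhds hx)

section Smooth

variable {E : Type*} [NormedAddCommGroup E] [NormedSpace ℝ E] {k : WithTop ℕ∞} {x : E}
  {M N : E → CMat}

theorem contDiffAt_mul_apply (hM : ∀ i j, ContDiffAt ℝ k (fun y => M y i j) x)
    (hN : ∀ i j, ContDiffAt ℝ k (fun y => N y i j) x) (i j : Fin 4) :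
    ContDiffAt ℝ k (fun y => (M y * N y) i j) x := by
  simp only [Matrix.mul_apply]
  exact ContDiffAt.sum fun r _ => (hM i r).mul (hN r j)

theorem contDiffAt_trace_mul (hM : ∀ i j, ContDiffAt ℝ k (fun y => M y i j) x)
    (hN : ∀ i j, ContDiffAt ℝ k (fun y => N y i j) x) :
    ContDiffAt ℝ k (fun y => (M y * N y).trace) x := by
  simp only [Matrix.trace, Matrix.diag_apply]
  exact ContDiffAt.sum fun i _ => contDiffAt_mul_apply hM hN i i

end Smooth

theorem contDiffAt_curvMat {Γ : Field3} {x : Coord}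
    (hΓ : ∀ l m n, ContDiffAt ℝ ∞ (fun y => Γ y l m n) x) (a b m n : Fin 4) :
    ContDiffAt ℝ ∞ (fun y => curvMat Γ y a b m n) x := by
  simp only [curvMat, Matrix.of_apply, riemann]
  exact ((ContDiffAt.pd (hΓ m n b) a).sub (ContDiffAt.pd (hΓ m n a) b)).add
    (ContDiffAt.sum fun r _ => ((hΓ m r a).mul (hΓ r n b)).sub ((hΓ m r b).mul (hΓ r n a)))

section Connection

variable {U : Set Coord} {g : MetricField} {α : ℂ} {κ : ℝ}

theorem contDiffAt_algEq (hU : IsOpen U) (hg : IsLorentzMetric U g) {C : Field3} {x : Coord}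
    (hx : x ∈ U) (hC : ∀ l m n, ContDiffAt ℝ ∞ (fun y => C y l m n) x) (b i j : Fin 4) :
    ContDiffAt ℝ ∞ (fun y => algEq α (g y) (C y) b i j) x := by
  simp only [algEq, Matrix.sum_apply, Matrix.sub_apply]
  refine ContDiffAt.sum fun a _ => ContDiffAt.sub ?_ ?_
  · exact contDiffAt_mul_apply (contDiffAt_dens_metric hU hg hx α a b) (fun i j => hC i j a) i j
  · exact contDiffAt_mul_apply (N := fun y => dens α (g y) a b) (M := fun y => connMat (C y) a)
      (fun i j => hC i j a) (contDiffAt_dens_metric hU hg hx α a b) i j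

theorem connMat_smul (t : ℂ) (C : Fin 4 → Fin 4 → Fin 4 → ℂ) (a : Fin 4) :
    connMat (t • C) a = t • connMat C a := rfl

theorem algEq_smul (t : ℂ) (G : Matrix (Fin 4) (Fin 4) ℝ) (C : Fin 4 → Fin 4 → Fin 4 → ℂ)
    (b : Fin 4) : algEq α G (t • C) b = t • algEq α G C b := by
  simp only [algEq, connMat_smul, Matrix.mul_smul, Matrix.smul_mul, ← smul_sub, ← Finset.smul_sum]

theorem pd_const_mul {f : Coord → ℂ} {x : Coord} (hf : DifferentiableAt ℝ f x) (t : ℂ)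
    (a : Fin 4) : pd a (fun y => t * f y) x = t * pd a f x := by
  rw [pd_mul (differentiableAt_const t) hf, pd_const, zero_mul, zero_add]

/-- The density is exactly quadratic in the connection, so the action is a quadratic polynomial in t
and no differentiation under the integral is needed. -/
theorem lagDens_add_smul (hU : IsOpen U) (hg : IsLorentzMetric U g) {x : Coord} (hx : x ∈ U)
    {Γ C : Field3} (hΓ : ∀ l m n, ContDiffAt ℝ ∞ (fun y => Γ y l m n) x)
    (hC : ∀ l m n, ContDiffAt ℝ ∞ (fun y => C y l m n) x) (t : ℝ) :
    lagDens α (g x) (fun y => Γ y + t • C y) x = lagDens α (g x) Γ x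
      + t * (2 * (∑ a, pd a (fun y => ∑ b, (dens α (g y) a b * connMat (C y) b).trace) x
        + ∑ b, (algEq α (g x) (Γ x - leviCivita g x) b * connMat (C x) b).trace))
      + t ^ 2 * ∑ b, (algEq α (g x) (C x) b * connMat (C x) b).trace := by
  have h1 : (fun y => Γ y + t • C y) = Γ + fun y => (t : ℂ) • C y := by
    funext y l m n; simp
  have h2 : ∀ a, pd a (fun y => ∑ b, (dens α (g y) a b * connMat ((t : ℂ) • C y) b).trace) x
      = t * pd a (fun y => ∑ b, (dens α (g y) a b * connMat (C y) b).trace) x := by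
    intro a
    rw [← pd_const_mul]
    · simp only [connMat_smul, Matrix.mul_smul, Matrix.trace_smul, smul_eq_mul, Finset.mul_sum]
    · exact DifferentiableAt.fun_sum fun b _ => (contDiffAt_trace_mul
        (contDiffAt_dens_metric hU hg hx α a b) (fun i j => hC i j b)).differentiableAt (by simp)
  have hCt : ∀ l m n, DifferentiableAt ℝ (fun y => ((t : ℂ) • C y) l m n) x := fun l m n =>
    ((contDiffAt_const (c := (t : ℂ))).mul (hC l m n)).differentiableAt (by simp)
  rw [h1, lagDens_add hU hg hx (fun l m n => (hΓ l m n).differentiableAt (by simp))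
    hCt]
  simp only [h2]
  simp only [algEq_smul, connMat_smul, Matrix.mul_smul, Matrix.smul_mul, Matrix.trace_smul,
    smul_eq_mul, ← Finset.mul_sum]
  ring

theorem hasDerivAt_quadratic (A B C : ℂ) :
    HasDerivAt (fun t : ℝ => A + t * B + (t : ℂ) ^ 2 * C) B 0 := by
  have h1 : HasDerivAt (fun t : ℝ => (t : ℂ)) 1 0 := Complex.ofRealCLM.hasDerivAt
  have h2 := ((h1.mul_const B).const_add A).add ((h1.pow 2).mul_const C)
  have h3 : HasDerivAt (fun t : ℝ => A + t * B + (t : ℂ) ^ 2 * C) _ 0 := h2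
  simpa using h3

theorem integrableOn_of_contDiffAt {K : Set Coord} (hK : IsCompact K) {f : Coord → ℂ}
    (hf : ∀ x ∈ K, ContDiffAt ℝ ∞ f x) : IntegrableOn f K :=
  ContinuousOn.integrableOn_compact hK fun x hx => (hf x hx).continuousAt.continuousWithinAt

theorem hasDerivAt_action_connection (hU : IsOpen U) (hg : IsLorentzMetric U g) {Γ : Field3}
    (hΓ : ContDiffOn ℝ ∞ Γ U) {K : Set Coord} (hKU : K ⊆ U) (hK : IsCompact K) {γ : Field3}
    (hγ : ContDiff ℝ ∞ γ) (hγ0 : ∀ x ∉ K, γ x = 0) :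
    HasDerivAt (fun t : ℝ => action κ α K g (fun x => Γ x + t • γ x))
      (1 / (2 * (κ : ℂ)) * (2 * ∫ x in K,
        ∑ b, (algEq α (g x) (Γ x - leviCivita g x) b * connMat (γ x) b).trace)) 0 := by
  have hΓ' : ∀ x ∈ U, ∀ l m n, ContDiffAt ℝ ∞ (fun y => Γ y l m n) x := fun x hx =>
    ContDiffOn.component hU hΓ hx
  have hγ' : ∀ x, ∀ l m n, ContDiffAt ℝ ∞ (fun y => γ y l m n) x := fun x =>
    ContDiffOn.component isOpen_univ hγ.contDiffOn (Set.mem_univ x)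
  obtain ⟨w, hw⟩ : ∃ w : Fin 4 → Coord → ℂ,
    w = fun a y => ∑ b, (dens α (g y) a b * connMat (γ y) b).trace := ⟨_, rfl⟩
  have hwU : ∀ a, ∀ x ∈ U, ContDiffAt ℝ ∞ (w a) x := by
    intro a x hx
    rw [hw]
    exact ContDiffAt.sum fun b _ => contDiffAt_trace_mul
      (contDiffAt_dens_metric hU hg hx α a b) (fun i j => hγ' x i j b)
  have hw0 : ∀ a, ∀ x ∉ K, w a x = 0 := by
    intro a x hx
    have h1 : ∀ b, connMat (0 : Fin 4 → Fin 4 → Fin 4 → ℂ) b = 0 := fun b => rfl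
    rw [hw]
    simp [hγ0 x hx, h1]
  -- Nothing is known about g outside U. The boundary current is nevertheless smooth everywhere,
  -- since it vanishes off the compact set K inside U.
  have hwS : ∀ a, ContDiff ℝ ∞ (w a) := by
    intro a
    rw [contDiff_iff_contDiffAt]
    intro x
    by_cases hx : x ∈ K
    · exact hwU a x (hKU hx)
    · refine (contDiffAt_const (c := (0 : ℂ))).congr_of_eventuallyEq ?_
      filter_upwards [hK.isClosed.isOpen_compl.mem_nhds hx] with y hy using hw0 a y hy
  have hmeas := hK.measurableSet
  have hLC : ∀ x ∈ U, ∀ l m n, ContDiffAt ℝ ∞ (fun y => (Γ y - leviCivita g y) l m n) x :=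
    fun x hx l m n => (hΓ' x hx l m n).sub (contDiffAt_leviCivita hU hg hx l m n)
  have hiA : IntegrableOn (fun x => lagDens α (g x) Γ x) K := by
    refine integrableOn_of_contDiffAt hK fun x hx => ContDiffAt.sum fun a _ =>
      ContDiffAt.sum fun b _ => ?_
    exact contDiffAt_trace_mul (contDiffAt_dens_metric hU hg (hKU hx) α a b)
      (contDiffAt_curvMat (hΓ' x (hKU hx)) a b)
  have hiD : ∀ a, IntegrableOn (fun x => pd a (w a) x) K := fun a =>
    integrableOn_of_contDiffAt hK fun x hx => ContDiffAt.pd (hwU a x (hKU hx)) a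
  have hiE : IntegrableOn (fun x => ∑ b, (algEq α (g x) (Γ x - leviCivita g x) b
      * connMat (γ x) b).trace) K := by
    refine integrableOn_of_contDiffAt hK fun x hx => ContDiffAt.sum fun b _ => ?_
    exact contDiffAt_trace_mul (contDiffAt_algEq hU hg (hKU hx) (hLC x (hKU hx)) b)
      (fun i j => hγ' x i j b)
  have hiQ : IntegrableOn (fun x => ∑ b, (algEq α (g x) (γ x) b * connMat (γ x) b).trace) K := by
    refine integrableOn_of_contDiffAt hK fun x hx => ContDiffAt.sum fun b _ => ?_
    exact contDiffAt_trace_mul (contDiffAt_algEq hU hg (hKU hx) (hγ' x) b) (fun i j => hγ' x i j b)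
  have hiDE : IntegrableOn (fun x => 2 * (∑ a, pd a (w a) x
      + ∑ b, (algEq α (g x) (Γ x - leviCivita g x) b * connMat (γ x) b).trace)) K :=
    ((integrable_finsetSum _ fun a _ => hiD a).add hiE).const_mul 2
  have hval : ∀ t : ℝ, ∫ x in K, (sqrtNegDet g x : ℂ) * lagrangian α g (fun x => Γ x + t • γ x) x
      = (∫ x in K, lagDens α (g x) Γ x)
        + t * (2 * ∫ x in K, ∑ b, (algEq α (g x) (Γ x - leviCivita g x) b
            * connMat (γ x) b).trace)
        + t ^ 2 * ∫ x in K, ∑ b, (algEq α (g x) (γ x) b * connMat (γ x) b).trace := by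
    intro t
    have h1 : ∫ x in K, 2 * (∑ a, pd a (w a) x
        + ∑ b, (algEq α (g x) (Γ x - leviCivita g x) b * connMat (γ x) b).trace)
        = 2 * ∫ x in K, ∑ b, (algEq α (g x) (Γ x - leviCivita g x) b
            * connMat (γ x) b).trace := by
      rw [integral_const_mul, integral_add (integrable_finsetSum _ fun a _ => hiD a) hiE,
        integral_finsetSum _ fun a _ => hiD a]
      simp only [setIntegral_pd_eq_zero hK (hwS _) (hw0 _), Finset.sum_const_zero, zero_add]
    have hi2 : IntegrableOn (fun x => lagDens α (g x) Γ x + t * (2 * (∑ a, pd a (w a) x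
        + ∑ b, (algEq α (g x) (Γ x - leviCivita g x) b * connMat (γ x) b).trace))) K :=
      hiA.add (hiDE.const_mul _)
    rw [← h1, ← integral_const_mul, ← integral_const_mul,
      ← integral_add hiA (hiDE.const_mul _), ← integral_add hi2 (hiQ.const_mul _)]
    refine setIntegral_congr_fun hmeas fun x hx => ?_
    have hxU := hKU hx
    rw [sqrt_mul_lagrangian (hg.det_neg hxU) (hg.isSymm hxU),
      lagDens_add_smul hU hg hxU (hΓ' x hxU) (hγ' x), hw]
  simp only [action, hval]
  exact (hasDerivAt_quadratic _ _ _).const_mul _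

end Connection

/-- The metric variation of the Lagrangian density in the direction `δg = H`. -/
def metricVar (α : ℂ) (G : Matrix (Fin 4) (Fin 4) ℝ) (Γ : Field3) (x : Coord)
    (H : Matrix (Fin 4) (Fin 4) ℝ) : ℂ :=
  ∑ a, ∑ b, (densVar α G (((1 / 2 : ℝ) • (G⁻¹ * H)).map (fun r : ℝ => (r : ℂ))) a b
    * curvMat Γ x a b).trace

section Variation

variable {U : Set Coord} {g : MetricField} {α : ℂ} {κ : ℝ}

theorem contDiffAt_metricVar (hU : IsOpen U) (hg : IsLorentzMetric U g) {Γ : Field3} {x : Coord}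
    (hx : x ∈ U) (hΓ : ∀ l m n, ContDiffAt ℝ ∞ (fun y => Γ y l m n) x)
    (H : Matrix (Fin 4) (Fin 4) ℝ) :
    ContDiffAt ℝ ∞ (fun y => metricVar α (g y) Γ y H) x := by
  have hA : ∀ i j, ContDiffAt ℝ ∞ (fun y =>
      ((1 / 2 : ℝ) • ((g y)⁻¹ * H)).map (fun r : ℝ => (r : ℂ)) i j) x := by
    intro i j
    simp only [Matrix.map_apply, Matrix.smul_apply, Matrix.mul_apply, smul_eq_mul]
    exact ContDiffAt.ofReal (contDiffAt_const.mul (ContDiffAt.sum fun k _ =>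
      (contDiffAt_inv (hg.contDiffAt hU hx) (hg.det_neg hx).ne i k).mul contDiffAt_const))
  have hd := contDiffAt_dens_metric hU hg hx α
  refine ContDiffAt.sum fun a _ => ContDiffAt.sum fun b _ =>
    contDiffAt_trace_mul (fun i j => ?_) (contDiffAt_curvMat hΓ a b)
  simp only [densVar, Matrix.sub_apply, Matrix.add_apply, Matrix.sum_apply, Matrix.smul_apply,
    smul_eq_mul]
  refine ContDiffAt.sub (ContDiffAt.sub (ContDiffAt.sub (ContDiffAt.add ?_ ?_) ?_) ?_) ?_
  · exact ContDiffAt.mul (ContDiffAt.sum fun i _ => hA i i) (hd a b i j)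
  · exact contDiffAt_mul_apply (hd a b) hA i j
  · exact contDiffAt_mul_apply hA (hd a b) i j
  · exact ContDiffAt.sum fun r _ => (hA a r).mul (hd r b i j)
  · exact ContDiffAt.sum fun r _ => (hA b r).mul (hd a r i j)

theorem metricVar_smul (G : Matrix (Fin 4) (Fin 4) ℝ) (Γ : Field3) (x : Coord)
    (H : Matrix (Fin 4) (Fin 4) ℝ) (c : ℝ) :
    metricVar α G Γ x (c • H) = c • metricVar α G Γ x H := by
  have h1 : ((1 / 2 : ℝ) • (G⁻¹ * (c • H))).map (fun r : ℝ => (r : ℂ))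
      = (c : ℂ) • ((1 / 2 : ℝ) • (G⁻¹ * H)).map (fun r : ℝ => (r : ℂ)) := by
    ext i j
    simp only [Matrix.map_apply, Matrix.smul_apply, Matrix.mul_smul, smul_eq_mul]
    push_cast
    ring
  have h2 : ∀ (A : CMat) (a b : Fin 4), densVar α G ((c : ℂ) • A) a b
      = (c : ℂ) • densVar α G A a b := by
    intro A a b
    simp only [densVar, Matrix.trace_smul, Matrix.mul_smul, Matrix.smul_mul, Matrix.smul_apply,
      smul_sub, smul_add, Finset.smul_sum, smul_smul, smul_eq_mul]
  simp only [metricVar, h1, h2, Matrix.smul_mul, Matrix.trace_smul, ← Finset.smul_sum]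
  simp

theorem hasDerivAt_lagDens {G H : Matrix (Fin 4) (Fin 4) ℝ} (hG : Gᵀ = G) (hH : Hᵀ = H)
    (hdet : G.det < 0) (Γ : Field3) (x : Coord) :
    HasDerivAt (fun t : ℝ => lagDens α (G + t • H) Γ x) (metricVar α G Γ x H) 0 := by
  have hu : IsUnit G.det := isUnit_iff_ne_zero.mpr hdet.ne
  have hX : G⁻¹ᵀ = G⁻¹ := by rw [Matrix.transpose_nonsing_inv, hG]
  obtain ⟨B, hB⟩ : ∃ B : Matrix (Fin 4) (Fin 4) ℝ, B = (1 / 2 : ℝ) • (G⁻¹ * H) := ⟨_, rfl⟩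
  have hBt : Bᵀ = (1 / 2 : ℝ) • (H * G⁻¹) := by
    rw [hB, Matrix.transpose_smul, Matrix.transpose_mul, hH, hX]
  have h2 : G * B + Bᵀ * G = H := by
    rw [hBt, hB, Matrix.mul_smul, Matrix.smul_mul, ← Matrix.mul_assoc, Matrix.mul_assoc H,
      Matrix.mul_nonsing_inv _ hu, Matrix.nonsing_inv_mul _ hu, Matrix.one_mul, Matrix.mul_one,
      ← add_smul]
    norm_num
  have h3 : ∀ i j, HasDerivAt (fun t : ℝ => (G + t • H) i j)
      (((G + (0 : ℝ) • H) * B + Bᵀ * (G + (0 : ℝ) • H)) i j) 0 := by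
    intro i j
    rw [zero_smul, add_zero, h2]
    simp only [Matrix.add_apply, Matrix.smul_apply, smul_eq_mul]
    simpa using ((hasDerivAt_id (0 : ℝ)).mul_const (H i j)).const_add (G i j)
  have h4 : ∀ a b n m, HasDerivAt (fun t : ℝ => dens α (G + t • H) a b n m)
      (densVar α G (B.map (fun r : ℝ => (r : ℂ))) a b n m) 0 := by
    intro a b n m
    have h5 := hasDerivAt_dens (M := fun t : ℝ => G + t • H) h3 (by simpa using hdet) α a b n m
    simpa using h5
  simp only [lagDens, metricVar, ← hB, Matrix.trace, Matrix.diag_apply, Matrix.mul_apply]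
  exact HasDerivAt.fun_sum fun a _ => HasDerivAt.fun_sum fun b _ => HasDerivAt.fun_sum fun n _ =>
    HasDerivAt.fun_sum fun m _ => (h4 a b n m).mul_const _

/-- The integrand agrees with `lagDens` near t = 0 and is therefore C¹ jointly in (t, x) around {0}
× K, which permits differentiation under the integral. -/
theorem hasDerivAt_action_metric (hU : IsOpen U) (hg : IsLorentzMetric U g) {Γ : Field3}
    (hΓ : ContDiffOn ℝ ∞ Γ U) {K : Set Coord} (hKU : K ⊆ U) (hK : IsCompact K) {h : MetricField}
    (hh : ∀ m n, ContDiff ℝ ∞ (fun x => h x m n)) (hs : ∀ x, (h x).IsSymm) :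
    HasDerivAt (fun t : ℝ => action κ α K (fun x => g x + t • h x) Γ)
      (1 / (2 * (κ : ℂ)) * ∫ x in K, metricVar α (g x) Γ x (h x)) 0 := by
  obtain ⟨F, hF⟩ : ∃ F : ℝ × Coord → ℂ, F = fun p =>
    (sqrtNegDet (fun x => g x + p.1 • h x) p.2 : ℂ)
      * lagrangian α (fun x => g x + p.1 • h x) Γ p.2 := ⟨_, rfl⟩
  have hM : ∀ x ∈ U, ∀ i j, ContDiffAt ℝ ∞
      (fun p : ℝ × Coord => (g p.2 + p.1 • h p.2) i j) (0, x) := by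
    intro x hx i j
    simp only [Matrix.add_apply, Matrix.smul_apply, smul_eq_mul]
    refine ContDiffAt.add ?_ (contDiffAt_fst.mul ?_)
    · exact ContDiffAt.comp (g := fun y => g y i j) (0, x) (hg.contDiffAt hU hx i j) contDiffAt_snd
    · exact ContDiffAt.comp (g := fun y => h y i j) (0, x) (hh i j).contDiffAt contDiffAt_snd
  have hneg : ∀ x ∈ U, (g x + (0 : ℝ) • h x).det < 0 := fun x hx => by
    rw [zero_smul, add_zero]; exact hg.det_neg hx
  -- For large t the varied metric may degenerate; negativity of its determinant persists near t =
  -- 0, and this with symmetry is all the density formula uses.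
  have heq : ∀ x ∈ U, F =ᶠ[𝓝 ((0 : ℝ), x)] fun p => lagDens α (g p.2 + p.1 • h p.2) Γ p.2 := by
    intro x hx
    have h1 : ∀ᶠ p : ℝ × Coord in 𝓝 ((0 : ℝ), x), (g p.2 + p.1 • h p.2).det < 0 :=
      (contDiffAt_det (hM x hx)).continuousAt.eventually_lt continuousAt_const (hneg x hx)
    have h2 : ∀ᶠ p : ℝ × Coord in 𝓝 ((0 : ℝ), x), p.2 ∈ U :=
      continuousAt_snd.eventually (hU.mem_nhds hx)
    filter_upwards [h1, h2] with p hp1 hp2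
    rw [hF]
    refine sqrt_mul_lagrangian (g := fun x => g x + p.1 • h x) hp1 ?_ Γ
    rw [Matrix.transpose_add, Matrix.transpose_smul, hg.isSymm hp2, (hs p.2).eq]
  have hreg : ∀ x ∈ K, ContDiffAt ℝ 1 F (0, x) := by
    intro x hx
    have hxU := hKU hx
    have h1 : ContDiffAt ℝ ∞ (fun p : ℝ × Coord => lagDens α (g p.2 + p.1 • h p.2) Γ p.2) (0, x) :=
      ContDiffAt.sum fun a _ => ContDiffAt.sum fun b _ => contDiffAt_trace_mul
        (contDiffAt_dens (hM x hxU) (hneg x hxU) α a b) (fun i j =>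
          ContDiffAt.comp (g := fun y => curvMat Γ y a b i j) ((0 : ℝ), x)
            (contDiffAt_curvMat (ContDiffOn.component hU hΓ hxU) a b i j) contDiffAt_snd)
    exact (h1.congr_of_eventuallyEq (heq x hxU)).of_le (by simp)
  have hkey := hasDerivAt_setIntegral_of_contDiffAt hK hreg
  have hder : ∫ x in K, deriv (fun t : ℝ => F (t, x)) 0
      = ∫ x in K, metricVar α (g x) Γ x (h x) := by
    refine setIntegral_congr_fun hK.measurableSet fun x hx => ?_
    have hxU := hKU hx
    have h1 : (fun t : ℝ => F (t, x)) =ᶠ[𝓝 0] fun t => lagDens α (g x + t • h x) Γ x :=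
      (show ContinuousAt (fun t : ℝ => (t, x)) 0 by fun_prop).eventually (heq x hxU)
    exact ((hasDerivAt_lagDens (hg.isSymm hxU) (hs x).eq (hg.det_neg hxU) Γ x).congr_of_eventuallyEq
      h1).deriv
  rw [hder] at hkey
  have h3 := hkey.const_mul (1 / (2 * (κ : ℂ)))
  rw [hF] at h3
  exact h3

/-- The field equations. -/
theorem isSolution_iff (hκ : 0 < κ) (hU : IsOpen U) (hg : IsLorentzMetric U g) {Γ : Field3}
    (hΓ : ContDiffOn ℝ ∞ Γ U) :
    IsSolution κ α U g Γ ↔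
      (∀ x ∈ U, ∀ b, algEq α (g x) (Γ x - leviCivita g x) b = 0) ∧
      ∀ x ∈ U, ∀ H : Matrix (Fin 4) (Fin 4) ℝ, Hᵀ = H → metricVar α (g x) Γ x H = 0 := by
  have hκ' : (1 / (2 * (κ : ℂ))) ≠ 0 := by
    simp [hκ.ne']
  have hΓ' : ∀ x ∈ U, ∀ l m n, ContDiffAt ℝ ∞ (fun y => Γ y l m n) x := fun x hx =>
    ContDiffOn.component hU hΓ hx
  constructor
  · intro hsol
    constructor
    · suffices H : ∀ k j i, ∀ x ∈ U, algEq α (g x) (Γ x - leviCivita g x) k j i = 0 by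
        intro x hx b
        ext j i
        exact H b j i x hx
      intro k j i
      refine eqOn_zero_of_integral_smul hU (fun x hx => ?_) fun φ hφ hc hφU => ?_
      · exact (contDiffAt_algEq hU hg (C := fun y => Γ y - leviCivita g y) hx (fun l m n =>
          (hΓ' x hx l m n).sub (contDiffAt_leviCivita hU hg hx l m n)) k j
            i).continuousAt.continuousWithinAt
      -- A bump function in a single component of the connection; pairing by the trace then isolates
      -- the transposed entry of E^k.
      · obtain ⟨γ, hγ⟩ : ∃ γ : Field3, γ = fun x l m n =>
          if l = i ∧ m = j ∧ n = k then (φ x : ℂ) else 0 := ⟨_, rfl⟩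
        have h1 : ContDiff ℝ ∞ γ := by
          rw [← contDiffOn_univ, contDiffOn_field3_iff]
          intro l m n
          rw [contDiffOn_univ, hγ]
          by_cases h : l = i ∧ m = j ∧ n = k
          · simp only [h, if_true, and_self]
            exact Complex.ofRealCLM.contDiff.comp hφ
          · simp only [h, if_false]
            exact contDiff_const
        have h2 : ∀ x ∉ tsupport φ, γ x = 0 := by
          intro x hx
          funext l m n
          rw [hγ]
          simp [image_eq_zero_of_notMem_tsupport hx]
        have h3 := (hasDerivAt_action_connection (κ := κ) (α := α) hU hg hΓ hφU hc h1 h2).unique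
          (hsol.connection_eq _ hφU hc γ h1 h2)
        have h4 := (mul_eq_zero.mp ((mul_eq_zero.mp h3).resolve_left hκ')).resolve_left two_ne_zero
        rw [← h4]
        refine setIntegral_congr_fun hc.measurableSet fun x _ => ?_
        have h5 : ∀ b, connMat (γ x) b = if b = k then Matrix.single i j (φ x : ℂ) else 0 := by
          intro b
          ext l m
          rw [hγ]
          by_cases hb : b = k
          · simp [connMat, hb, Matrix.single_apply, eq_comm]
          · simp [connMat, hb]
        simp only [h5]
        rw [Finset.sum_eq_single k (fun b _ hb => by simp [hb]) (by simp)]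
        simp [Matrix.trace_mul_single, mul_comm]
    · suffices H : ∀ H : Matrix (Fin 4) (Fin 4) ℝ, Hᵀ = H → ∀ x ∈ U,
          metricVar α (g x) Γ x H = 0 from fun x hx S hS => H S hS x hx
      intro H hH
      refine eqOn_zero_of_integral_smul hU (fun x hx => ?_) fun φ hφ hc hφU => ?_
      · exact (contDiffAt_metricVar hU hg hx (hΓ' x hx) H).continuousAt.continuousWithinAt
      · have h1 : ∀ m n, ContDiff ℝ ∞ (fun x => (φ x • H) m n) := fun m n =>
          hφ.mul contDiff_const
        have h2 : ∀ x, (φ x • H).IsSymm := fun x => by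
          rw [Matrix.IsSymm, Matrix.transpose_smul, hH]
        have h3 := (hasDerivAt_action_metric (κ := κ) (α := α) hU hg hΓ hφU hc h1 h2).unique
          (hsol.metric_eq _ hφU hc (fun x => φ x • H) h1 h2 fun x hx => by
            rw [image_eq_zero_of_notMem_tsupport hx, zero_smul])
        have h4 := (mul_eq_zero.mp h3).resolve_left hκ'
        rw [← h4]
        exact setIntegral_congr_fun hc.measurableSet fun x _ => (metricVar_smul _ _ _ _ _).symm
  · rintro ⟨hA, hM⟩
    constructor
    · intro K hKU hK h hh hs _
      refine (hasDerivAt_action_metric hU hg hΓ hKU hK hh hs).congr_deriv ?_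
      rw [setIntegral_congr_fun (g := fun _ => (0 : ℂ)) hK.measurableSet fun x hx =>
        hM x (hKU hx) (h x) (hs x).eq]
      simp
    · intro K hKU hK γ hγ hγ0
      refine (hasDerivAt_action_connection hU hg hΓ hKU hK hγ hγ0).congr_deriv ?_
      rw [setIntegral_congr_fun (g := fun _ => (0 : ℂ)) hK.measurableSet fun x hx => by
        simp [hA x (hKU hx)]]
      simp

end Variation

/-! ### Smoothness of shifts and of the torsion components -/

section Smoothness

variable {U : Set Coord} {g : MetricField} {α : ℂ} {x : Coord}

theorem contDiffAt_epsUp (hU : IsOpen U) (hg : IsLorentzMetric U g) (hx : x ∈ U)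
    (a b c d : Fin 4) : ContDiffAt ℝ ∞ (fun y => epsUp g y a b c d) x :=
  contDiffAt_const.div (contDiffAt_sqrt_neg_det (hg.contDiffAt hU hx) (hg.det_neg hx))
    (Real.sqrt_pos.mpr (by linarith [hg.det_neg hx])).ne'

theorem contDiffAt_epsLow (hU : IsOpen U) (hg : IsLorentzMetric U g) (hx : x ∈ U)
    (a b c d : Fin 4) : ContDiffAt ℝ ∞ (fun y => epsLow g y a b c d) x :=
  ContDiffAt.sum fun i _ => ContDiffAt.sum fun j _ => ContDiffAt.sum fun k _ =>
    ContDiffAt.sum fun l _ => ((((hg.contDiffAt hU hx a i).mul (hg.contDiffAt hU hx b j)).mul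
      (hg.contDiffAt hU hx c k)).mul (hg.contDiffAt hU hx d l)).mul (contDiffAt_epsUp hU hg hx i j k l)

theorem contDiffAt_metric_inv (hU : IsOpen U) (hg : IsLorentzMetric U g) (hx : x ∈ U)
    (a b : Fin 4) : ContDiffAt ℝ ∞ (fun y => (g y)⁻¹ a b) x :=
  contDiffAt_inv (hg.contDiffAt hU hx) (hg.det_neg hx).ne a b

theorem contDiffAt_epsMixed (hU : IsOpen U) (hg : IsLorentzMetric U g) (hx : x ∈ U)
    (a b c d : Fin 4) : ContDiffAt ℝ ∞ (fun y => epsMixed g y a b c d) x :=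
  ContDiffAt.sum fun i _ => (contDiffAt_metric_inv hU hg hx a i).mul
    (contDiffAt_epsLow hU hg hx i b c d)

theorem contDiffAt_raise (hU : IsOpen U) (hg : IsLorentzMetric U g) (hx : x ∈ U)
    {ψ : CovectorField} (hψ : ∀ m, ContDiffAt ℝ ∞ (fun y => ψ y m) x) (a : Fin 4) :
    ContDiffAt ℝ ∞ (fun y => raise g y (ψ y) a) x :=
  ContDiffAt.sum fun b _ => (ContDiffAt.ofReal (contDiffAt_metric_inv hU hg hx a b)).mul (hψ b)

theorem contDiffAt_covector (hU : IsOpen U) {ψ : CovectorField} (hψ : ContDiffOn ℝ ∞ ψ U)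
    (hx : x ∈ U) (m : Fin 4) : ContDiffAt ℝ ∞ (fun y => ψ y m) x :=
  ((contDiffOn_pi.mp hψ) m).contDiffAt (hU.mem_nhds hx)

theorem contDiffAt_projShift (hU : IsOpen U) {ξ : CovectorField} (hξ : ContDiffOn ℝ ∞ ξ U)
    (hx : x ∈ U) (l m n : Fin 4) : ContDiffAt ℝ ∞ (fun y => projShift ξ y l m n) x :=
  contDiffAt_const.mul (contDiffAt_covector hU hξ hx n)

/-- Gauge shifts are smooth. -/
theorem IsGaugeShift.contDiffOn (hU : IsOpen U) (hg : IsLorentzMetric U g) {N : Field3}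
    (hN : IsGaugeShift α U g N) : ContDiffOn ℝ ∞ N U := by
  have hX := fun {x} (hx : x ∈ U) i j =>
    ContDiffAt.ofReal (contDiffAt_metric_inv hU hg hx i j)
  obtain ⟨ξ, hξ, h | ⟨s, hs, hα, ψ, V, hψ, hV, -, h⟩ | ⟨s, hs, hα, V, hV, -, h⟩⟩ := hN
  · refine ContDiffOn.congr ?_ h
    exact contDiffOn_field3_iff.mpr fun l m n x hx =>
      (contDiffAt_projShift hU hξ hx l m n).contDiffWithinAt
  · refine ContDiffOn.congr ?_ h
    refine contDiffOn_field3_iff.mpr fun l m n x hx => ContDiffAt.contDiffWithinAt ?_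
    have hψ' := contDiffAt_covector hU hψ hx
    refine ((contDiffAt_projShift hU hξ hx l m n).add (ContDiffAt.sub (ContDiffAt.sub
      (contDiffAt_const.mul (hψ' m)) ((contDiffAt_raise hU hg hx hψ' l).mul
        (ContDiffAt.ofReal (hg.contDiffAt hU hx m n)))) (contDiffAt_const.mul
        (ContDiffAt.sum fun a _ => (ContDiffAt.ofReal (contDiffAt_epsMixed hU hg hx l m n a)).mul
          (contDiffAt_raise hU hg hx hψ' a))))).add ?_
    exact ContDiffAt.sum fun k _ => (hX hx l k).mul (ContDiffOn.component hU hV hx k m n)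
  · refine ContDiffOn.congr ?_ h
    refine contDiffOn_field3_iff.mpr fun l m n x hx => ContDiffAt.contDiffWithinAt ?_
    refine (contDiffAt_projShift hU hξ hx l m n).add ?_
    exact ContDiffAt.sum fun k _ => (hX hx l k).mul ((ContDiffOn.component hU hV hx k n m).add
      (ContDiffOn.component hU hV hx m n k))

variable {Γ : Field3}

theorem contDiffAt_torsion (hU : IsOpen U) (hΓ : ContDiffOn ℝ ∞ Γ U) (hx : x ∈ U)
    (m n r : Fin 4) : ContDiffAt ℝ ∞ (fun y => torsion Γ y m n r) x :=
  ((ContDiffOn.component hU hΓ hx r m n).sub (ContDiffOn.component hU hΓ hx r n m)).div_const 2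

theorem contDiffAt_torsionLow (hU : IsOpen U) (hg : IsLorentzMetric U g)
    (hΓ : ContDiffOn ℝ ∞ Γ U) (hx : x ∈ U) (m n k : Fin 4) :
    ContDiffAt ℝ ∞ (fun y => torsionLow g Γ y m n k) x :=
  ContDiffAt.sum fun r _ => (contDiffAt_torsion hU hΓ hx m n r).mul
    (ContDiffAt.ofReal (hg.contDiffAt hU hx r k))

theorem contDiffAt_torsionVec (hU : IsOpen U) (hΓ : ContDiffOn ℝ ∞ Γ U) (hx : x ∈ U)
    (m : Fin 4) : ContDiffAt ℝ ∞ (fun y => torsionVec Γ y m) x :=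
  ContDiffAt.sum fun r _ => contDiffAt_torsion hU hΓ hx m r r

theorem contDiffAt_torsionPseudo (hU : IsOpen U) (hg : IsLorentzMetric U g)
    (hΓ : ContDiffOn ℝ ∞ Γ U) (hx : x ∈ U) (l : Fin 4) :
    ContDiffAt ℝ ∞ (fun y => torsionPseudo g Γ y l) x :=
  ContDiffAt.sum fun a _ => ContDiffAt.sum fun b _ => ContDiffAt.sum fun k _ =>
    (ContDiffAt.ofReal (contDiffAt_epsUp hU hg hx l a b k)).mul
      (contDiffAt_torsionLow hU hg hΓ hx a b k)

theorem contDiffAt_torsionTensor (hU : IsOpen U) (hg : IsLorentzMetric U g)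
    (hΓ : ContDiffOn ℝ ∞ Γ U) (hx : x ∈ U) (l m n : Fin 4) :
    ContDiffAt ℝ ∞ (fun y => torsionTensor g Γ y l m n) x := by
  have hG := fun i j => ContDiffAt.ofReal (hg.contDiffAt hU hx i j)
  have hv := contDiffAt_torsionVec hU hΓ hx
  exact ((contDiffAt_torsionLow hU hg hΓ hx l m n).sub (contDiffAt_const.mul
    (((hG m n).mul (hv l)).sub ((hG l n).mul (hv m))))).sub (contDiffAt_const.mul
      (ContDiffAt.sum fun r _ => (ContDiffAt.ofReal (contDiffAt_epsLow hU hg hx l m n r)).mul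
        (contDiffAt_torsionPseudo hU hg hΓ hx r)))

end Smoothness

/-! ### Shifting a solution to the Levi-Civita connection -/

section Shifts

variable {U : Set Coord} {g : MetricField} {α : ℂ} {Γ : Field3}

theorem IsDualTensor.const_mul {c : ℂ} {V : Field3} (hV : IsDualTensor c U g V) (t : ℂ) :
    IsDualTensor c U g (fun x l m n => t * V x l m n) := by
  intro x hx l m n
  obtain ⟨h1, h2⟩ := hV x hx l m n
  constructor
  · have h3 : ∑ r, ∑ s, (epsHalf g x l m r s : ℂ) * (t * V x n r s)
        = t * ∑ r, ∑ s, (epsHalf g x l m r s : ℂ) * V x n r s := by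
      simp only [Finset.mul_sum]
      exact Finset.sum_congr rfl fun r _ => Finset.sum_congr rfl fun s _ => by ring
    simp only [h3]
    linear_combination t * h1
  · linear_combination t * h2

theorem SolvedGeneric.exists_shift (hU : IsOpen U) (hΓ : ContDiffOn ℝ ∞ Γ U)
    (h : SolvedGeneric U g Γ) :
    ∃ N : Field3, IsGaugeShift α U g N ∧ ∀ x ∈ U, Γ x + N x = leviCivita g x := by
  refine ⟨projShift fun x m => 2 / 3 * torsionVec Γ x m, ⟨_, ?_, Or.inl fun x _ => rfl⟩, ?_⟩
  · exact contDiffOn_pi.mpr fun m x hx =>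
      (contDiffAt_const.mul (contDiffAt_torsionVec hU hΓ hx m)).contDiffWithinAt
  · intro x hx
    funext l m n
    simp only [Pi.add_apply, projShift, h x hx l m n]
    ring

theorem raise_lower (hg : IsLorentzMetric U g) {x : Coord} (hx : x ∈ U) (v : Fin 4 → ℂ)
    (a : Fin 4) : raise g x (lower g x v) a = v a := by
  have hu : IsUnit (g x).det := isUnit_iff_ne_zero.mpr (hg.det_neg hx).ne
  simp only [raise, lower, Finset.mul_sum]
  rw [Finset.sum_comm]
  have h1 : ∀ c, ∑ b, ((g x)⁻¹ a b : ℂ) * ((g x b c : ℂ) * v c) = kd a c * v c := by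
    intro c
    have h2 := congrFun (congrFun (Matrix.nonsing_inv_mul _ hu) a) c
    rw [Matrix.mul_apply] at h2
    have h3 : ∑ b, ((g x)⁻¹ a b : ℂ) * (g x b c : ℂ) = kd a c := by
      have h4 := congrArg (fun r : ℝ => (r : ℂ)) h2
      push_cast at h4
      rw [h4, Matrix.one_apply, kd]
      split_ifs <;> simp
    rw [← h3, Finset.sum_mul]
    exact Finset.sum_congr rfl fun b _ => by ring
  simp only [h1, sum_kd_left]

theorem SolvedHalf.exists_shift (hU : IsOpen U) (hg : IsLorentzMetric U g)
    (hΓ : ContDiffOn ℝ ∞ Γ U) {s : ℂ} (hs : s = 1 ∨ s = -1) (hα : α = s * Complex.I / 2)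
    (h : SolvedHalf s U g Γ) :
    ∃ N : Field3, IsGaugeShift α U g N ∧ ∀ x ∈ U, Γ x + N x = leviCivita g x := by
  obtain ⟨hd, hs'⟩ := h
  have hs2 : s * s = 1 := by rcases hs with rfl | rfl <;> norm_num
  -- The choice of ψ cancels the δ^l_n and metric terms of the explicit form; its Levi-Civita term
  -- then matches because (si)² = -1. The vector ξ collects the two δ^l_m terms, and V = 2Z the
  -- rest.
  obtain ⟨ξ, hξ⟩ : ∃ ξ : CovectorField, ξ = fun x m => 2 / 3 * torsionVec Γ x m
    - s * Complex.I / 6 * lower g x (torsionPseudo g Γ x) m := ⟨_, rfl⟩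
  obtain ⟨ψ, hψ⟩ : ∃ ψ : CovectorField, ψ = fun x m =>
    -(s * Complex.I / 6) * lower g x (torsionPseudo g Γ x) m := ⟨_, rfl⟩
  obtain ⟨V, hV⟩ : ∃ V : Field3, V = fun x l m n => 2 * torsionTensor g Γ x l m n := ⟨_, rfl⟩
  have hlow : ∀ x ∈ U, ∀ m, ContDiffAt ℝ ∞ (fun y => lower g y (torsionPseudo g Γ y) m) x :=
    fun x hx m => ContDiffAt.sum fun b _ => (ContDiffAt.ofReal (hg.contDiffAt hU hx m b)).mul
      (contDiffAt_torsionPseudo hU hg hΓ hx b)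
  refine ⟨fun x => projShift ξ x + vectorShift s g ψ x + tensorShift g V x,
    ⟨ξ, ?_, Or.inr (Or.inl ⟨s, hs, hα, ψ, V, ?_, ?_, ?_, fun x _ => rfl⟩)⟩, ?_⟩
  · rw [hξ]
    exact contDiffOn_pi.mpr fun m x hx =>
      ((contDiffAt_const.mul (contDiffAt_torsionVec hU hΓ hx m)).sub
        (contDiffAt_const.mul (hlow x hx m))).contDiffWithinAt
  · rw [hψ]
    exact contDiffOn_pi.mpr fun m x hx =>
      (contDiffAt_const.mul (hlow x hx m)).contDiffWithinAt
  · rw [hV]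
    exact contDiffOn_field3_iff.mpr fun l m n x hx =>
      (contDiffAt_const.mul (contDiffAt_torsionTensor hU hg hΓ hx l m n)).contDiffWithinAt
  · rw [hV]
    exact hd.const_mul 2
  · intro x hx
    funext l m n
    have hr : ∀ a, raise g x (ψ x) a = -(s * Complex.I / 6) * torsionPseudo g Γ x a := by
      intro a
      rw [← raise_lower hg hx (torsionPseudo g Γ x) a, hψ]
      simp only [raise, Finset.mul_sum]
      exact Finset.sum_congr rfl fun b _ => by ring
    have h1 : ∑ a, (epsMixed g x l m n a : ℂ) * raise g x (ψ x) a
        = -(s * Complex.I / 6) * ∑ a, (epsMixed g x l m n a : ℂ) * torsionPseudo g Γ x a := by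
      simp only [hr, Finset.mul_sum]
      exact Finset.sum_congr rfl fun b _ => by ring
    have h2 : tensorShift g V x l m n = 2 * tensorShift g (torsionTensor g Γ) x l m n := by
      rw [hV]
      simp only [tensorShift, Finset.mul_sum]
      exact Finset.sum_congr rfl fun b _ => by ring
    simp only [Pi.add_apply]
    rw [h2, vectorShift, h1, hr, hs' x hx l m n, projShift, hξ, hψ]
    linear_combination (1 / 6 * ∑ a, (epsMixed g x l m n a : ℂ) * torsionPseudo g Γ x a)
      * (s * s * Complex.I_sq - hs2)

theorem SolvedSixth.exists_shift (hU : IsOpen U) (hg : IsLorentzMetric U g)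
    (hΓ : ContDiffOn ℝ ∞ Γ U) {s : ℂ} (hs : s = 1 ∨ s = -1) (hα : α = s * Complex.I / 6)
    (h : SolvedSixth s U g Γ) :
    ∃ N : Field3, IsGaugeShift α U g N ∧ ∀ x ∈ U, Γ x + N x = leviCivita g x := by
  obtain ⟨hd, hs'⟩ := h
  obtain ⟨V, hV⟩ : ∃ V : Field3, V = fun x l m n => -(2 / 3) * torsionTensor g Γ x l m n :=
    ⟨_, rfl⟩
  refine ⟨fun x => projShift (fun x m => 2 / 3 * torsionVec Γ x m) x + tensorShiftSix g V x,
    ⟨_, ?_, Or.inr (Or.inr ⟨s, hs, hα, V, ?_, ?_, fun x _ => rfl⟩)⟩, ?_⟩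
  · exact contDiffOn_pi.mpr fun m x hx =>
      (contDiffAt_const.mul (contDiffAt_torsionVec hU hΓ hx m)).contDiffWithinAt
  · rw [hV]
    exact contDiffOn_field3_iff.mpr fun l m n x hx =>
      (contDiffAt_const.mul (contDiffAt_torsionTensor hU hg hΓ hx l m n)).contDiffWithinAt
  · rw [hV]
    exact hd.const_mul _
  · intro x hx
    funext l m n
    have h2 : tensorShiftSix g V x l m n
        = -(2 / 3) * tensorShiftSix g (torsionTensor g Γ) x l m n := by
      rw [hV]
      simp only [tensorShiftSix, Finset.mul_sum]
      exact Finset.sum_congr rfl fun b _ => by ring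
    simp only [Pi.add_apply]
    rw [h2, hs' x hx l m n, projShift]
    ring

theorem exists_shift_of_algEq (hU : IsOpen U) (hg : IsLorentzMetric U g)
    (hΓ : ContDiffOn ℝ ∞ Γ U)
    (H : ∀ x ∈ U, ∀ b, algEq α (g x) (Γ x - leviCivita g x) b = 0) :
    ∃ N : Field3, IsGaugeShift α U g N ∧ ∀ x ∈ U, Γ x + N x = leviCivita g x := by
  have hL := fun x (hx : x ∈ U) => leviCivita_symm hU hg hx
  by_cases h1 : α = Complex.I / 2
  · have hα : α = 1 * Complex.I / 2 := by rw [h1, one_mul]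
    exact (solvedHalf_of_algEq hg hL H (Or.inl rfl) hα).exists_shift hU hg hΓ (Or.inl rfl) hα
  by_cases h2 : α = -Complex.I / 2
  · have hα : α = -1 * Complex.I / 2 := by rw [h2, neg_one_mul]
    exact (solvedHalf_of_algEq hg hL H (Or.inr rfl) hα).exists_shift hU hg hΓ (Or.inr rfl) hα
  by_cases h3 : α = Complex.I / 6
  · have hα : α = 1 * Complex.I / 6 := by rw [h3, one_mul]
    exact (solvedSixth_of_algEq hg hL H (Or.inl rfl) hα).exists_shift hU hg hΓ (Or.inl rfl) hα
  by_cases h4 : α = -Complex.I / 6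
  · have hα : α = -1 * Complex.I / 6 := by rw [h4, neg_one_mul]
    exact (solvedSixth_of_algEq hg hL H (Or.inr rfl) hα).exists_shift hU hg hΓ (Or.inr rfl) hα
  exact (solvedGeneric_of_algEq hg hL H h1 h2 h3 h4).exists_shift hU hΓ

theorem isGaugeShift_zero : IsGaugeShift α U g 0 :=
  ⟨0, contDiffOn_const, Or.inl fun x _ => by funext l m n; simp [projShift]⟩

theorem curvMat_congr {Γ Γ' : Field3} {x : Coord} (h : Γ =ᶠ[𝓝 x] Γ') (a b : Fin 4) :
    curvMat Γ x a b = curvMat Γ' x a b := by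
  have h1 : ∀ c b, pdMat c (fun y => connMat (Γ y) b) x = pdMat c (fun y => connMat (Γ' y) b) x := by
    intro c b
    ext i j
    exact pd_congr (by filter_upwards [h] with y hy; rw [hy]) c
  rw [curvMat_eq, curvMat_eq, h1, h1, h.self_of_nhds]

theorem contDiffOn_leviCivita (hU : IsOpen U) (hg : IsLorentzMetric U g) :
    ContDiffOn ℝ ∞ (leviCivita g) U :=
  contDiffOn_field3_iff.mpr fun l m n _ hx =>
    (contDiffAt_leviCivita hU hg hx l m n).contDiffWithinAt

/-- Near x the connection is Γ̃ - N, and -N satisfies the same linear conditions as N, so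
`sum_densVar_curvMat_add` applies. -/
theorem metricVar_eq_of_shift (hU : IsOpen U) (hg : IsLorentzMetric U g) {N : Field3}
    (hN : IsGaugeShift α U g N) (hΓN : ∀ x ∈ U, Γ x + N x = leviCivita g x) {x : Coord}
    (hx : x ∈ U) (H : Matrix (Fin 4) (Fin 4) ℝ) :
    metricVar α (g x) Γ x H = metricVar α (g x) (leviCivita g) x H := by
  have h1 : Γ =ᶠ[𝓝 x] leviCivita g + -N := by
    filter_upwards [hU.mem_nhds hx] with y hy
    rw [Pi.add_apply, ← hΓN y hy, Pi.neg_apply, add_neg_cancel_right]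
  have hNd : ∀ y ∈ U, ∀ l m n, DifferentiableAt ℝ (fun z => (-N) z l m n) y := fun y hy l m n =>
    (ContDiffOn.component hU (hN.contDiffOn hU hg) hy l m n).neg.differentiableAt (by simp)
  simp only [metricVar, curvMat_congr h1]
  refine sum_densVar_curvMat_add hU hg hNd (fun y hy b => ?_) (fun y hy a b k => ?_) hx
    (fun l m n => (contDiffAt_leviCivita hU hg hx l m n).differentiableAt (by simp)) _
  · rw [Pi.neg_apply, algEq_neg, (hN.algEq_eq_zero hg hy).1 b, neg_zero]
  · rw [Pi.neg_apply, connMat_neg, Matrix.mul_neg, Matrix.trace_neg,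
      (hN.algEq_eq_zero hg hy).2 a b k, neg_zero]

/-- The connection equation is equivalent to the existence of a shift to Γ̃. Given the shift, the
metric equation may be evaluated at Γ̃, where it is Ricci-flatness. -/
theorem isSolution_iff_exists_shift {κ : ℝ} (hκ : 0 < κ) (hU : IsOpen U)
    (hg : IsLorentzMetric U g) (hΓ : ContDiffOn ℝ ∞ Γ U) :
    IsSolution κ α U g Γ ↔ IsRicciFlat U g ∧
      ∃ N : Field3, IsGaugeShift α U g N ∧ ∀ x ∈ U, Γ x + N x = leviCivita g x := by
  rw [isSolution_iff hκ hU hg hΓ]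
  constructor
  · rintro ⟨hA, hM⟩
    obtain ⟨N, hN, hΓN⟩ := exists_shift_of_algEq hU hg hΓ hA
    refine ⟨fun x hx => (metricEq_leviCivita_iff hU hg hx α).mp fun H hH => ?_, N, hN, hΓN⟩
    exact (metricVar_eq_of_shift hU hg hN hΓN hx H).symm.trans (hM x hx H hH)
  · rintro ⟨hR, N, hN, hΓN⟩
    refine ⟨fun x hx b => ?_, fun x hx H hH => ?_⟩
    · have h1 : Γ x - leviCivita g x = -N x := by rw [← hΓN x hx]; abel
      rw [h1, algEq_neg, (hN.algEq_eq_zero hg hx).1 b, neg_zero]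
    · rw [metricVar_eq_of_shift hU hg hN hΓN hx]
      exact (metricEq_leviCivita_iff hU hg hx α).mpr (hR x hx) H hH

end Shifts

end MetricAffine
end

theorem mainTheorem3 (κ : ℝ) (hκ : 0 < κ) (α : ℂ) (hα : α ≠ 0) (U : Set Coord) (hU : IsOpen U)
    (g : MetricField) (hg : IsLorentzMetric U g) :
    -- the available shifts of the connection are symmetries of `R + α ε R`
    (∀ Γ N : Field3, ContDiffOn ℝ ∞ Γ U → IsGaugeShift α U g N →
      ∀ x ∈ U, lagrangian α g (Γ + N) x = lagrangian α g Γ x) ∧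
    -- the solutions are the Ricci-flat metrics with a connection that a symmetry brings to the
    -- Levi-Civita connection
    (∀ Γ : Field3, ContDiffOn ℝ ∞ Γ U →
      (IsSolution κ α U g Γ ↔
        IsRicciFlat U g ∧
          ∃ N : Field3, IsGaugeShift α U g N ∧ ∀ x ∈ U, Γ x + N x = leviCivita g x)) ∧
    -- the explicit form of the solution connections
    (∀ Γ : Field3, ContDiffOn ℝ ∞ Γ U → IsSolution κ α U g Γ →
      (α ≠ Complex.I / 2 → α ≠ -Complex.I / 2 → α ≠ Complex.I / 6 → α ≠ -Complex.I / 6 →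
        SolvedGeneric U g Γ) ∧
      (∀ s : ℂ, s = 1 ∨ s = -1 → α = s * Complex.I / 2 → SolvedHalf s U g Γ) ∧
      (∀ s : ℂ, s = 1 ∨ s = -1 → α = s * Complex.I / 6 → SolvedSixth s U g Γ)) ∧
    -- equivalence with vacuum general relativity
    ((∃ Γ : Field3, ContDiffOn ℝ ∞ Γ U ∧ IsSolution κ α U g Γ) ↔ IsRicciFlat U g) ∧
    (IsSolution κ α U g (leviCivita g) ↔ IsRicciFlat U g) := by
  have hLC := contDiffOn_leviCivita hU hg
  have hfix : IsSolution κ α U g (leviCivita g) ↔ IsRicciFlat U g := by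
    rw [isSolution_iff_exists_shift hκ hU hg hLC]
    exact ⟨fun h => h.1, fun h => ⟨h, 0, isGaugeShift_zero, fun x _ => add_zero _⟩⟩
  refine ⟨fun Γ N hΓ hN x hx => ?_, fun Γ hΓ => isSolution_iff_exists_shift hκ hU hg hΓ,
    fun Γ hΓ hsol => ?_, ⟨fun ⟨Γ, hΓ, hsol⟩ => ?_, fun h => ⟨_, hLC, hfix.mpr h⟩⟩, hfix⟩
  · exact lagrangian_add_eq hU hg hx
      (fun l m n => (ContDiffOn.component hU hΓ hx l m n).differentiableAt (by simp))
      (fun l m n => (ContDiffOn.component hU (hN.contDiffOn hU hg) hx l m n).differentiableAt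
        (by simp))
      (hN.algEq_eq_zero hg hx).1 fun y hy => (hN.algEq_eq_zero hg hy).2
  · have hL := fun x (hx : x ∈ U) => leviCivita_symm hU hg hx
    have hA := ((isSolution_iff hκ hU hg hΓ).mp hsol).1
    exact ⟨solvedGeneric_of_algEq hg hL hA, fun s hs hα => solvedHalf_of_algEq hg hL hA hs hα,
      fun s hs hα => solvedSixth_of_algEq hg hL hA hs hα⟩
  · exact ((isSolution_iff_exists_shift hκ hU hg hΓ).mp hsol).1
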